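/- **Setting.** Let $\mathfrak{osp}(1|2)$ be the complex Lie superalgebra with even basis elements $X,Y,H$, odd basis elements $F,G$ and nonzero brackets $[H,X]=2X$, $[H,Y]=-2Y$, $[X,Y]=H$, $[H,F]=-F$, $[H,G]=G$, $[G,F]=H$, $[G,G]=2X$, $[F,F]=-2Y$, $[G,Y]=F$, $[F,X]=G$ (and those that follow by super-antisymmetry). In its enveloping superalgebra put $\tau=H+\tfrac12-2FG$. Let $\lambda\in\mathbb C$, $\lambda\notin\mathbb Z_{\ge0}\cup\{-\tfrac12\}$, and let $B_\lambda=U(\mathfrak{osp}(1|2))/\mathfrak m_\lambda$, where $\mathfrak m_\lambda$ is the two-sided ideal generated by $\tau^2-(\lambda+\tfrac12)^2$. Let $u\mapsto u^t$ be the linear map of $B_\lambda$ with $H^t=H$, $F^t=G$, $G^t=-F$ and $(uv)^t=(-1)^{p(u)p(v)}v^tu^t$ for homogeneous $u,v$ ($p$ is the parity), and let $(B_\lambda)_i=\{u: Hu-uH=iu\}$ for $i\in\mathbb Z$. A *supertrace* is a linear functional on $B_\lambda$ that vanishes on all supercommutators. Let $\mathbb C[H,\tau]$ be the commutative algebra with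 $\tau^2=(\lambda+\tfrac12)^2$, and let the degree of a nonzero element be the largest degree of a monomial $H^n$ or $H^n\tau$ occurring in it, where $\deg H=2$, $\deg\tau=1$ (the zero polynomial has degree less than every $k\ge0$). Substituting the elements $H,\tau$ of $B_\lambda$ makes every polynomial $f$ an element of $B_\lambda$. For $f\in\mathbb C[H,\tau]$, $f=f(H,\tau)$, put $$\Delta f=f(H+1,-\tau)-f,\quad \nabla f=f-f(H-1,-\tau),\quad \Delta_2f=f(H+2,\tau)-f,\quad \nabla_2f=f-f(H-2,\tau).$$ Define $f_{k,j}\in\mathbb C[H,\tau]$ for integers $k,j\ge0$ by (for all $i\ge0$) $$f_{k,2i}\,G^{2i}=\begin{cases}(\operatorname{ad}F)^k(G^{2i+k})& k\text{ even}\\(\operatorname{ad}F)^k(G^{2i+k}\tau)&k\text{ odd,}\end{cases}\qquad f_{k,2i+1}\,G^{2i+1}=\begin{cases}(\operatorname{ad}F)^{k+1}(G^{2i+k+2})& k\text{ even}\\(\operatorname{ad}F)^{k-1}(G^{2i+k}\tau)&k\text{ odd,}\end{cases}$$ where $(\operatorname{ad}F)(u)=Fu-(-1)^{p(u)}uF$.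 Let $(a)_n=a(a+1)\cdots(a+n-1)$. Given a supertrace $L$, put $\langle u,v\rangle=L(uv^t)$ and, for $j\ge0$, $\langle f,g\rangle_j=\langle fG^j,gG^j\rangle$ and $\langle f,g\rangle_{-j}=\langle fF^j,gF^j\rangle$ (for $j=0$ the two definitions agree). A sequence $(g_k)_{k\ge0}$ is called *orthogonal* for one of these forms if it is a basis of $\mathbb C[H,\tau]$, $\deg g_k=k$ for all $k$, each $g_k$ is orthogonal to all polynomials of degree less than $k$, and $g_k,g_l$ are orthogonal for $k\ne l$. **Theorem 2.2.** There is exactly one supertrace $\mathrm{str}$ on $B_\lambda$ with $\mathrm{str}(1)=1$ (so every supertrace is a multiple of it), and the polynomials $f_{k,j}$ exist and are unique. For every supertrace $L$ (in particular for $L=\mathrm{str}$) the statements 1), 2), 5) hold; moreover 3), 4), 6)–9) hold for all integers $k,i\ge0$. 1) $\langle (B_\lambda)_i,(B_\lambda)_j\rangle=0$ for integers $i\ne j$. 2) For every $j\ge0$ the sequence $(f_{k,j})_{k\ge0}$ is orthogonal for $\langle\cdot,\cdot\rangle_j$; in particular $\deg f_{k,j}=k$. 3) $f=f_{k,2i}$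 satisfies $(H-\tau+\frac12)\Delta\nabla f+2(H-i)\nabla f+(2i+\frac12)f=(-1)^k(2i+k+\frac12)f$. 4) $f=f_{k,2i+1}$ satisfies $(H-\tau+\frac12)\Delta\nabla f+2(H-\tau-i-\frac12)\nabla f+(2i+\frac52)f=c\,f$ with $c=2i+k+\frac52$ for $k$ even and $c=-(2i+k+\frac12)$ for $k$ odd. 5) For every $j\ge0$ the sequence $(f_{k,j}(-H,\tau))_{k\ge0}$ is orthogonal for $\langle\cdot,\cdot\rangle_{-j}$. 6) $f=f_{k,2i}$ satisfies $\big[(H+1)^2-(\tau+\frac12)^2\big]\Delta_2\nabla_2f+4(i+1)(H-i)\nabla_2f+4i(i+1)f=c\,f$ with $c=(2i+k)(2i+k+2)$ for $k$ even and $c=(2i+k-1)(2i+k+1)$ for $k$ odd. 7) $f=f_{k,2i+1}$ satisfies $\big[(H+1)^2-(\tau+\frac12)^2\big]\Delta_2\nabla_2f+\big[(2i+3)(2H-2i-1)-2\tau\big]\nabla_2f+(2i+1)(2i+3)f=c\,f$ with $c=(2i+k+1)(2i+k+3)$ for $k$ even and $c=(2i+k)(2i+k+2)$ for $k$ odd.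 8) The $f_{k,2i}$ are Hahn polynomials with parameter $\tau$: $$f_{2k,2i}=(i+1)_k(i+\tfrac12-\tau)_k\;{}_3F_2\!\left(\begin{matrix}-k,\;k+2i+1,\;\frac12(2i+\frac12-\tau-H)\\ i+1,\;i+\frac12-\tau\end{matrix}\,\Big|\,1\right),$$ $$f_{2k+1,2i}=\tfrac12\big[(2k+2i+1)\tau-2(\lambda+\tfrac12)^2\big]f_{2k,2i}.$$ 9) The $f_{k,2i+1}$ are Hahn polynomials with parameter $\tau$: $$f_{2k,2i+1}=(i+k+1)\,(i+2)_k(i+\tfrac32-\tau)_k\;{}_3F_2\!\left(\begin{matrix}-k,\;k+2i+2,\;\frac12(2i+\frac52-\tau-H)\\ i+2,\;i+\frac32-\tau\end{matrix}\,\Big|\,1\right),$$ $$f_{2k+1,2i+1}=-\frac{\tau}{i+k+1}\,f_{2k,2i+1}.$$ Here, with $(d)_k(e)_k$ the Pochhammer prefactor, $(d)_k(e)_k\,{}_3F_2(-k,b,c;d,e\,|\,1)$ stands for $\sum_{n=0}^k\frac{(-k)_n(b)_n(c)_n}{n!}(d+n)_{k-n}(e+n)_{k-n}$. If $\lambda$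 is not a negative integer, then $(d)_k$ and $(e)_k$ are invertible in $\mathbb C[H,\tau]$ and this is literally the product of $(d)_k(e)_k$ with ${}_3F_2=\sum_n\frac{(-k)_n(b)_n(c)_n}{(d)_n(e)_n\,n!}$. -/

import Mathlib

/-! ### The Lie superalgebra `osp(1|2)` and its enveloping superalgebra -/

/-- The standard basis of `osp(1|2)`: `X, Y, H` are even, `F, G` are odd. -/
inductive OspGen : Type
  | X | Y | H | F | G
  deriving DecidableEq

instance : Fintype OspGen where
  elems := {.X, .Y, .H, .F, .G}
  complete := by rintro (_ | _ | _ | _ | _) <;> decide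

namespace Osp12

/-- The parity of a basis element. -/
def parity : OspGen → ℕ
  | .X => 0
  | .Y => 0
  | .H => 0
  | .F => 1
  | .G => 1

/-- The basis of `osp(1|2)` as matrices inside `gl(1|2)`; the index `1` is the index of the
one-dimensional part, so that `X, Y, H` are even and `F, G` are odd. -/
def mat : OspGen → Matrix (Fin 3) (Fin 3) ℤ
  | .X => !![0, 0, -1; 0, 0, 0; 0, 0, 0]
  | .Y => !![0, 0, 0; 0, 0, 0; -1, 0, 0]
  | .H => !![1, 0, 0; 0, 0, 0; 0, 0, -1]
  | .F => !![0, 0, 0; 1, 0, 0; 0, 1, 0]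
  | .G => !![0, 1, 0; 0, 0, -1; 0, 0, 0]

/-- The structure constants of `osp(1|2)`: `[a, b] = ∑ c, coeff a b c • c`. -/
def coeff : OspGen → OspGen → OspGen → ℤ
  | .H, .X, .X => 2
  | .X, .H, .X => -2
  | .H, .Y, .Y => -2
  | .Y, .H, .Y => 2
  | .X, .Y, .H => 1
  | .Y, .X, .H => -1
  | .H, .F, .F => -1
  | .F, .H, .F => 1
  | .H, .G, .G => 1
  | .G, .H, .G => -1
  | .G, .F, .H => 1
  | .F, .G, .H => 1
  | .G, .G, .X => 2
  | .F, .F, .Y => -2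
  | .G, .Y, .F => 1
  | .Y, .G, .F => -1
  | .F, .X, .G => 1
  | .X, .F, .G => -1
  | _, _, _ => 0

/-- The structure constants are those of the supercommutator of the matrices `mat`. -/
theorem mat_bracket (a b : OspGen) :
    mat a * mat b - (-1) ^ (parity a * parity b) • (mat b * mat a) =
      ∑ c, coeff a b c • mat c := by
  revert a b
  decide

/-- The defining relations `a b - (-1)^{p(a)p(b)} b a = [a, b]` of `U(osp(1|2))`. -/
inductive EnvRel : FreeAlgebra ℂ OspGen → FreeAlgebra ℂ OspGen → Prop
  | bracket (a b : OspGen) :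
      EnvRel
        (FreeAlgebra.ι ℂ a * FreeAlgebra.ι ℂ b -
          (-1 : ℂ) ^ (parity a * parity b) • (FreeAlgebra.ι ℂ b * FreeAlgebra.ι ℂ a))
        (∑ c, (coeff a b c : ℂ) • FreeAlgebra.ι ℂ c)

/-- The universal enveloping superalgebra `U(osp(1|2))` over `ℂ`. -/
def U : Type := RingQuot EnvRel

noncomputable instance : Ring U := inferInstanceAs (Ring (RingQuot EnvRel))

noncomputable instance : Algebra ℂ U := inferInstanceAs (Algebra ℂ (RingQuot EnvRel))

/-- The canonical map from the free algebra onto `U(osp(1|2))`. -/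
noncomputable def uMk : FreeAlgebra ℂ OspGen →ₐ[ℂ] U := RingQuot.mkAlgHom ℂ EnvRel

/-- The universal property of `U(osp(1|2))`. -/
noncomputable def uLift {A : Type*} [Ring A] [Algebra ℂ A] (g : FreeAlgebra ℂ OspGen →ₐ[ℂ] A)
    (h : ∀ ⦃x y⦄, EnvRel x y → g x = g y) : U →ₐ[ℂ] A :=
  RingQuot.liftAlgHom ℂ ⟨g, h⟩

theorem uMk_rel {x y : FreeAlgebra ℂ OspGen} (h : EnvRel x y) : uMk x = uMk y :=
  RingQuot.mkAlgHom_rel ℂ h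

theorem uLift_uMk {A : Type*} [Ring A] [Algebra ℂ A] (g : FreeAlgebra ℂ OspGen →ₐ[ℂ] A)
    (h : ∀ ⦃x y⦄, EnvRel x y → g x = g y) (x : FreeAlgebra ℂ OspGen) : uLift g h (uMk x) = g x :=
  RingQuot.liftAlgHom_mkAlgHom_apply ℂ g h x

/-- The image of a basis element in `U(osp(1|2))`. -/
noncomputable def uGen (a : OspGen) : U := uMk (FreeAlgebra.ι ℂ a)

/-- The element `τ = H + 1/2 - 2 F G` of `U(osp(1|2))`. -/
noncomputable def uTau : U :=
  uGen .H + algebraMap ℂ U (1 / 2) - 2 * (uGen .F * uGen .G)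

/-- The relation `τ² = (λ + 1/2)²`. -/
inductive TauRel (lam : ℂ) : U → U → Prop
  | tau_sq : TauRel lam (uTau ^ 2) (algebraMap ℂ U ((lam + 1 / 2) ^ 2))

/-- `B_λ = U(osp(1|2)) / 𝔪_λ`, the quotient by the two-sided ideal generated by
`τ² - (λ + 1/2)²` (to be used for `λ ∉ ℤ_{≥0} ∪ {-1/2}`). -/
def B (lam : ℂ) : Type := RingQuot (TauRel lam)

noncomputable instance (lam : ℂ) : Ring (B lam) := inferInstanceAs (Ring (RingQuot (TauRel lam)))

noncomputable instance (lam : ℂ) : Algebra ℂ (B lam) :=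
  inferInstanceAs (Algebra ℂ (RingQuot (TauRel lam)))

/-- The canonical map from `U(osp(1|2))` onto `B_λ`. -/
noncomputable def mk (lam : ℂ) : U →ₐ[ℂ] B lam := RingQuot.mkAlgHom ℂ (TauRel lam)

theorem mk_rel {lam : ℂ} {x y : U} (h : TauRel lam x y) : mk lam x = mk lam y :=
  RingQuot.mkAlgHom_rel ℂ h

/-- The image of a basis element in `B_λ`. -/
noncomputable def gen (lam : ℂ) (a : OspGen) : B lam := mk lam (uGen a)

/-- The element `τ` of `B_λ`. -/
noncomputable def tau (lam : ℂ) : B lam := mk lam uTau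

theorem tau_eq (lam : ℂ) :
    tau lam = gen lam .H + algebraMap ℂ (B lam) (1 / 2) - 2 * (gen lam .F * gen lam .G) := by
  simp only [tau, uTau, gen, map_sub, map_add, map_mul, AlgHom.commutes, map_ofNat]

theorem gen_bracket (lam : ℂ) (a b : OspGen) :
    gen lam a * gen lam b - (-1 : ℂ) ^ (parity a * parity b) • (gen lam b * gen lam a) =
      ∑ c, (coeff a b c : ℂ) • gen lam c := by
  have h := congrArg (mk lam) (uMk_rel (EnvRel.bracket a b))
  simp only [map_sub, map_smul, map_mul, map_sum] at h
  exact h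

theorem tau_sq (lam : ℂ) : tau lam ^ 2 = algebraMap ℂ (B lam) ((lam + 1 / 2) ^ 2) := by
  have h := mk_rel (TauRel.tau_sq (lam := lam))
  rw [map_pow, AlgHom.commutes] at h
  exact h

/-- Algebra maps out of `B_λ` are given by the images of the five generators. -/
noncomputable def lift {A : Type*} [Ring A] [Algebra ℂ A] (lam : ℂ) (φ : OspGen → A)
    (h₁ : ∀ a b, φ a * φ b - (-1 : ℂ) ^ (parity a * parity b) • (φ b * φ a) =
      ∑ c, (coeff a b c : ℂ) • φ c)
    (h₂ : (φ .H + algebraMap ℂ A (1 / 2) - 2 * (φ .F * φ .G)) ^ 2 =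
      algebraMap ℂ A ((lam + 1 / 2) ^ 2)) : B lam →ₐ[ℂ] A :=
  RingQuot.liftAlgHom ℂ ⟨uLift (FreeAlgebra.lift ℂ φ) (by
    rintro _ _ ⟨a, b⟩
    simpa using h₁ a b), by
    rintro _ _ ⟨⟩
    simp only [uTau, uGen, map_pow, map_sub, map_add, map_mul, AlgHom.commutes, map_ofNat,
      uLift_uMk, FreeAlgebra.lift_ι_apply] at h₂ ⊢
    exact h₂⟩

theorem lift_gen {A : Type*} [Ring A] [Algebra ℂ A] (lam : ℂ) (φ : OspGen → A)
    (h₁ : ∀ a b, φ a * φ b - (-1 : ℂ) ^ (parity a * parity b) • (φ b * φ a) =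
      ∑ c, (coeff a b c : ℂ) • φ c)
    (h₂ : (φ .H + algebraMap ℂ A (1 / 2) - 2 * (φ .F * φ .G)) ^ 2 =
      algebraMap ℂ A ((lam + 1 / 2) ^ 2)) (a : OspGen) :
    lift lam φ h₁ h₂ (gen lam a) = φ a := by
  have h := RingQuot.liftAlgHom_mkAlgHom_apply ℂ (uLift (FreeAlgebra.lift ℂ φ) (by
    rintro _ _ ⟨a, b⟩
    simpa using h₁ a b)) (s := TauRel lam) (by
    rintro _ _ ⟨⟩
    simp only [uTau, uGen, map_pow, map_sub, map_add, map_mul, AlgHom.commutes, map_ofNat,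
      uLift_uMk, FreeAlgebra.lift_ι_apply] at h₂ ⊢
    exact h₂) (uGen a)
  refine Eq.trans h ?_
  rw [uGen, uLift_uMk, FreeAlgebra.lift_ι_apply]

theorem coeff_parity (a b c : OspGen) :
    coeff a b c * (-1) ^ parity c = coeff a b c * (-1) ^ (parity a + parity b) := by
  revert a b c
  decide

/-- The parity automorphism `σ` of `B_λ`: it is `1` on the even and `-1` on the odd generators. -/
noncomputable def parityAut (lam : ℂ) : B lam →ₐ[ℂ] B lam :=
  lift lam (fun a => (-1 : ℂ) ^ parity a • gen lam a)
    (by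
      intro a b
      have h : ∀ c, (coeff a b c : ℂ) * (-1) ^ parity c =
          (-1) ^ (parity a + parity b) * coeff a b c := by
        intro c
        rw [mul_comm ((-1 : ℂ) ^ _)]
        exact_mod_cast coeff_parity a b c
      simp only [smul_smul, h]
      simp only [mul_smul ((-1 : ℂ) ^ (parity a + parity b)), ← Finset.smul_sum]
      rw [← gen_bracket]
      simp only [smul_mul_smul_comm, smul_sub, smul_smul, pow_add]
      congr 2
      ring)
    (by
      rw [← tau_sq, tau_eq]
      simp [parity])

@[simp] theorem parityAut_gen (lam : ℂ) (a : OspGen) :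
    parityAut lam (gen lam a) = (-1 : ℂ) ^ parity a • gen lam a :=
  lift_gen ..

/-- `u ∈ B_λ` is homogeneous of parity `p` (`p` is read modulo `2`). -/
def IsHomog {lam : ℂ} (p : ℕ) (u : B lam) : Prop := parityAut lam u = (-1 : ℂ) ^ p • u

/-- The involution of the basis underlying the antiautomorphism `t`. -/
def swap : OspGen → OspGen
  | .X => .Y
  | .Y => .X
  | .H => .H
  | .F => .G
  | .G => .F

/-- The scalars in the definition of `ordTranspose`. -/
noncomputable def swapCoeff : OspGen → ℂ
  | .X => 1
  | .Y => 1
  | .H => 1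
  | .F => -Complex.I
  | .G => Complex.I

theorem coeff_swap (a b c : OspGen) :
    (coeff (swap b) (swap a) (swap c) : ℂ) * (swapCoeff a * swapCoeff b) =
      coeff a b c * swapCoeff c := by
  cases a <;> cases b <;> cases c <;> simp [coeff, swap, swapCoeff]

/-- The ordinary (unsigned) antiautomorphism of `B_λ` with
`X ↦ Y, Y ↦ X, H ↦ H, F ↦ -√-1 G, G ↦ √-1 F`. -/
noncomputable def ordTranspose (lam : ℂ) : B lam →ₐ[ℂ] (B lam)ᵐᵒᵖ :=
  lift lam (fun a => MulOpposite.op (swapCoeff a • gen lam (swap a)))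
    (by
      intro a b
      apply MulOpposite.unop_injective
      have hsw : Function.Involutive swap := by intro x; cases x <;> rfl
      have hp : ∀ x, parity (swap x) = parity x := by intro x; cases x <;> rfl
      simp only [MulOpposite.unop_sub, MulOpposite.unop_mul, MulOpposite.unop_smul,
        MulOpposite.unop_op, Finset.unop_sum, smul_smul, ← coeff_swap]
      rw [hsw.bijective.sum_comp
        (fun c => ((coeff (swap b) (swap a) c : ℂ) * (swapCoeff a * swapCoeff b)) • gen lam c)]
      simp only [mul_comm _ (swapCoeff a * swapCoeff b), mul_smul (swapCoeff a * swapCoeff b),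
        ← Finset.smul_sum]
      rw [← gen_bracket, hp, hp]
      simp only [smul_mul_smul_comm, smul_sub, smul_smul]
      congr 2 <;> ring_nf)
    (by
      apply MulOpposite.unop_injective
      have h2 : MulOpposite.unop (2 : (B lam)ᵐᵒᵖ) = 2 := rfl
      have hc : (2 : B lam) * (gen lam .F * gen lam .G) = gen lam .F * gen lam .G * 2 :=
        ((Commute.ofNat_left 2 _) : _)
      simp only [MulOpposite.unop_pow, MulOpposite.unop_sub, MulOpposite.unop_add,
        MulOpposite.unop_mul, MulOpposite.unop_op, MulOpposite.algebraMap_apply, h2]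
      rw [← tau_sq, tau_eq, hc]
      simp [swap, swapCoeff, smul_smul])

/-- The antiautomorphism `u ↦ u^t` of the superalgebra `B_λ`, i.e. the linear map with
`H^t = H`, `F^t = G`, `G^t = -F` and `(uv)^t = (-1)^{p(u)p(v)} v^t u^t` for homogeneous `u, v`
(see `transpose_H`, `transpose_F`, `transpose_G`, `transpose_mul` below). It is obtained from
the unsigned antiautomorphism by multiplying its values on odd elements by `√-1`. -/
noncomputable def transpose (lam : ℂ) : B lam →ₗ[ℂ] B lam where
  toFun u :=
    (1 / 2 : ℂ) • (ordTranspose lam (u + parityAut lam u)).unop +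
      (Complex.I / 2) • (ordTranspose lam (u - parityAut lam u)).unop
  map_add' u v := by
    simp only [map_add, map_sub, MulOpposite.unop_add, MulOpposite.unop_sub]
    module
  map_smul' r u := by
    simp only [map_add, map_sub, map_smul, MulOpposite.unop_add, MulOpposite.unop_sub,
      MulOpposite.unop_smul, RingHom.id_apply]
    module

theorem transpose_even {lam : ℂ} {p : ℕ} (hp : Even p) {u : B lam} (hu : IsHomog p u) :
    transpose lam u = (ordTranspose lam u).unop := by
  have h : parityAut lam u = u := by rw [hu, hp.neg_one_pow, one_smul]
  simp only [transpose, LinearMap.coe_mk, AddHom.coe_mk, h, sub_self, map_zero, map_add,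
    MulOpposite.unop_zero, MulOpposite.unop_add]
  module

theorem transpose_odd {lam : ℂ} {p : ℕ} (hp : Odd p) {u : B lam} (hu : IsHomog p u) :
    transpose lam u = Complex.I • (ordTranspose lam u).unop := by
  have h : parityAut lam u = -u := by rw [hu, hp.neg_one_pow, neg_one_smul]
  simp only [transpose, LinearMap.coe_mk, AddHom.coe_mk, h, add_neg_cancel, sub_neg_eq_add]
  simp only [map_zero, map_add, MulOpposite.unop_zero, MulOpposite.unop_add]
  module

theorem isHomog_gen (lam : ℂ) (a : OspGen) : IsHomog (parity a) (gen lam a) := parityAut_gen lam a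

theorem IsHomog.mul {lam : ℂ} {p q : ℕ} {u v : B lam} (hu : IsHomog p u) (hv : IsHomog q v) :
    IsHomog (p + q) (u * v) := by
  unfold IsHomog at *
  rw [map_mul, hu, hv, smul_mul_smul_comm, pow_add]

theorem transpose_mul {lam : ℂ} {p q : ℕ} {u v : B lam} (hu : IsHomog p u) (hv : IsHomog q v) :
    transpose lam (u * v) = (-1 : ℂ) ^ (p * q) • (transpose lam v * transpose lam u) := by
  rcases Nat.even_or_odd p with hp | hp <;> rcases Nat.even_or_odd q with hq | hq
  · rw [transpose_even (hp.add hq) (hu.mul hv), transpose_even hp hu, transpose_even hq hv,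
      (hp.mul_right q).neg_one_pow, one_smul, map_mul, MulOpposite.unop_mul]
  · rw [transpose_odd (hp.add_odd hq) (hu.mul hv), transpose_even hp hu, transpose_odd hq hv,
      (hp.mul_right q).neg_one_pow, one_smul, map_mul, MulOpposite.unop_mul, smul_mul_assoc]
  · rw [transpose_odd (hp.add_even hq) (hu.mul hv), transpose_odd hp hu, transpose_even hq hv,
      (hq.mul_left p).neg_one_pow, one_smul, map_mul, MulOpposite.unop_mul, mul_smul_comm]
  · rw [transpose_even (hp.add_odd hq) (hu.mul hv), transpose_odd hp hu, transpose_odd hq hv,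
      (hp.mul hq).neg_one_pow, map_mul, MulOpposite.unop_mul, smul_mul_smul_comm,
      Complex.I_mul_I, smul_smul]
    simp

theorem ordTranspose_gen (lam : ℂ) (a : OspGen) :
    (ordTranspose lam (gen lam a)).unop = swapCoeff a • gen lam (swap a) := by
  rw [ordTranspose, lift_gen, MulOpposite.unop_op]

theorem transpose_H (lam : ℂ) : transpose lam (gen lam .H) = gen lam .H := by
  rw [transpose_even (by decide) (isHomog_gen lam .H), ordTranspose_gen]
  simp [swap, swapCoeff]

theorem transpose_F (lam : ℂ) : transpose lam (gen lam .F) = gen lam .G := by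
  rw [transpose_odd (by decide) (isHomog_gen lam .F), ordTranspose_gen]
  simp [swap, swapCoeff, smul_smul]

theorem transpose_G (lam : ℂ) : transpose lam (gen lam .G) = -gen lam .F := by
  rw [transpose_odd (by decide) (isHomog_gen lam .G), ordTranspose_gen]
  simp [swap, swapCoeff, smul_smul]

/-! ### Supertraces, the bilinear form, the grading, the adjoint action of `F` -/

/-- An invariant functional (supertrace): `L` vanishes on all supercommutators
`[u, v] = uv - (-1)^{p(u)p(v)} vu` of homogeneous elements. -/
def IsSupertrace {lam : ℂ} (L : B lam →ₗ[ℂ] ℂ) : Prop :=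
  ∀ (p q : ℕ) (u v : B lam), IsHomog p u → IsHomog q v →
    L (u * v - (-1 : ℂ) ^ (p * q) • (v * u)) = 0

/-- The bilinear form `⟨u, v⟩ = L(u v^t)`. -/
noncomputable def form {lam : ℂ} (L : B lam →ₗ[ℂ] ℂ) (u v : B lam) : ℂ :=
  L (u * transpose lam v)

/-- The graded piece `(B_λ)_i = {u | [H, u] = i u}`. -/
def weightSpace (lam : ℂ) (i : ℤ) : Submodule ℂ (B lam) where
  carrier := {u | gen lam .H * u - u * gen lam .H = (i : ℂ) • u}
  add_mem' {u v} hu hv := by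
    simp only [Set.mem_ofPred_eq] at *
    rw [smul_add, ← hu, ← hv]
    noncomm_ring
  zero_mem' := by simp
  smul_mem' r u hu := by
    simp only [Set.mem_ofPred_eq] at *
    rw [smul_comm, ← hu, mul_smul_comm, smul_mul_assoc, smul_sub]

/-- The supercommutator `(ad F)(u) = [F, u]`, equal to `F u - (-1)^{p(u)} u F` on homogeneous
`u`. -/
noncomputable def adF (lam : ℂ) (u : B lam) : B lam :=
  gen lam .F * u - parityAut lam u * gen lam .F

theorem adF_homog {lam : ℂ} {p : ℕ} {u : B lam} (hu : IsHomog p u) :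
    adF lam u = gen lam .F * u - (-1 : ℂ) ^ p • (u * gen lam .F) := by
  rw [adF, hu, smul_mul_assoc]

/-! ### Polynomials in `H` and `τ` -/

/-- The ring `ℂ[τ]` with `τ² = (λ + 1/2)²`. -/
abbrev TauRing (lam : ℂ) : Type := QuadraticAlgebra ℂ ((lam + 1 / 2) ^ 2) 0

/-- The ring `ℂ[H, τ]` with `τ² = (λ + 1/2)²`: polynomials in `H` over `TauRing`. -/
abbrev Poly (lam : ℂ) : Type := Polynomial (TauRing lam)

/-- The variable `H`. -/
noncomputable def pH (lam : ℂ) : Poly lam := Polynomial.X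

/-- The variable `τ`. -/
noncomputable def pTau (lam : ℂ) : Poly lam := Polynomial.C ⟨0, 1⟩

theorem pTau_sq (lam : ℂ) : pTau lam ^ 2 = algebraMap ℂ (Poly lam) ((lam + 1 / 2) ^ 2) := by
  rw [pTau, ← Polynomial.C_pow, IsScalarTower.algebraMap_apply ℂ (TauRing lam) (Poly lam),
    Polynomial.algebraMap_eq]
  congr 1
  ext <;> simp [pow_two]

/-- The value of a polynomial at the elements `H` and `τ` (which commute) of `B_λ`: the term
`(a + b τ) H^n` goes to the same expression in `B_λ`. -/
noncomputable def ev {lam : ℂ} (f : Poly lam) : B lam :=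
  f.sum fun n z => (z.re • 1 + z.im • tau lam) * gen lam .H ^ n

/-- The degree of a polynomial in `H` and `τ` for `deg H = 2`, `deg τ = 1`: the largest degree of
the monomials `H^n`, `H^n τ` occurring in it (`⊥` for the zero polynomial). -/
noncomputable def wdeg {lam : ℂ} (f : Poly lam) : WithBot ℕ :=
  f.support.sup fun n =>
    (if (f.coeff n).re = 0 then ⊥ else ((2 * n : ℕ) : WithBot ℕ)) ⊔
      (if (f.coeff n).im = 0 then ⊥ else ((2 * n + 1 : ℕ) : WithBot ℕ))

/-- The substitution `f(H, τ) ↦ f(H + a, τ)`. -/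
noncomputable def shift {lam : ℂ} (a : ℂ) (f : Poly lam) : Poly lam :=
  f.comp (pH lam + algebraMap ℂ (Poly lam) a)

/-- The substitution `f(H, τ) ↦ f(H, -τ)`. -/
noncomputable def conj {lam : ℂ} (f : Poly lam) : Poly lam :=
  f.map (starRingEnd (TauRing lam))

/-- The substitution `f(H, τ) ↦ f(-H, τ)`. -/
noncomputable def reflect {lam : ℂ} (f : Poly lam) : Poly lam := f.comp (-pH lam)

/-- `Δf = f(H + 1, -τ) - f(H, τ)`. -/
noncomputable def Del {lam : ℂ} (f : Poly lam) : Poly lam := conj (shift 1 f) - f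

/-- `∇f = f(H, τ) - f(H - 1, -τ)`. -/
noncomputable def Nab {lam : ℂ} (f : Poly lam) : Poly lam := f - conj (shift (-1) f)

/-- `Δ₂f = f(H + 2, τ) - f(H, τ)`. -/
noncomputable def Del2 {lam : ℂ} (f : Poly lam) : Poly lam := shift 2 f - f

/-- `∇₂f = f(H, τ) - f(H - 2, τ)`. -/
noncomputable def Nab2 {lam : ℂ} (f : Poly lam) : Poly lam := f - shift (-2) f

theorem Del_pH (lam : ℂ) : Del (pH lam) = 1 := by
  simp [Del, conj, shift, pH, Polynomial.algebraMap_apply]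

theorem Del_pTau (lam : ℂ) : Del (pTau lam) = -2 * pTau lam := by
  have h : (star (⟨0, 1⟩ : TauRing lam)) = -⟨0, 1⟩ := by ext <;> simp
  simp only [Del, conj, shift, pTau, Polynomial.C_comp, Polynomial.map_C, starRingEnd_apply, h,
    Polynomial.C_neg]
  ring

theorem Del_mul {lam : ℂ} (f g : Poly lam) :
    Del (f * g) = Del f * g + f * Del g + Del f * Del g := by
  simp only [Del, conj, shift, Polynomial.mul_comp, Polynomial.map_mul]
  ring

theorem Nab_pH (lam : ℂ) : Nab (pH lam) = 1 := by
  simp [Nab, conj, shift, pH, Polynomial.algebraMap_apply]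

theorem Nab_pTau (lam : ℂ) : Nab (pTau lam) = 2 * pTau lam := by
  have h : (star (⟨0, 1⟩ : TauRing lam)) = -⟨0, 1⟩ := by ext <;> simp
  simp only [Nab, conj, shift, pTau, Polynomial.C_comp, Polynomial.map_C, starRingEnd_apply, h,
    Polynomial.C_neg]
  ring

theorem Nab_mul {lam : ℂ} (f g : Poly lam) :
    Nab (f * g) = Nab f * g + f * Nab g - Nab f * Nab g := by
  simp only [Nab, conj, shift, Polynomial.mul_comp, Polynomial.map_mul]
  ring

/-- The constant polynomial with value `a`. -/
noncomputable def cst (lam : ℂ) (a : ℂ) : Poly lam := algebraMap ℂ (Poly lam) a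

/-- The form `⟨f, g⟩_i = ⟨f G^i, g G^i⟩`. -/
noncomputable def formPos {lam : ℂ} (L : B lam →ₗ[ℂ] ℂ) (i : ℕ) (f g : Poly lam) : ℂ :=
  form L (ev f * gen lam .G ^ i) (ev g * gen lam .G ^ i)

/-- The form `⟨f, g⟩_{-i} = ⟨f F^i, g F^i⟩`. -/
noncomputable def formNeg {lam : ℂ} (L : B lam →ₗ[ℂ] ℂ) (i : ℕ) (f g : Poly lam) : ℂ :=
  form L (ev f * gen lam .F ^ i) (ev g * gen lam .F ^ i)

/-- `f₀, f₁, f₂, …` are orthogonal polynomials for the form `β`: they are a basis of `ℂ[H, τ]`,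
`deg f_k = k`, each `f_k` is orthogonal to all polynomials of degree `< k`, and the `f_k` are
pairwise orthogonal. -/
def IsOrthogonalBasis {lam : ℂ} (β : Poly lam → Poly lam → ℂ) (f : ℕ → Poly lam) : Prop :=
  LinearIndependent ℂ f ∧ Submodule.span ℂ (Set.range f) = ⊤ ∧
    (∀ k : ℕ, wdeg (f k) = k) ∧
    (∀ (k : ℕ) (g : Poly lam), wdeg g < k → β (f k) g = 0) ∧
    ∀ k l : ℕ, k ≠ l → β (f k) (f l) = 0

/-- The relations defining the polynomials `f_{k,j}` (here `f k j`). -/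
structure IsFamily (lam : ℂ) (f : ℕ → ℕ → Poly lam) : Prop where
  even_even (k i : ℕ) : Even k →
    ev (f k (2 * i)) * gen lam .G ^ (2 * i) = (adF lam)^[k] (gen lam .G ^ (2 * i + k))
  odd_even (k i : ℕ) : Odd k →
    ev (f k (2 * i)) * gen lam .G ^ (2 * i) =
      (adF lam)^[k] (gen lam .G ^ (2 * i + k) * tau lam)
  even_odd (k i : ℕ) : Even k →
    ev (f k (2 * i + 1)) * gen lam .G ^ (2 * i + 1) =
      (adF lam)^[k + 1] (gen lam .G ^ (2 * i + k + 2))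
  odd_odd (k i : ℕ) : Odd k →
    ev (f k (2 * i + 1)) * gen lam .G ^ (2 * i + 1) =
      (adF lam)^[k - 1] (gen lam .G ^ (2 * i + k) * tau lam)

/-! ### Hypergeometric expressions -/

/-- The Pochhammer symbol `(a)_n = a (a + 1) ⋯ (a + n - 1)`. -/
noncomputable def poch {A : Type*} [CommRing A] (a : A) (n : ℕ) : A :=
  ∏ m ∈ Finset.range n, (a + m)

/-- The generalized hypergeometric series
`₃F₂(-k, b, c; d, e | 1) = ∑ n, (-k)_n (b)_n (c)_n / ((d)_n (e)_n n!)` over a commutative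
`ℂ`-algebra, to be used when `(d)_k` and `(e)_k` are invertible. The terms with `n > k` vanish
because `(-k)_n = 0`. -/
noncomputable def hyp32 {A : Type*} [CommRing A] [Algebra ℂ A] (k : ℕ) (b c d e : A) : A :=
  ∑ n ∈ Finset.range (k + 1),
    (n.factorial : ℂ)⁻¹ • (poch (-(k : A)) n * poch b n * poch c n *
      Ring.inverse (poch d n * poch e n))

/-- The product `(d)_k (e)_k · ₃F₂(-k, b, c; d, e | 1)` with the denominators cancelled by
`(d)_k = (d)_n (d + n)_{k - n}` and `(e)_k = (e)_n (e + n)_{k - n}`; it is meaningful also when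
`(d)_k` or `(e)_k` is not invertible. -/
noncomputable def hyp32Cleared {A : Type*} [CommRing A] [Algebra ℂ A] (k : ℕ) (b c d e : A) : A :=
  ∑ n ∈ Finset.range (k + 1),
    (n.factorial : ℂ)⁻¹ • (poch (-(k : A)) n * poch b n * poch c n *
      poch (d + n) (k - n) * poch (e + n) (k - n))

theorem poch_add {A : Type*} [CommRing A] (a : A) (m n : ℕ) :
    poch a (m + n) = poch a m * poch (a + m) n := by
  simp only [poch, Finset.prod_range_add, Nat.cast_add, add_assoc]

theorem hyp32Cleared_eq {A : Type*} [CommRing A] [Algebra ℂ A] (k : ℕ) (b c d e : A)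
    (hd : IsUnit (poch d k)) (he : IsUnit (poch e k)) :
    hyp32Cleared k b c d e = poch d k * poch e k * hyp32 k b c d e := by
  rw [hyp32, Finset.mul_sum, hyp32Cleared]
  refine Finset.sum_congr rfl fun n hn => ?_
  have hn : n + (k - n) = k := by
    have := Finset.mem_range.1 hn
    omega
  have h1 := poch_add d n (k - n)
  have h2 := poch_add e n (k - n)
  rw [hn] at h1 h2
  rw [h1] at hd
  rw [h2] at he
  have h3 : poch d n * poch e n * Ring.inverse (poch d n * poch e n) = 1 :=
    Ring.mul_inverse_cancel _
      ((isUnit_of_mul_isUnit_left hd).mul (isUnit_of_mul_isUnit_left he))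
  rw [h1, h2, mul_smul_comm]
  congr 1
  linear_combination (-(poch (-(k : A)) n * poch b n * poch c n *
      poch (d + n) (k - n) * poch (e + n) (k - n))) * h3

end Osp12

open Osp12

namespace Osp12

/-! ### Polynomials in `H` and `τ` and their substitutions -/

/-! In `B_λ` the odd generators `F`, `G` anticommute with `τ`, both `F G` and `G F` lie in the
commutative algebra `ℂ[H, τ]`, and moving `F` or `G` across `f(H, τ)` gives `f(H ± 1, -τ)`. So `B_λ`
is spanned by the elements `f G^j` and `f F^j`, and each identity becomes one about polynomials and
the substitutions `twist`. An explicit representation on `ℤ → ℂ[H, τ]` by weighted shifts shows that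
`f G^j = 0` forces `f = 0`. This gives the uniqueness of the `f_{k,j}` and permits coefficients of
`G^j` to be compared.

Explicit form: `(ad F)²` is the ordinary commutator with `F²`. On `f G^{j+2}` it is a two-term
operator in `f` and `f(H + 2, τ)`, and it agrees with a contiguous relation for terminating `₃F₂`
sums (`hyp32Cleared_succ`). Induction identifies `(ad F)^{2k} (G^{j+2k})` with a Hahn polynomial
times `G^j`. The remaining cases follow because `ℂ[τ]` commutes with `F²`.

Difference equations: `G^m` for even `m` and `G^m τ` for odd `m` are highest weight vectors of the
adjoint representation, so the adjoint action of `τ` multiplies them by `m + 1/2`. It anticommutes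
with `ad F` (`adTau_adF`), hence every `f_{k,j} G^j` is an eigenvector. Written on `f G^j` this is a
difference equation in `Δ`, `∇`. The equations in `Δ₂`, `∇₂` follow because the Casimir element of
`sl(2)` is `(τ + 1/2)² - 1`.

Orthogonality: up to a scalar, `⟨f, g⟩_j` is `L(f G^j F^j g)`. Invariance of `L` moves the powers of
`ad F` from `f_{k,j} G^j` to `F^j g`, where `(ad F)²` acts on `g` as `∇₂` and lowers the degree by
two; if `deg g < k` the result is killed (`IsFamily.orthogonal`). Leading terms give `deg f_{k,j} =
k`, hence bases. The automorphism exchanging `F` and `G` transfers everything to the forms with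
negative index.

Supertrace: a supertrace vanishes on nonzero weights and, by orthogonality to `1 = f_{0,0}`, on
every `f_{k,0}` with `k > 0`, so its value at `1` determines it. Conversely, the functional with
these values vanishes on `[F, f_{k,1} G]`, because this element is again some `f_{l,0}` with `l >
0`. Vanishing on supercommutators with `F` and `G` then extends to all of `B_λ`. -/

theorem cst_add (lam a b : ℂ) : cst lam (a + b) = cst lam a + cst lam b := map_add _ _ _

theorem cst_sub (lam a b : ℂ) : cst lam (a - b) = cst lam a - cst lam b := map_sub _ _ _

theorem cst_mul (lam a b : ℂ) : cst lam (a * b) = cst lam a * cst lam b := map_mul _ _ _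

theorem cst_neg (lam a : ℂ) : cst lam (-a) = -cst lam a := map_neg _ _

theorem cst_pow (lam a : ℂ) (n : ℕ) : cst lam (a ^ n) = cst lam a ^ n := map_pow _ _ _

theorem cst_one (lam : ℂ) : cst lam 1 = 1 := map_one _

theorem cst_zero (lam : ℂ) : cst lam 0 = 0 := map_zero _

theorem cst_natCast (lam : ℂ) (n : ℕ) : cst lam n = n := map_natCast _ _

theorem cst_ofNat (lam : ℂ) (n : ℕ) [n.AtLeastTwo] :
    cst lam (ofNat(n) : ℂ) = (ofNat(n) : Poly lam) := map_ofNat _ _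

theorem cst_eq_C (lam a : ℂ) : cst lam a = Polynomial.C ⟨a, 0⟩ := rfl

theorem smul_eq_cst_mul {lam : ℂ} (a : ℂ) (f : Poly lam) : a • f = cst lam a * f :=
  Algebra.smul_def a f

theorem two_mul_cst_half (lam : ℂ) : 2 * cst lam (1 / 2) = 1 := by
  rw [← cst_ofNat lam 2, ← cst_mul, ← cst_one]
  norm_num

theorem C_eq (lam : ℂ) (z : TauRing lam) :
    (Polynomial.C z : Poly lam) = cst lam z.re + cst lam z.im * pTau lam := by
  rw [cst_eq_C, cst_eq_C, pTau, ← Polynomial.C_mul, ← Polynomial.C_add]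
  congr 1
  ext <;> simp

/-- Used to compare multiplicative maps on `ℂ[H, τ]`: only constants, `H` and `τ` need checking. -/
theorem Poly.induction {lam : ℂ} {P : Poly lam → Prop} (hc : ∀ a, P (cst lam a)) (hH : P (pH lam))
    (ht : P (pTau lam)) (hadd : ∀ f g, P f → P g → P (f + g))
    (hmul : ∀ f g, P f → P g → P (f * g)) (f : Poly lam) : P f := by
  have hC : ∀ z : TauRing lam, P (Polynomial.C z) := fun z => by
    rw [C_eq]
    exact hadd _ _ (hc _) (hmul _ _ (hc _) ht)
  have hX : ∀ n : ℕ, P (pH lam ^ n) := fun n => by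
    induction n with
    | zero => rw [pow_zero, ← cst_one]; exact hc 1
    | succ n ih => rw [pow_succ]; exact hmul _ _ ih hH
  induction f using Polynomial.induction_on' with
  | add f g hf hg => exact hadd f g hf hg
  | monomial n z =>
    rw [← Polynomial.C_mul_X_pow_eq_monomial]
    exact hmul _ _ (hC z) (hX n)

/-- `f(H, τ) ↦ f(H + a, τ)` as a ring homomorphism. -/
noncomputable def shiftHom (lam a : ℂ) : Poly lam →+* Poly lam :=
  Polynomial.compRingHom (pH lam + algebraMap ℂ (Poly lam) a)

/-- `f(H, τ) ↦ f(H + a, -τ)` as a ring homomorphism. -/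
noncomputable def twist (lam a : ℂ) : Poly lam →+* Poly lam :=
  (Polynomial.mapRingHom (starRingEnd (TauRing lam))).comp (shiftHom lam a)

@[simp] theorem shiftHom_pH (lam a : ℂ) : shiftHom lam a (pH lam) = pH lam + cst lam a := by
  simp [shiftHom, pH, cst]

@[simp] theorem shiftHom_pTau (lam a : ℂ) : shiftHom lam a (pTau lam) = pTau lam := by
  simp [shiftHom, pTau]

@[simp] theorem shiftHom_cst (lam a b : ℂ) : shiftHom lam a (cst lam b) = cst lam b := by
  simp [shiftHom, cst_eq_C]

@[simp] theorem twist_pH (lam a : ℂ) : twist lam a (pH lam) = pH lam + cst lam a := by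
  have h : (star (⟨a, 0⟩ : TauRing lam)) = ⟨a, 0⟩ := by ext <;> simp
  have h2 : algebraMap ℂ (Poly lam) a = Polynomial.C ⟨a, 0⟩ := rfl
  simp only [twist, shiftHom, cst_eq_C, pH, h2, RingHom.comp_apply,
    Polynomial.coe_compRingHom_apply,
    Polynomial.X_comp, Polynomial.coe_mapRingHom, Polynomial.map_add, Polynomial.map_X,
    Polynomial.map_C, starRingEnd_apply, h]

@[simp] theorem twist_pTau (lam a : ℂ) : twist lam a (pTau lam) = -pTau lam := by
  have h : (star (⟨0, 1⟩ : TauRing lam)) = -⟨0, 1⟩ := by ext <;> simp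
  simp only [twist, pTau, shiftHom, RingHom.comp_apply, Polynomial.coe_compRingHom_apply,
    Polynomial.C_comp, Polynomial.coe_mapRingHom, Polynomial.map_C, starRingEnd_apply, h,
    Polynomial.C_neg]

@[simp] theorem twist_cst (lam a b : ℂ) : twist lam a (cst lam b) = cst lam b := by
  have h : (star (⟨b, 0⟩ : TauRing lam)) = ⟨b, 0⟩ := by ext <;> simp
  simp [twist, cst_eq_C, shiftHom, starRingEnd_apply, h]

/-- The two sign changes of `τ` cancel, which is why the second-order operators with step `2` leave
`τ` fixed. -/
theorem twist_twist (lam a b : ℂ) (f : Poly lam) :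
    twist lam a (twist lam b f) = shiftHom lam (a + b) f := by
  induction f using Poly.induction with
  | hc c => simp
  | hH => simp [cst_add, add_assoc]
  | ht => simp
  | hadd f g hf hg => simp only [map_add, hf, hg]
  | hmul f g hf hg => simp only [map_mul, hf, hg]

theorem shiftHom_zero (lam : ℂ) (f : Poly lam) : shiftHom lam 0 f = f := by
  simp [shiftHom, pH]

theorem twist_twist_of_add_eq_zero {lam a b : ℂ} (h : a + b = 0) (f : Poly lam) :
    twist lam a (twist lam b f) = f := by
  rw [twist_twist, h, shiftHom_zero]

/-- The polynomial `(H + 1/2 - τ)/2`, equal to `F G` in `B_λ`. -/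
noncomputable def polyFG (lam : ℂ) : Poly lam :=
  cst lam (1 / 2) * (pH lam + cst lam (1 / 2) - pTau lam)

/-- The polynomial `(H - 1/2 + τ)/2`, equal to `G F` in `B_λ`. -/
noncomputable def polyGF (lam : ℂ) : Poly lam :=
  cst lam (1 / 2) * (pH lam - cst lam (1 / 2) + pTau lam)

/-! ### Relations in `B_λ` -/

section relations

variable (lam : ℂ)

theorem H_mul_G : gen lam .H * gen lam .G = gen lam .G * gen lam .H + gen lam .G := by
  have h := gen_bracket lam .H .G
  rw [Finset.sum_eq_single OspGen.G (by rintro (_ | _ | _ | _ | _) <;> simp [coeff]) (by simp)] at h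
  simp [parity, coeff] at h
  rw [sub_eq_iff_eq_add'.1 h]

theorem H_mul_F : gen lam .H * gen lam .F = gen lam .F * gen lam .H - gen lam .F := by
  have h := gen_bracket lam .H .F
  rw [Finset.sum_eq_single OspGen.F (by rintro (_ | _ | _ | _ | _) <;> simp [coeff]) (by simp)] at h
  simp [parity, coeff] at h
  rw [sub_eq_iff_eq_add'.1 h, sub_eq_add_neg]

theorem G_mul_F : gen lam .G * gen lam .F + gen lam .F * gen lam .G = gen lam .H := by
  have h := gen_bracket lam .G .F
  rw [Finset.sum_eq_single OspGen.H (by rintro (_ | _ | _ | _ | _) <;> simp [coeff]) (by simp)] at h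
  simpa [parity, coeff] using h

theorem gen_X : gen lam .X = gen lam .G * gen lam .G := by
  have h := gen_bracket lam .G .G
  rw [Finset.sum_eq_single OspGen.X (by rintro (_ | _ | _ | _ | _) <;> simp [coeff]) (by simp)] at h
  simp [parity, coeff] at h
  rw [← two_smul ℂ] at h
  exact (smul_right_injective _ (two_ne_zero (α := ℂ)) h).symm

theorem gen_Y : gen lam .Y = -(gen lam .F * gen lam .F) := by
  have h := gen_bracket lam .F .F
  rw [Finset.sum_eq_single OspGen.Y (by rintro (_ | _ | _ | _ | _) <;> simp [coeff]) (by simp)] at h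
  simp [parity, coeff] at h
  rw [← two_smul ℂ, ← smul_neg] at h
  rw [smul_right_injective _ (two_ne_zero (α := ℂ)) h, neg_neg]

/-- With `G F + F G = H`, the anticommutator is `G H + H G + G - 2 H G`, which is zero because `[H,
G] = G`. -/
theorem G_mul_tau : gen lam .G * tau lam = -(tau lam * gen lam .G) := by
  have h1 := H_mul_G lam
  have h2 := G_mul_F lam
  have hc : gen lam .G * algebraMap ℂ (B lam) (1 / 2) =
    algebraMap ℂ (B lam) (1 / 2) * gen lam .G := (Algebra.commutes _ _).symm
  have hh : algebraMap ℂ (B lam) (1 / 2) + algebraMap ℂ (B lam) (1 / 2) = 1 := by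
    rw [← map_add, ← map_one (algebraMap ℂ (B lam))]; norm_num
  have key : gen lam .G * tau lam + tau lam * gen lam .G = 0 := by
    calc _ = gen lam .G * gen lam .H + gen lam .H * gen lam .G +
          (algebraMap ℂ (B lam) (1 / 2) + algebraMap ℂ (B lam) (1 / 2)) * gen lam .G -
          2 * ((gen lam .G * gen lam .F + gen lam .F * gen lam .G) * gen lam .G) := by
          rw [tau_eq, mul_sub, mul_add, hc]; noncomm_ring
      _ = 0 := by rw [hh, h2, h1]; noncomm_ring
  exact eq_neg_of_add_eq_zero_left key

theorem F_mul_tau : gen lam .F * tau lam = -(tau lam * gen lam .F) := by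
  have h1 := H_mul_F lam
  have h2 := G_mul_F lam
  have hc : gen lam .F * algebraMap ℂ (B lam) (1 / 2) =
    algebraMap ℂ (B lam) (1 / 2) * gen lam .F := (Algebra.commutes _ _).symm
  have hh : algebraMap ℂ (B lam) (1 / 2) + algebraMap ℂ (B lam) (1 / 2) = 1 := by
    rw [← map_add, ← map_one (algebraMap ℂ (B lam))]; norm_num
  have key : gen lam .F * tau lam + tau lam * gen lam .F = 0 := by
    calc _ = gen lam .F * gen lam .H + gen lam .H * gen lam .F +
          (algebraMap ℂ (B lam) (1 / 2) + algebraMap ℂ (B lam) (1 / 2)) * gen lam .F -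
          2 * (gen lam .F * (gen lam .G * gen lam .F + gen lam .F * gen lam .G)) := by
          rw [tau_eq, mul_sub, mul_add, hc]; noncomm_ring
      _ = 0 := by rw [hh, h2, h1]; noncomm_ring
  exact eq_neg_of_add_eq_zero_left key

/-- `H = G F + F G`, and `τ` passes each product of two odd generators with two cancelling signs. -/
theorem H_mul_tau : Commute (gen lam .H) (tau lam) := by
  change _ = _
  have h1 : gen lam .G * gen lam .F * tau lam = tau lam * (gen lam .G * gen lam .F) := by
    rw [mul_assoc, F_mul_tau, mul_neg, ← mul_assoc, G_mul_tau, neg_mul, neg_neg, mul_assoc]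
  have h2 : gen lam .F * gen lam .G * tau lam = tau lam * (gen lam .F * gen lam .G) := by
    rw [mul_assoc, G_mul_tau, mul_neg, ← mul_assoc, F_mul_tau, neg_mul, neg_neg, mul_assoc]
  rw [← G_mul_F, add_mul, mul_add, h1, h2]

end relations

/-! ### Evaluation of polynomials in `B_λ` -/

/-- The evaluation of elements of `ℂ[τ]` in `B_λ`. -/
noncomputable def tauHom (lam : ℂ) : TauRing lam →ₐ[ℂ] B lam :=
  QuadraticAlgebra.lift ⟨tau lam, by
    rw [← pow_two, tau_sq, zero_smul, add_zero, Algebra.algebraMap_eq_smul_one]⟩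

/-- The evaluation `ev` as a ring homomorphism. -/
noncomputable def evHom (lam : ℂ) : Poly lam →+* B lam :=
  Polynomial.eval₂RingHom' (tauHom lam : TauRing lam →+* B lam) (gen lam .H) fun z => by
    have h : Commute (tau lam) (gen lam .H) := (H_mul_tau lam).symm
    exact ((Commute.one_left _).smul_left z.re).add_left (h.smul_left z.im)

theorem ev_eq {lam : ℂ} (f : Poly lam) : ev f = evHom lam f := by
  change _ = Polynomial.eval₂ _ _ f
  rw [Polynomial.eval₂_eq_sum]
  rfl

theorem evHom_pH (lam : ℂ) : evHom lam (pH lam) = gen lam .H :=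
  Polynomial.eval₂_X ..

theorem evHom_C (lam : ℂ) (z : TauRing lam) :
    evHom lam (Polynomial.C z) = z.re • 1 + z.im • tau lam :=
  Polynomial.eval₂_C ..

theorem evHom_pTau (lam : ℂ) : evHom lam (pTau lam) = tau lam := by
  rw [pTau, evHom_C]; simp

theorem evHom_cst (lam a : ℂ) : evHom lam (cst lam a) = algebraMap ℂ (B lam) a := by
  rw [cst_eq_C, evHom_C, Algebra.algebraMap_eq_smul_one]; simp

theorem evHom_smul (lam a : ℂ) (f : Poly lam) : evHom lam (a • f) = a • evHom lam f := by
  rw [smul_eq_cst_mul, map_mul, evHom_cst, Algebra.smul_def]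

/-- The evaluation `ev` as a linear map. -/
noncomputable def evLin (lam : ℂ) : Poly lam →ₗ[ℂ] B lam where
  toFun := evHom lam
  map_add' := map_add _
  map_smul' := evHom_smul lam

theorem G_mul_ev (lam : ℂ) (f : Poly lam) :
    gen lam .G * evHom lam f = evHom lam (twist lam (-1) f) * gen lam .G := by
  induction f using Poly.induction with
  | hc c => simp only [twist_cst, evHom_cst, Algebra.commutes]
  | hH =>
    rw [twist_pH, map_add, evHom_pH, evHom_cst, add_mul, H_mul_G, map_neg, map_one]
    noncomm_ring
  | ht => rw [twist_pTau, map_neg, evHom_pTau, G_mul_tau, neg_mul]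
  | hadd f g hf hg => simp only [map_add, mul_add, add_mul, hf, hg]
  | hmul f g hf hg => simp only [map_mul, ← mul_assoc, hf]; simp only [mul_assoc, hg]

theorem F_mul_ev (lam : ℂ) (f : Poly lam) :
    gen lam .F * evHom lam f = evHom lam (twist lam 1 f) * gen lam .F := by
  induction f using Poly.induction with
  | hc c => simp only [twist_cst, evHom_cst, Algebra.commutes]
  | hH =>
    rw [twist_pH, map_add, evHom_pH, evHom_cst, add_mul, H_mul_F, map_one]
    noncomm_ring
  | ht => rw [twist_pTau, map_neg, evHom_pTau, F_mul_tau, neg_mul]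
  | hadd f g hf hg => simp only [map_add, mul_add, add_mul, hf, hg]
  | hmul f g hf hg => simp only [map_mul, ← mul_assoc, hf]; simp only [mul_assoc, hg]

theorem F_mul_G_eq (lam : ℂ) : gen lam .F * gen lam .G = evHom lam (polyFG lam) := by
  have hh : algebraMap ℂ (B lam) (1 / 2) * 2 = 1 := by
    rw [← map_ofNat (algebraMap ℂ (B lam)) 2, ← map_mul, ← map_one (algebraMap ℂ (B lam))]
    norm_num
  rw [polyFG, map_mul, map_sub, map_add, evHom_pH, evHom_pTau, evHom_cst, tau_eq, sub_sub_cancel,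
    ← mul_assoc, hh, one_mul]

theorem G_mul_F_eq (lam : ℂ) : gen lam .G * gen lam .F = evHom lam (polyGF lam) := by
  rw [eq_sub_of_add_eq (G_mul_F lam), F_mul_G_eq, ← evHom_pH, ← map_sub]
  congr 1
  rw [polyFG, polyGF]
  linear_combination (-pH lam) * two_mul_cst_half lam

theorem sum_ospGen {M : Type*} [AddCommMonoid M] (f : OspGen → M) :
    ∑ c, f c = f .X + (f .Y + (f .H + (f .F + f .G))) := by
  have h : (Finset.univ : Finset OspGen) = {.X, .Y, .H, .F, .G} := rfl
  rw [h]
  simp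

/-! ### A faithful representation -/

/-- The sign `(-1)^n` as a polynomial. -/
noncomputable def sgn (lam : ℂ) (n : ℤ) : Poly lam := ((n.negOnePow : ℤ) : Poly lam)

theorem sgn_zero (lam : ℂ) : sgn lam 0 = 1 := by simp [sgn]

theorem sgn_add_one (lam : ℂ) (n : ℤ) : sgn lam (n + 1) = -sgn lam n := by
  simp [sgn, Int.negOnePow_succ]

theorem sgn_sub_one (lam : ℂ) (n : ℤ) : sgn lam (n - 1) = -sgn lam n := by
  rw [← neg_eq_iff_eq_neg, ← sgn_add_one, sub_add_cancel]

theorem sgn_sq (lam : ℂ) (n : ℤ) : sgn lam n ^ 2 = 1 := by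
  rw [sgn, ← Int.cast_pow, ← Units.val_pow_eq_pow_val, Int.units_sq]
  simp

/-- The action of the generators on `ℤ → ℂ[H, τ]`: `G` moves the basis vector `e_n` to `e_{n+1}`,
the elements `H`, `τ` of `B_λ` act on `e_n` by `H + n`, `(-1)^n τ`. -/
noncomputable def repGen (lam : ℂ) : OspGen → Module.End (Poly lam) (ℤ → Poly lam) :=
  let G : Module.End (Poly lam) (ℤ → Poly lam) := LinearMap.pi fun n => LinearMap.proj (n - 1)
  let F : Module.End (Poly lam) (ℤ → Poly lam) := LinearMap.pi fun n =>
    (cst lam (1 / 2) * (pH lam + n + cst lam (1 / 2) - sgn lam n * pTau lam)) •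
      LinearMap.proj (n + 1)
  let H : Module.End (Poly lam) (ℤ → Poly lam) := LinearMap.pi fun n =>
    (pH lam + n) • LinearMap.proj n
  fun
  | .X => G * G
  | .Y => -(F * F)
  | .H => H
  | .F => F
  | .G => G

theorem repGen_G (lam : ℂ) (u : ℤ → Poly lam) (n : ℤ) : repGen lam .G u n = u (n - 1) := rfl

theorem repGen_F (lam : ℂ) (u : ℤ → Poly lam) (n : ℤ) : repGen lam .F u n =
    (cst lam (1 / 2) * (pH lam + n + cst lam (1 / 2) - sgn lam n * pTau lam)) * u (n + 1) := rfl

theorem repGen_H (lam : ℂ) (u : ℤ → Poly lam) (n : ℤ) :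
    repGen lam .H u n = (pH lam + n) * u n := rfl

theorem repGen_X (lam : ℂ) : repGen lam .X = repGen lam .G * repGen lam .G := rfl

theorem repGen_Y (lam : ℂ) : repGen lam .Y = -(repGen lam .F * repGen lam .F) := rfl

theorem repGen_tau (lam : ℂ) (u : ℤ → Poly lam) (n : ℤ) :
    (repGen lam .H + algebraMap ℂ (Module.End (Poly lam) (ℤ → Poly lam)) (1 / 2) -
      2 * (repGen lam .F * repGen lam .G)) u n = sgn lam n * pTau lam * u n := by
  have h2 : (2 : Module.End (Poly lam) (ℤ → Poly lam)) = 1 + 1 := by norm_num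
  simp only [h2, add_mul, one_mul, LinearMap.sub_apply, LinearMap.add_apply, Pi.sub_apply,
    Pi.add_apply, repGen_H, Module.End.mul_apply, repGen_F, repGen_G, Module.algebraMap_end_apply,
    Pi.smul_apply, smul_eq_cst_mul, add_sub_cancel_right]
  linear_combination (-(pH lam + n + cst lam (1 / 2) - sgn lam n * pTau lam) * u n) *
    two_mul_cst_half lam

-- Since `X` and `Y` act as `G²` and `-F²`, each bracket, read at one coordinate `n`, is a
-- polynomial identity in `H`, `τ`, `n` and the sign `(-1)^n`.
set_option maxHeartbeats 1000000 in
theorem repGen_bracket (lam : ℂ) (a b : OspGen) :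
    repGen lam a * repGen lam b - (-1 : ℂ) ^ (parity a * parity b) • (repGen lam b * repGen lam a) =
      ∑ c, (coeff a b c : ℂ) • repGen lam c := by
  have h := two_mul_cst_half lam
  refine LinearMap.ext fun u => funext fun n => ?_
  have hs := sgn_sq lam n
  simp only [one_div] at h
  cases a <;> cases b <;>
    simp [sum_ospGen, coeff, parity, repGen_X, repGen_Y, repGen_F, repGen_G, repGen_H,
      sgn_add_one, sgn_sub_one, smul_eq_cst_mul, cst_ofNat] <;>
    first | ring1 | grind

/-- The representation of `B_λ` on `ℤ → ℂ[H, τ]`. -/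
noncomputable def rep (lam : ℂ) : B lam →ₐ[ℂ] Module.End (Poly lam) (ℤ → Poly lam) :=
  lift lam (repGen lam) (repGen_bracket lam) <| by
    refine LinearMap.ext fun u => funext fun n => ?_
    rw [pow_two (_ - _), Module.End.mul_apply, repGen_tau, repGen_tau, Module.algebraMap_end_apply,
      Pi.smul_apply, Algebra.smul_def, ← pTau_sq]
    linear_combination (pTau lam ^ 2 * u n) * sgn_sq lam n

theorem rep_gen (lam : ℂ) (a : OspGen) : rep lam (gen lam a) = repGen lam a := lift_gen ..

theorem rep_tau (lam : ℂ) (u : ℤ → Poly lam) (n : ℤ) :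
    rep lam (tau lam) u n = sgn lam n * pTau lam * u n := by
  rw [← repGen_tau, tau_eq]
  simp only [map_sub, map_add, map_mul, AlgHom.commutes, map_ofNat, rep_gen]

/-- The value at `0` of `u e_0`. -/
noncomputable def coeffZero (lam : ℂ) : B lam →ₗ[ℂ] Poly lam where
  toFun u := rep lam u (Pi.single 0 1) 0
  map_add' u v := by simp
  map_smul' r u := by simp

/-- At coordinate `0` the shift of `H` and the sign of `τ` are both trivial, so a polynomial can be
read off from its action there. -/
theorem rep_ev_zero (lam : ℂ) (f : Poly lam) (u : ℤ → Poly lam) :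
    rep lam (evHom lam f) u 0 = f * u 0 := by
  induction f using Poly.induction generalizing u with
  | hc c =>
    rw [evHom_cst, AlgHom.commutes, Module.algebraMap_end_apply, Pi.smul_apply, smul_eq_cst_mul]
  | hH => rw [evHom_pH, rep_gen, repGen_H]; simp
  | ht => rw [evHom_pTau, rep_tau, sgn_zero, one_mul]
  | hadd f g hf hg => simp only [map_add, LinearMap.add_apply, Pi.add_apply, hf, hg, add_mul]
  | hmul f g hf hg => simp only [map_mul, Module.End.mul_apply, hf, hg, mul_assoc]

theorem coeffZero_ev (lam : ℂ) (f : Poly lam) : coeffZero lam (evHom lam f) = f := by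
  change rep lam _ _ 0 = f
  rw [rep_ev_zero]; simp

theorem rep_G_pow (lam : ℂ) (j : ℕ) (u : ℤ → Poly lam) (n : ℤ) :
    rep lam (gen lam .G ^ j) u n = u (n - j) := by
  induction j generalizing n with
  | zero => simp
  | succ j ih =>
    rw [pow_succ' (gen lam .G), map_mul, Module.End.mul_apply, rep_gen, repGen_G, ih]
    congr 1
    push_cast
    ring

/-- The constant function `1` is fixed by `G`, so coordinate `0` of its image under `f G^j` is `f`.
This replaces a Poincaré–Birkhoff–Witt argument. -/
theorem eq_zero_of_ev_mul_G_pow {lam : ℂ} {f : Poly lam} {j : ℕ}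
    (h : evHom lam f * gen lam .G ^ j = 0) : f = 0 := by
  have h1 := congrArg (fun u => rep lam u (fun _ => 1) 0) h
  simpa only [map_mul, Module.End.mul_apply, rep_ev_zero, rep_G_pow, mul_one, map_zero,
    LinearMap.zero_apply, Pi.zero_apply] using h1

theorem ev_mul_G_pow_injective {lam : ℂ} {f g : Poly lam} {j : ℕ}
    (h : evHom lam f * gen lam .G ^ j = evHom lam g * gen lam .G ^ j) : f = g :=
  sub_eq_zero.1 (eq_zero_of_ev_mul_G_pow (j := j) (by rw [map_sub, sub_mul, h, sub_self]))

/-! ### Generators and a spanning set of `B_λ` -/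

/-- The odd generators suffice: `X = G²`, `Y = -F²` and `H = G F + F G`. -/
theorem subalgebra_eq_top {lam : ℂ} (S : Subalgebra ℂ (B lam)) (hF : gen lam .F ∈ S)
    (hG : gen lam .G ∈ S) : S = ⊤ := by
  have hgen : ∀ a, gen lam a ∈ S := by
    rintro (_ | _ | _ | _ | _)
    · rw [gen_X]; exact S.mul_mem hG hG
    · rw [gen_Y]; exact S.neg_mem (S.mul_mem hF hF)
    · rw [← G_mul_F]; exact S.add_mem (S.mul_mem hG hF) (S.mul_mem hF hG)
    · exact hF
    · exact hG
  rw [eq_top_iff]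
  rintro u -
  obtain ⟨v, rfl⟩ := RingQuot.mkAlgHom_surjective ℂ (TauRel lam) u
  obtain ⟨w, rfl⟩ := RingQuot.mkAlgHom_surjective ℂ EnvRel v
  change ((mk lam).comp uMk) w ∈ S
  induction w using FreeAlgebra.induction with
  | grade0 r => rw [AlgHom.commutes]; exact S.algebraMap_mem r
  | grade1 a => exact hgen a
  | mul a b ha hb => rw [map_mul]; exact S.mul_mem ha hb
  | add a b ha hb => rw [map_add]; exact S.add_mem ha hb

/-- A submodule that contains `1` and is stable under left multiplication by `F` and `G`
is everything. -/
theorem submodule_eq_top {lam : ℂ} (S : Submodule ℂ (B lam)) (h1 : 1 ∈ S)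
    (hF : ∀ u ∈ S, gen lam .F * u ∈ S) (hG : ∀ u ∈ S, gen lam .G * u ∈ S) : S = ⊤ := by
  let A : Subalgebra ℂ (B lam) :=
    { carrier := {a | ∀ u ∈ S, a * u ∈ S}
      mul_mem' := fun {a b} ha hb u hu => by rw [mul_assoc]; exact ha _ (hb _ hu)
      add_mem' := fun {a b} ha hb u hu => by rw [add_mul]; exact S.add_mem (ha _ hu) (hb _ hu)
      algebraMap_mem' := fun r u hu => by
        rw [← Algebra.smul_def]; exact S.smul_mem r hu }
  have hA : A = ⊤ := subalgebra_eq_top A hF hG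
  rw [eq_top_iff]
  rintro u -
  have hu : u ∈ A := hA ▸ trivial
  simpa using hu 1 h1

/-- Left multiplication by `F` or `G` preserves the span of the `f G^i` and `f F^i`: it either
lengthens the power or absorbs a product `F G` or `G F` into the polynomial. Closure of `P` under
scalars need not be assumed, since scalars go into `f`. -/
theorem span_induction_B {lam : ℂ} {P : B lam → Prop}
    (hG : ∀ f i, P (evHom lam f * gen lam .G ^ i)) (hF : ∀ f i, P (evHom lam f * gen lam .F ^ i))
    (hadd : ∀ u v, P u → P v → P (u + v)) (u : B lam) : P u := by
  let S : Set (B lam) := {u | ∃ f i, u = evHom lam f * gen lam .G ^ i} ∪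
    {u | ∃ f i, u = evHom lam f * gen lam .F ^ i}
  have hPS : ∀ c : ℂ, ∀ u ∈ S, c • u ∈ S := by
    rintro c _ (⟨f, i, rfl⟩ | ⟨f, i, rfl⟩)
    · exact Or.inl ⟨c • f, i, by rw [evHom_smul, smul_mul_assoc]⟩
    · exact Or.inr ⟨c • f, i, by rw [evHom_smul, smul_mul_assoc]⟩
  have hmul : ∀ x : B lam, (∀ u ∈ S, x * u ∈ S) → ∀ u ∈ Submodule.span ℂ S,
      x * u ∈ Submodule.span ℂ S := by
    intro x hx u hu
    induction hu using Submodule.span_induction with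
    | mem u hu => exact Submodule.subset_span (hx u hu)
    | zero => rw [mul_zero]; exact Submodule.zero_mem _
    | add u v _ _ hu hv => rw [mul_add]; exact Submodule.add_mem _ hu hv
    | smul c u _ hu => rw [mul_smul_comm]; exact Submodule.smul_mem _ _ hu
  have htop : Submodule.span ℂ S = ⊤ := by
    apply submodule_eq_top
    · exact Submodule.subset_span (Or.inl ⟨1, 0, by simp⟩)
    · refine hmul _ ?_
      rintro _ (⟨f, i, rfl⟩ | ⟨f, i, rfl⟩)
      · rcases i with _ | i
        · exact Or.inr ⟨twist lam 1 f, 1, by rw [pow_zero, mul_one, pow_one, F_mul_ev]⟩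
        · exact Or.inl ⟨twist lam 1 f * polyFG lam, i, by
            rw [← mul_assoc, F_mul_ev, pow_succ' (gen lam .G), mul_assoc, ← mul_assoc (gen lam .F),
              F_mul_G_eq,
              map_mul, mul_assoc]⟩
      · exact Or.inr ⟨twist lam 1 f, i + 1, by
          rw [← mul_assoc, F_mul_ev, pow_succ' (gen lam .F), mul_assoc]⟩
    · refine hmul _ ?_
      rintro _ (⟨f, i, rfl⟩ | ⟨f, i, rfl⟩)
      · exact Or.inl ⟨twist lam (-1) f, i + 1, by
          rw [← mul_assoc, G_mul_ev, pow_succ' (gen lam .G), mul_assoc]⟩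
      · rcases i with _ | i
        · exact Or.inl ⟨twist lam (-1) f, 1, by rw [pow_zero, mul_one, pow_one, G_mul_ev]⟩
        · exact Or.inr ⟨twist lam (-1) f * polyGF lam, i, by
            rw [← mul_assoc, G_mul_ev, pow_succ' (gen lam .F), mul_assoc, ← mul_assoc (gen lam .G),
              G_mul_F_eq,
              map_mul, mul_assoc]⟩
  have hu : u ∈ Submodule.span ℂ S := htop ▸ Submodule.mem_top
  -- All multiples are treated at once, because `P` itself is only additive while the span is taken
  -- over `ℂ`.
  have key : ∀ c : ℂ, P (c • u) := by
    induction hu using Submodule.span_induction with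
    | mem u hu =>
      intro c
      rcases hPS c u hu with ⟨f, i, h⟩ | ⟨f, i, h⟩
      · rw [h]; exact hG f i
      · rw [h]; exact hF f i
    | zero => intro c; simpa using hG 0 0
    | add u v _ _ hu hv => intro c; rw [smul_add]; exact hadd _ _ (hu c) (hv c)
    | smul a u _ hu => intro c; rw [smul_smul]; exact hu _
  simpa using key 1

/-! ### Parity -/

theorem algHom_ext_FG {lam : ℂ} {A : Type*} [Ring A] [Algebra ℂ A] {φ ψ : B lam →ₐ[ℂ] A}
    (hF : φ (gen lam .F) = ψ (gen lam .F)) (hG : φ (gen lam .G) = ψ (gen lam .G)) : φ = ψ := by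
  have h := subalgebra_eq_top (AlgHom.equalizer φ ψ) hF hG
  refine AlgHom.ext fun u => ?_
  have hu : u ∈ AlgHom.equalizer φ ψ := h ▸ trivial
  exact hu

theorem parityAut_F (lam : ℂ) : parityAut lam (gen lam .F) = -gen lam .F := by simp [parity]

theorem parityAut_G (lam : ℂ) : parityAut lam (gen lam .G) = -gen lam .G := by simp [parity]

theorem parityAut_parityAut {lam : ℂ} (u : B lam) : parityAut lam (parityAut lam u) = u := by
  have h : (parityAut lam).comp (parityAut lam) = AlgHom.id ℂ (B lam) := by
    apply algHom_ext_FG <;> simp [parity]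
  exact DFunLike.congr_fun h u

theorem parityAut_tau (lam : ℂ) : parityAut lam (tau lam) = tau lam := by
  rw [tau_eq]
  simp [parity, map_ofNat]

theorem parityAut_ev (lam : ℂ) (f : Poly lam) : parityAut lam (evHom lam f) = evHom lam f := by
  induction f using Poly.induction with
  | hc c => rw [evHom_cst, AlgHom.commutes]
  | hH => rw [evHom_pH, parityAut_gen]; simp [parity]
  | ht => rw [evHom_pTau, parityAut_tau]
  | hadd f g hf hg => simp only [map_add, hf, hg]
  | hmul f g hf hg => simp only [map_mul, hf, hg]

theorem isHomog_ev (lam : ℂ) (f : Poly lam) : IsHomog 0 (evHom lam f) := by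
  rw [IsHomog, parityAut_ev, pow_zero, one_smul]

theorem isHomog_tau (lam : ℂ) : IsHomog 0 (tau lam) := by
  rw [← evHom_pTau]; exact isHomog_ev _ _

theorem isHomog_G (lam : ℂ) : IsHomog 1 (gen lam .G) := isHomog_gen lam .G

theorem isHomog_F (lam : ℂ) : IsHomog 1 (gen lam .F) := isHomog_gen lam .F

theorem isHomog_H (lam : ℂ) : IsHomog 0 (gen lam .H) := isHomog_gen lam .H

theorem IsHomog.pow {lam : ℂ} {u : B lam} (hu : IsHomog 1 u) (j : ℕ) : IsHomog j (u ^ j) := by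
  unfold IsHomog at *
  rw [map_pow, hu, pow_one, smul_pow]

theorem IsHomog.sub {lam : ℂ} {p : ℕ} {u v : B lam} (hu : IsHomog p u) (hv : IsHomog p v) :
    IsHomog p (u - v) := by
  unfold IsHomog at *
  rw [map_sub, hu, hv, smul_sub]

theorem IsHomog.smul {lam : ℂ} {p : ℕ} {u : B lam} (hu : IsHomog p u) (c : ℂ) :
    IsHomog p (c • u) := by
  unfold IsHomog at *
  rw [map_smul, hu, smul_comm]

theorem IsHomog.congr {lam : ℂ} {p q : ℕ} {u : B lam} (hu : IsHomog p u)
    (h : (-1 : ℂ) ^ p = (-1) ^ q) : IsHomog q u := by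
  unfold IsHomog at *
  rw [hu, h]

theorem isHomog_ev_mul_G_pow (lam : ℂ) (f : Poly lam) (j : ℕ) :
    IsHomog j (evHom lam f * gen lam .G ^ j) := by
  simpa using (isHomog_ev lam f).mul ((isHomog_G lam).pow j)

theorem isHomog_ev_mul_F_pow (lam : ℂ) (f : Poly lam) (j : ℕ) :
    IsHomog j (evHom lam f * gen lam .F ^ j) := by
  simpa using (isHomog_ev lam f).mul ((isHomog_F lam).pow j)

theorem isHomog_F_pow_mul_ev (lam : ℂ) (f : Poly lam) (j : ℕ) :
    IsHomog j (gen lam .F ^ j * evHom lam f) := by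
  simpa using ((isHomog_F lam).pow j).mul (isHomog_ev lam f)

theorem exists_homog_decomp {lam : ℂ} (u : B lam) :
    ∃ u₀ u₁ : B lam, IsHomog 0 u₀ ∧ IsHomog 1 u₁ ∧ u = u₀ + u₁ := by
  refine ⟨(1 / 2 : ℂ) • (u + parityAut lam u), (1 / 2 : ℂ) • (u - parityAut lam u), ?_, ?_, ?_⟩
  · rw [IsHomog, map_smul, map_add, parityAut_parityAut]; module
  · rw [IsHomog, map_smul, map_sub, parityAut_parityAut]; module
  · module

/-! ### The adjoint actions of `F` and `G` -/

/-- The supercommutator `[G, u]`. -/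
noncomputable def adG (lam : ℂ) (u : B lam) : B lam :=
  gen lam .G * u - parityAut lam u * gen lam .G

theorem adG_homog {lam : ℂ} {p : ℕ} {u : B lam} (hu : IsHomog p u) :
    adG lam u = gen lam .G * u - (-1 : ℂ) ^ p • (u * gen lam .G) := by
  rw [adG, hu, smul_mul_assoc]

theorem IsHomog.adF {lam : ℂ} {p : ℕ} {u : B lam} (hu : IsHomog p u) :
    IsHomog (p + 1) (adF lam u) := by
  rw [adF_homog hu]
  exact ((add_comm 1 p) ▸ (isHomog_F lam).mul hu).sub ((hu.mul (isHomog_F lam)).smul _)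

theorem IsHomog.adF_iterate {lam : ℂ} {p : ℕ} {u : B lam} (hu : IsHomog p u) (m : ℕ) :
    IsHomog (p + m) ((Osp12.adF lam)^[m] u) := by
  induction m with
  | zero => exact hu
  | succ m ih => rw [Function.iterate_succ_apply', ← add_assoc]; exact ih.adF

/-- As `F` is odd, the cross terms cancel and the square of `ad F` is an ordinary commutator, with
no parity of `u` involved. -/
theorem adF_adF {lam : ℂ} (u : B lam) : adF lam (adF lam u) =
    gen lam .F * gen lam .F * u - u * (gen lam .F * gen lam .F) := by
  simp only [adF, map_sub, map_mul, parityAut_parityAut, parityAut_F]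
  noncomm_ring

theorem adF_zero (lam : ℂ) : adF lam 0 = 0 := by simp [adF]

theorem adF_smul {lam : ℂ} (c : ℂ) (u : B lam) : adF lam (c • u) = c • adF lam u := by
  simp only [adF, map_smul, mul_smul_comm, smul_mul_assoc, smul_sub]

theorem adF_iterate_smul {lam : ℂ} (c : ℂ) (u : B lam) (m : ℕ) :
    (adF lam)^[m] (c • u) = c • (adF lam)^[m] u := by
  induction m with
  | zero => rfl
  | succ m ih => rw [Function.iterate_succ_apply', ih, adF_smul, Function.iterate_succ_apply']

theorem F_sq_mul_ev (lam : ℂ) (f : Poly lam) :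
    gen lam .F * gen lam .F * evHom lam f =
      evHom lam (shiftHom lam 2 f) * (gen lam .F * gen lam .F) := by
  rw [mul_assoc, F_mul_ev, ← mul_assoc, F_mul_ev, twist_twist, mul_assoc]
  norm_num

/-- Meant for `c` in `ℂ[τ]`: such factors pass through even powers of `ad F`. -/
theorem adF_adF_mul {lam : ℂ} {c : B lam} (hc : gen lam .F * gen lam .F * c =
    c * (gen lam .F * gen lam .F)) (u : B lam) :
    adF lam (adF lam (c * u)) = c * adF lam (adF lam u) := by
  rw [adF_adF, adF_adF, mul_sub, ← mul_assoc, hc, mul_assoc, mul_assoc c u]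

theorem adF_iterate_even_mul {lam : ℂ} {c : B lam} (hc : gen lam .F * gen lam .F * c =
    c * (gen lam .F * gen lam .F)) (u : B lam) (n : ℕ) :
    (adF lam)^[2 * n] (c * u) = c * (adF lam)^[2 * n] u := by
  induction n with
  | zero => rfl
  | succ n ih =>
    rw [mul_add, mul_one, Function.iterate_succ_apply', Function.iterate_succ_apply', ih,
      adF_adF_mul hc, Function.iterate_succ_apply', Function.iterate_succ_apply']

/-- Elements of `ℂ[τ]` commute with `F²`. -/
theorem F_sq_mul_ev_of_shift {lam : ℂ} {f : Poly lam} (hf : shiftHom lam 2 f = f) :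
    gen lam .F * gen lam .F * evHom lam f = evHom lam f * (gen lam .F * gen lam .F) := by
  rw [F_sq_mul_ev, hf]

/-! ### Formulas for `ad F` and `(ad F)²` on `f G^j` -/

theorem G_pow_mul_ev (lam : ℂ) (j : ℕ) (f : Poly lam) :
    gen lam .G ^ j * evHom lam f = evHom lam ((twist lam (-1))^[j] f) * gen lam .G ^ j := by
  induction j with
  | zero => simp
  | succ j ih =>
    rw [pow_succ' (gen lam .G), mul_assoc, ih, ← mul_assoc, G_mul_ev, Function.iterate_succ_apply',
      mul_assoc]

/-- `(ad F)(f G^{j+1})`, in terms of the product `σ^{j+1}(F G) = G^{j+1} F / G^j`. -/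
theorem adF_ev_mul_G_pow (lam : ℂ) (f : Poly lam) (j : ℕ) :
    adF lam (evHom lam f * gen lam .G ^ (j + 1)) =
      evHom lam (twist lam 1 f * polyFG lam -
        cst lam ((-1) ^ (j + 1)) * f * (twist lam (-1))^[j] (polyGF lam)) * gen lam .G ^ j := by
  rw [adF_homog (isHomog_ev_mul_G_pow lam f (j + 1)), ← mul_assoc, F_mul_ev,
    pow_succ (gen lam .G) j, mul_assoc, mul_assoc, mul_assoc, G_mul_F_eq, G_pow_mul_ev, map_sub,
    sub_mul]
  congr 1
  · rw [← pow_succ (gen lam .G), pow_succ' (gen lam .G), ← mul_assoc (gen lam .F), F_mul_G_eq,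
      map_mul, mul_assoc]
  · rw [map_mul, map_mul, evHom_cst, Algebra.smul_def, mul_assoc, mul_assoc]

theorem shiftHom_shiftHom (lam a b : ℂ) (f : Poly lam) :
    shiftHom lam a (shiftHom lam b f) = shiftHom lam (a + b) f := by
  induction f using Poly.induction with
  | hc c => simp
  | hH => simp [cst_add, add_assoc]
  | ht => simp
  | hadd f g hf hg => simp only [map_add, hf, hg]
  | hmul f g hf hg => simp only [map_mul, hf, hg]

theorem twist_iterate_even (lam : ℂ) (n : ℕ) (f : Poly lam) :
    (twist lam (-1))^[2 * n] f = shiftHom lam (-(2 * n : ℂ)) f := by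
  induction n with
  | zero => simp [shiftHom_zero]
  | succ n ih =>
    rw [mul_add, mul_one, Function.iterate_succ_apply', Function.iterate_succ_apply', ih,
      twist_twist, shiftHom_shiftHom]
    congr 2
    push_cast
    ring

theorem adF_ev_mul_G_pow_even (lam : ℂ) (f : Poly lam) (n : ℕ) :
    adF lam (evHom lam f * gen lam .G ^ (2 * n + 2)) =
      evHom lam (polyFG lam * (twist lam 1 f - f) + cst lam (n + 1) * f) *
        gen lam .G ^ (2 * n + 1) := by
  rw [adF_ev_mul_G_pow, Function.iterate_succ_apply', twist_iterate_even]
  congr 2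
  have h : Even (2 * n + 1 + 1) := ⟨n + 1, by ring⟩
  rw [h.neg_one_pow]
  simp only [polyFG, polyGF, map_mul, map_sub, map_add, shiftHom_pH, shiftHom_pTau, shiftHom_cst,
    twist_pH, twist_pTau, twist_cst]
  simp only [cst_neg, cst_mul, cst_natCast, cst_ofNat, cst_one, cst_add]
  linear_combination ((n + 1 : Poly lam) * f + cst lam (1 / 2) * f) * two_mul_cst_half lam

theorem adF_ev_mul_G_pow_odd (lam : ℂ) (f : Poly lam) (n : ℕ) :
    adF lam (evHom lam f * gen lam .G ^ (2 * n + 1)) =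
      evHom lam (polyFG lam * twist lam 1 f +
        cst lam (1 / 2) * (pH lam - 2 * n - cst lam (1 / 2) + pTau lam) * f) *
        gen lam .G ^ (2 * n) := by
  rw [adF_ev_mul_G_pow, twist_iterate_even]
  congr 2
  have h : Odd (2 * n + 1) := ⟨n, by ring⟩
  rw [h.neg_one_pow]
  simp only [polyGF, map_mul, map_sub, map_add, shiftHom_pH, shiftHom_pTau, shiftHom_cst,
    cst_neg, cst_mul, cst_natCast, cst_ofNat, cst_one]
  ring

/-- The right side is arranged to coincide with the recurrence `evenHahn_succ`. -/
theorem adF_adF_ev_mul_G_pow_even (lam : ℂ) (f : Poly lam) (n : ℕ) :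
    adF lam (adF lam (evHom lam f * gen lam .G ^ (2 * n + 2))) =
      evHom lam (cst lam (1 / 2) ^ 2 * ((pH lam + cst lam (1 / 2) - pTau lam) *
        (pH lam + 3 * cst lam (1 / 2) + pTau lam) * shiftHom lam 2 f -
        (pH lam - 2 * n - 3 * cst lam (1 / 2) - pTau lam) *
        (pH lam - 2 * n - cst lam (1 / 2) + pTau lam) * f)) * gen lam .G ^ (2 * n) := by
  rw [adF_ev_mul_G_pow_even, adF_ev_mul_G_pow_odd]
  congr 2
  have h2 : twist lam 1 (twist lam 1 f) = shiftHom lam 2 f := by rw [twist_twist]; norm_num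
  have h3 : twist lam 1 (n : Poly lam) = n := map_natCast _ _
  simp only [polyFG, map_mul, map_sub, map_add, twist_pH, twist_pTau, twist_cst, cst_add, cst_one,
    cst_natCast, h2, h3, map_one]
  clear h2 h3
  have h := two_mul_cst_half lam
  generalize cst lam (1 / 2) = c at h ⊢
  grind

theorem adF_adF_ev_mul_G_pow_odd (lam : ℂ) (f : Poly lam) (n : ℕ) :
    adF lam (adF lam (evHom lam f * gen lam .G ^ (2 * n + 3))) =
      evHom lam (cst lam (1 / 2) ^ 2 * ((pH lam + cst lam (1 / 2) - pTau lam) *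
        (pH lam + 3 * cst lam (1 / 2) + pTau lam) * shiftHom lam 2 f -
        (pH lam - 2 * n - 5 * cst lam (1 / 2) + pTau lam) *
        (pH lam - 2 * n - 3 * cst lam (1 / 2) - pTau lam) * f)) * gen lam .G ^ (2 * n + 1) := by
  rw [show 2 * n + 3 = 2 * (n + 1) + 1 by ring, adF_ev_mul_G_pow_odd,
    show 2 * (n + 1) = 2 * n + 2 by ring, adF_ev_mul_G_pow_even]
  congr 2
  have h2 : twist lam 1 (twist lam 1 f) = shiftHom lam 2 f := by rw [twist_twist]; norm_num
  have h3 : twist lam 1 (n : Poly lam) = n := map_natCast _ _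
  simp only [polyFG, map_mul, map_sub, map_add, twist_pH, twist_pTau, twist_cst, cst_add, cst_one,
    cst_natCast, h2, Nat.cast_add, Nat.cast_one, map_ofNat, h3, map_one]
  clear h2 h3
  have h := two_mul_cst_half lam
  generalize cst lam (1 / 2) = c at h ⊢
  grind

/-! ### A recurrence for terminating hypergeometric sums -/

theorem poch_zero {A : Type*} [CommRing A] (a : A) : poch a 0 = 1 := by simp [poch]

theorem poch_succ {A : Type*} [CommRing A] (a : A) (n : ℕ) :
    poch a (n + 1) = poch a n * (a + n) := Finset.prod_range_succ _ _

theorem poch_succ' {A : Type*} [CommRing A] (a : A) (n : ℕ) :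
    poch a (n + 1) = a * poch (a + 1) n := by
  simp only [poch, Finset.prod_range_succ', Nat.cast_zero, add_zero, Nat.cast_add, Nat.cast_one]
  rw [mul_comm]
  congr 1
  exact Finset.prod_congr rfl fun m _ => by ring

theorem poch_neg_eq_zero {A : Type*} [CommRing A] (k : ℕ) : poch (-(k : A)) (k + 1) = 0 := by
  rw [poch_succ, neg_add_cancel, mul_zero]

/-- A contiguous relation with `b`, `d`, `e` raised by one. The sum for `k + 1` is compared with
those for `k` at `x` and `x + 1`: each pair of terms on the right splits as `U n + V n`, and the
term with index `n + 1` on the left is `U (n + 1) + V n`. Working with cleared denominators makes it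
valid for every `d` and `e`. -/
theorem hyp32Cleared_succ {A : Type*} [CommRing A] [Algebra ℂ A] (k : ℕ) (b x d e : A) :
    hyp32Cleared (k + 1) b x d e =
      (e - x) * (d - x) * hyp32Cleared k (b + 1) x (d + 1) (e + 1) +
        x * (e + d + k - b - x) * hyp32Cleared k (b + 1) (x + 1) (d + 1) (e + 1) := by
  let r : ℕ → A := fun n => algebraMap ℂ A (n.factorial : ℂ)⁻¹
  have hr : ∀ n, r n = (n + 1) * r (n + 1) := by
    intro n
    simp only [r, Nat.factorial_succ]
    rw [← map_natCast (algebraMap ℂ A) n, ← map_one (algebraMap ℂ A), ← map_add, ← map_mul]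
    congr 1
    have h1 : (n : ℂ) + 1 ≠ 0 := by exact_mod_cast n.succ_ne_zero
    have h2 : (n.factorial : ℂ) ≠ 0 := by exact_mod_cast n.factorial_ne_zero
    push_cast
    field_simp
  let C : ℕ → A := fun n => r n * (poch (-(k : A)) n * poch (b + 1) n *
    poch (d + 1 + n) (k - n) * poch (e + 1 + n) (k - n))
  let U : ℕ → A := fun n => C n * (poch x n * ((e + n) * (d + n)))
  let V : ℕ → A := fun n => -(C n * ((b + n - k) * poch x (n + 1)))
  let W : ℕ → A := fun n => r n * (poch (-((k + 1 : ℕ) : A)) n * poch b n * poch x n *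
    poch (d + n) (k + 1 - n) * poch (e + n) (k + 1 - n))
  have hrhs : (e - x) * (d - x) * hyp32Cleared k (b + 1) x (d + 1) (e + 1) +
        x * (e + d + k - b - x) * hyp32Cleared k (b + 1) (x + 1) (d + 1) (e + 1) =
      ∑ n ∈ Finset.range (k + 1), U n + ∑ n ∈ Finset.range (k + 1), V n := by
    rw [hyp32Cleared, hyp32Cleared, Finset.mul_sum, Finset.mul_sum, ← Finset.sum_add_distrib,
      ← Finset.sum_add_distrib]
    refine Finset.sum_congr rfl fun n _ => ?_
    have h1 := poch_succ x n
    have h2 := poch_succ' x n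
    simp only [U, V, C, r, Algebra.smul_def]
    generalize algebraMap ℂ A (n.factorial : ℂ)⁻¹ = s
    generalize poch (-(k : A)) n = p₁, poch (b + 1) n = p₂, poch (d + 1 + n) (k - n) = p₃,
      poch (e + 1 + n) (k - n) = p₄ at *
    -- After replacing `x (x + 1)_n` by `(x)_n (x + n)`, this is `(e - x)(d - x) + (x + n)(e + d + k
    -- - b - x) = (e + n)(d + n) - (b + n - k)(x + n)`.
    linear_combination (s * p₁ * p₂ * p₃ * p₄) * (-(e + d + k - b - x) * h2 + (e + d - x + n) * h1)
  have hU : ∑ n ∈ Finset.range (k + 1), U n = U 0 + ∑ n ∈ Finset.range (k + 1), U (n + 1) := by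
    have hUk : U (k + 1) = 0 := by simp only [U, C, poch_neg_eq_zero]; ring
    rw [add_comm (U 0), ← Finset.sum_range_succ' U (k + 1), Finset.sum_range_succ U (k + 1), hUk,
      add_zero]
  have hW : hyp32Cleared (k + 1) b x d e = W 0 + ∑ n ∈ Finset.range (k + 1), W (n + 1) := by
    rw [hyp32Cleared, Finset.sum_range_succ', add_comm]
    simp only [W, r, Algebra.smul_def]
  rw [hrhs, hU, hW, add_assoc, ← Finset.sum_add_distrib]
  congr 1
  · simp only [U, W, C, poch_zero, Nat.cast_zero, add_zero, Nat.sub_zero, poch_succ']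
    ring
  · refine Finset.sum_congr rfl fun n hn => ?_
    have hn : n ≤ k := Nat.lt_succ_iff.1 (Finset.mem_range.1 hn)
    -- The factors `d + n + 1` and `e + n + 1` of `U (n + 1)` extend the last two Pochhammer symbols
    -- by one step. At `n = k` the truncated subtraction prevents this, but there both sides vanish
    -- with `(-k)_{k+1}`.
    have hU1 : U (n + 1) = r (n + 1) * (poch (-(k : A)) (n + 1) * poch (b + 1) (n + 1) *
        poch (d + 1 + n) (k - n) * poch (e + 1 + n) (k - n)) * poch x (n + 1) := by
      rcases hn.eq_or_lt with rfl | hlt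
      · simp only [U, C, poch_neg_eq_zero]; ring
      · obtain ⟨m, rfl⟩ := Nat.exists_eq_add_of_lt hlt
        have h1 : n + m + 1 - (n + 1) = m := by omega
        have h2 : n + m + 1 - n = m + 1 := by omega
        simp only [U, C, h1, h2, poch_succ' _ m]
        push_cast
        simp only [add_assoc, add_comm (1 : A)]
        ring
    rw [hU1]
    have h3 : k + 1 - (n + 1) = k - n := by omega
    have h4 : -((k + 1 : ℕ) : A) + 1 = -(k : A) := by push_cast; ring
    simp only [V, W, C, h3, poch_succ' b, poch_succ' (-((k + 1 : ℕ) : A)), h4,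
      poch_succ (-(k : A)), poch_succ (b + 1), hr n]
    rw [show d + 1 + (n : A) = d + ((n + 1 : ℕ) : A) by push_cast; ring,
      show e + 1 + (n : A) = e + ((n + 1 : ℕ) : A) by push_cast; ring]
    push_cast
    ring

/-! ### The Hahn polynomials in `ℂ[H, τ]` -/

theorem shiftHom_poch (lam a : ℂ) (f : Poly lam) (n : ℕ) :
    shiftHom lam a (poch f n) = poch (shiftHom lam a f) n := by
  simp only [poch, map_prod, map_add, map_natCast]

theorem shiftHom_hyp32Cleared (lam a : ℂ) (k : ℕ) (b c d e : Poly lam) :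
    shiftHom lam a (hyp32Cleared k b c d e) = hyp32Cleared k (shiftHom lam a b)
      (shiftHom lam a c) (shiftHom lam a d) (shiftHom lam a e) := by
  simp only [hyp32Cleared, map_sum, smul_eq_cst_mul, map_mul, shiftHom_cst, shiftHom_poch, map_add,
    map_neg, map_natCast]

/-- The polynomial `f_{2k, 2i}`. -/
noncomputable def evenHahn (lam : ℂ) (k i : ℕ) : Poly lam :=
  hyp32Cleared k (cst lam (k + 2 * i + 1))
    (cst lam (1 / 2) * (cst lam (2 * i + 1 / 2) - pTau lam - pH lam))
    (cst lam (i + 1)) (cst lam (i + 1 / 2) - pTau lam)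

/-- The polynomial `f_{2k, 2i + 1} / (i + k + 1)`. -/
noncomputable def oddHahn (lam : ℂ) (k i : ℕ) : Poly lam :=
  hyp32Cleared k (cst lam (k + 2 * i + 2))
    (cst lam (1 / 2) * (cst lam (2 * i + 5 / 2) - pTau lam - pH lam))
    (cst lam (i + 2)) (cst lam (i + 3 / 2) - pTau lam)

theorem cst_three_halves (lam : ℂ) : cst lam (3 / 2) = 1 + cst lam (1 / 2) := by
  rw [← cst_one, ← cst_add]; norm_num

theorem cst_five_halves (lam : ℂ) : cst lam (5 / 2) = 2 + cst lam (1 / 2) := by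
  rw [← cst_ofNat, ← cst_add]; norm_num

/-- This is `hyp32Cleared_succ` with `x` the third upper parameter. Raising `i` by one turns `x`
into `x + 1`, and `H ↦ H + 2` turns it back into `x`, so both sums on the right come from the same
polynomial; `e - x` and `d - x` become `(H + 1/2 - τ)/2` and `(H + 3/2 + τ)/2`. -/
theorem evenHahn_succ (lam : ℂ) (k i : ℕ) : evenHahn lam (k + 1) i =
    cst lam (1 / 2) ^ 2 * ((pH lam + cst lam (1 / 2) - pTau lam) *
        (pH lam + 3 * cst lam (1 / 2) + pTau lam) * shiftHom lam 2 (evenHahn lam k (i + 1)) -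
        (pH lam - 2 * i - 3 * cst lam (1 / 2) - pTau lam) *
        (pH lam - 2 * i - cst lam (1 / 2) + pTau lam) * evenHahn lam k (i + 1)) := by
  have hc := two_mul_cst_half lam
  have hb : cst lam (k + 2 * (i + 1 : ℕ) + 1) = cst lam ((k + 1 : ℕ) + 2 * i + 1) + 1 := by
    rw [← cst_one, ← cst_add]; push_cast; congr 1; ring
  have hd : cst lam ((i + 1 : ℕ) + 1) = cst lam (i + 1) + 1 := by
    rw [← cst_one, ← cst_add]; push_cast; rfl
  have he : cst lam ((i + 1 : ℕ) + 1 / 2) - pTau lam = cst lam (i + 1 / 2) - pTau lam + 1 := by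
    simp only [cst_add, cst_natCast, Nat.cast_add, Nat.cast_one, cst_one]; ring
  have hx : cst lam (1 / 2) * (cst lam (2 * (i + 1 : ℕ) + 1 / 2) - pTau lam - pH lam) =
      cst lam (1 / 2) * (cst lam (2 * i + 1 / 2) - pTau lam - pH lam) + 1 := by
    simp only [cst_add, cst_mul, cst_natCast, Nat.cast_add, Nat.cast_one, cst_one, cst_ofNat]
    linear_combination hc
  have hx' : shiftHom lam 2
        (cst lam (1 / 2) * (cst lam (2 * i + 1 / 2) - pTau lam - pH lam) + 1) =
      cst lam (1 / 2) * (cst lam (2 * i + 1 / 2) - pTau lam - pH lam) := by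
    simp only [map_add, map_mul, map_sub, shiftHom_cst, shiftHom_pTau, shiftHom_pH, map_one,
      cst_ofNat]
    linear_combination -hc
  rw [evenHahn, hyp32Cleared_succ, evenHahn, shiftHom_hyp32Cleared, hb, hd, he, hx, hx']
  simp only [map_add, map_sub, map_one, shiftHom_cst, shiftHom_pTau]
  generalize (hyp32Cleared k _ _ _ _ : Poly lam) = P, (hyp32Cleared k _ _ _ _ : Poly lam) = Q
  simp only [cst_add, cst_mul, cst_natCast, Nat.cast_add, Nat.cast_one, cst_one, cst_ofNat]
  generalize cst lam (1 / 2) = c at hc ⊢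
  clear hb hd he hx hx'
  grind

theorem oddHahn_succ (lam : ℂ) (k i : ℕ) : oddHahn lam (k + 1) i =
    cst lam (1 / 2) ^ 2 * ((pH lam + cst lam (1 / 2) - pTau lam) *
        (pH lam + 3 * cst lam (1 / 2) + pTau lam) * shiftHom lam 2 (oddHahn lam k (i + 1)) -
        (pH lam - 2 * i - 5 * cst lam (1 / 2) + pTau lam) *
        (pH lam - 2 * i - 3 * cst lam (1 / 2) - pTau lam) * oddHahn lam k (i + 1)) := by
  have hc := two_mul_cst_half lam
  have hb : cst lam (k + 2 * (i + 1 : ℕ) + 2) = cst lam ((k + 1 : ℕ) + 2 * i + 2) + 1 := by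
    rw [← cst_one, ← cst_add]; push_cast; congr 1; ring
  have hd : cst lam ((i + 1 : ℕ) + 2) = cst lam (i + 2) + 1 := by
    rw [← cst_one, ← cst_add]; push_cast; congr 1; ring
  have he : cst lam ((i + 1 : ℕ) + 3 / 2) - pTau lam = cst lam (i + 3 / 2) - pTau lam + 1 := by
    simp only [cst_add, cst_natCast, Nat.cast_add, Nat.cast_one, cst_one]; ring
  have hx : cst lam (1 / 2) * (cst lam (2 * (i + 1 : ℕ) + 5 / 2) - pTau lam - pH lam) =
      cst lam (1 / 2) * (cst lam (2 * i + 5 / 2) - pTau lam - pH lam) + 1 := by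
    simp only [cst_add, cst_mul, cst_natCast, Nat.cast_add, Nat.cast_one, cst_one, cst_ofNat]
    linear_combination hc
  have hx' : shiftHom lam 2
        (cst lam (1 / 2) * (cst lam (2 * i + 5 / 2) - pTau lam - pH lam) + 1) =
      cst lam (1 / 2) * (cst lam (2 * i + 5 / 2) - pTau lam - pH lam) := by
    simp only [map_add, map_mul, map_sub, shiftHom_cst, shiftHom_pTau, shiftHom_pH, map_one,
      cst_ofNat]
    linear_combination -hc
  rw [oddHahn, hyp32Cleared_succ, oddHahn, shiftHom_hyp32Cleared, hb, hd, he, hx, hx']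
  simp only [map_add, map_sub, map_one, shiftHom_cst, shiftHom_pTau]
  generalize (hyp32Cleared k _ _ _ _ : Poly lam) = P, (hyp32Cleared k _ _ _ _ : Poly lam) = Q
  simp only [cst_add, cst_mul, cst_natCast, Nat.cast_add, Nat.cast_one, cst_one, cst_ofNat,
    cst_three_halves, cst_five_halves]
  generalize cst lam (1 / 2) = c at hc ⊢
  clear hb hd he hx hx'
  grind

theorem hyp32Cleared_zero {A : Type*} [CommRing A] [Algebra ℂ A] (b c d e : A) :
    hyp32Cleared 0 b c d e = 1 := by
  simp [hyp32Cleared, poch_zero]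

/-- The induction needs all `i`: splitting off the outermost `(ad F)²` leaves the same statement
with `k` for `k + 1` and `i + 1` for `i`. -/
theorem adF_iterate_G_pow_even (lam : ℂ) (k i : ℕ) :
    (adF lam)^[2 * k] (gen lam .G ^ (2 * i + 2 * k)) =
      evHom lam (evenHahn lam k i) * gen lam .G ^ (2 * i) := by
  induction k generalizing i with
  | zero => simp [evenHahn, hyp32Cleared_zero]
  | succ k ih =>
    rw [mul_add, mul_one, Function.iterate_succ_apply', Function.iterate_succ_apply',
      show 2 * i + (2 * k + 2) = 2 * (i + 1) + 2 * k by ring, ih, mul_add, mul_one,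
      adF_adF_ev_mul_G_pow_even, evenHahn_succ]

theorem adF_iterate_G_pow_odd (lam : ℂ) (k i : ℕ) :
    (adF lam)^[2 * k] (gen lam .G ^ (2 * i + 1 + 2 * k)) =
      evHom lam (oddHahn lam k i) * gen lam .G ^ (2 * i + 1) := by
  induction k generalizing i with
  | zero => simp [oddHahn, hyp32Cleared_zero]
  | succ k ih =>
    rw [mul_add, mul_one, Function.iterate_succ_apply', Function.iterate_succ_apply',
      show 2 * i + 1 + (2 * k + 2) = 2 * (i + 1) + 1 + 2 * k by ring, ih,
      show 2 * (i + 1) + 1 = 2 * i + 3 by ring, adF_adF_ev_mul_G_pow_odd, oddHahn_succ]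

/-! ### The family `f_{k,j}` -/

theorem adF_G_pow_even (lam : ℂ) (n : ℕ) :
    adF lam (gen lam .G ^ (2 * n + 2)) = (n + 1 : ℂ) • gen lam .G ^ (2 * n + 1) := by
  have h := adF_ev_mul_G_pow_even lam 1 n
  rw [map_one, one_mul, map_one, sub_self, mul_zero, zero_add, mul_one, evHom_cst,
    ← Algebra.smul_def] at h
  exact h

theorem G_pow_odd_mul_tau (lam : ℂ) (n : ℕ) : gen lam .G ^ (2 * n + 1) * tau lam =
    evHom lam (-pTau lam) * gen lam .G ^ (2 * n + 1) := by
  rw [← evHom_pTau, G_pow_mul_ev, Function.iterate_succ_apply', twist_iterate_even, shiftHom_pTau,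
    twist_pTau]

/-- The terms with `H` cancel, so the coefficient lies in `ℂ[τ]`; it is the factor by which the
odd-index polynomials differ from the even-index ones. -/
theorem adF_G_pow_mul_tau (lam : ℂ) (n : ℕ) :
    adF lam (gen lam .G ^ (2 * n + 1) * tau lam) =
      evHom lam (cst lam (1 / 2) * (cst lam (2 * n + 1) * pTau lam -
        cst lam (2 * (lam + 1 / 2) ^ 2))) * gen lam .G ^ (2 * n) := by
  rw [G_pow_odd_mul_tau, adF_ev_mul_G_pow_odd]
  congr 2
  have ht : pTau lam ^ 2 = cst lam ((lam + 1 / 2) ^ 2) := pTau_sq lam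
  rw [cst_mul, ← ht]
  simp only [polyFG, map_neg, twist_pTau, cst_add, cst_mul, cst_natCast, cst_ofNat, cst_one]
  linear_combination (cst lam (1 / 2) * pTau lam) * two_mul_cst_half lam

/-- The polynomials `f_{k,j}`. -/
noncomputable def hahnFamily (lam : ℂ) (k j : ℕ) : Poly lam :=
  if Even j then
    (if Even k then evenHahn lam (k / 2) (j / 2) else
      cst lam (1 / 2) * (cst lam (2 * (k / 2 : ℕ) + 2 * (j / 2 : ℕ) + 1) * pTau lam -
        cst lam (2 * (lam + 1 / 2) ^ 2)) * evenHahn lam (k / 2) (j / 2))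
  else
    (if Even k then cst lam ((j / 2 : ℕ) + (k / 2 : ℕ) + 1) * oddHahn lam (k / 2) (j / 2) else
      -pTau lam * oddHahn lam (k / 2) (j / 2))

section hahnFamily

variable (lam : ℂ) (k i : ℕ)

theorem half_odd (n : ℕ) : (2 * n + 1) / 2 = n := by omega

theorem hahnFamily_even_even : hahnFamily lam (2 * k) (2 * i) = evenHahn lam k i := by
  simp [hahnFamily]

theorem hahnFamily_odd_even : hahnFamily lam (2 * k + 1) (2 * i) =
    cst lam (1 / 2) * (cst lam (2 * k + 2 * i + 1) * pTau lam -
        cst lam (2 * (lam + 1 / 2) ^ 2)) * evenHahn lam k i := by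
  simp [hahnFamily, half_odd]

theorem hahnFamily_even_odd : hahnFamily lam (2 * k) (2 * i + 1) =
    cst lam (i + k + 1) * oddHahn lam k i := by
  simp [hahnFamily, half_odd]

theorem hahnFamily_odd_odd : hahnFamily lam (2 * k + 1) (2 * i + 1) =
    -pTau lam * oddHahn lam k i := by
  simp [hahnFamily, half_odd]

end hahnFamily

theorem isFamily_hahnFamily (lam : ℂ) : IsFamily lam (hahnFamily lam) where
  even_even k i hk := by
    obtain ⟨k, rfl⟩ := even_iff_exists_two_mul.1 hk
    rw [hahnFamily_even_even, ev_eq, adF_iterate_G_pow_even]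
  odd_even k i hk := by
    obtain ⟨k, rfl⟩ : ∃ m, k = 2 * m + 1 := hk
    -- The innermost `ad F` produces a factor from `ℂ[τ]`, which then passes through the remaining
    -- `(ad F)^{2k}`.
    rw [hahnFamily_odd_even, ev_eq, Function.iterate_succ_apply (adF lam) (2 * k),
      show 2 * i + (2 * k + 1) = 2 * (i + k) + 1 by ring, adF_G_pow_mul_tau,
      adF_iterate_even_mul (F_sq_mul_ev_of_shift (by simp)), mul_add, adF_iterate_G_pow_even,
      ← mul_assoc, ← map_mul]
    push_cast
    ring_nf
  even_odd k i hk := by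
    obtain ⟨k, rfl⟩ := even_iff_exists_two_mul.1 hk
    rw [hahnFamily_even_odd, ev_eq, Function.iterate_succ_apply (adF lam) (2 * k),
      show 2 * i + 2 * k + 2 = 2 * (i + k) + 2 by ring, adF_G_pow_even, adF_iterate_smul,
      show 2 * (i + k) + 1 = 2 * i + 1 + 2 * k by ring, adF_iterate_G_pow_odd, map_mul, evHom_cst,
      mul_assoc, ← Algebra.smul_def]
    push_cast
    rfl
  odd_odd k i hk := by
    obtain ⟨k, rfl⟩ : ∃ m, k = 2 * m + 1 := hk
    rw [hahnFamily_odd_odd, ev_eq, Nat.add_sub_cancel,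
      show 2 * i + (2 * k + 1) = 2 * (i + k) + 1 by ring, G_pow_odd_mul_tau,
      adF_iterate_even_mul (F_sq_mul_ev_of_shift (by simp)),
      show 2 * (i + k) + 1 = 2 * i + 1 + 2 * k by ring, adF_iterate_G_pow_odd, ← mul_assoc,
      ← map_mul]

/-- Each defining relation prescribes `f_{k,j} G^j`, and `f ↦ f G^j` is injective. -/
theorem IsFamily.eq_hahnFamily {lam : ℂ} {f : ℕ → ℕ → Poly lam} (hf : IsFamily lam f) :
    f = hahnFamily lam := by
  have hg := isFamily_hahnFamily lam
  funext k j
  rcases Nat.even_or_odd' j with ⟨i, rfl | rfl⟩ <;> rcases Nat.even_or_odd k with hk | hk <;>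
    [apply ev_mul_G_pow_injective (j := 2 * i); apply ev_mul_G_pow_injective (j := 2 * i);
      apply ev_mul_G_pow_injective (j := 2 * i + 1);
      apply ev_mul_G_pow_injective (j := 2 * i + 1)] <;> rw [← ev_eq, ← ev_eq]
  · rw [hf.even_even k i hk, hg.even_even k i hk]
  · rw [hf.odd_even k i hk, hg.odd_even k i hk]
  · rw [hf.even_odd k i hk, hg.even_odd k i hk]
  · rw [hf.odd_odd k i hk, hg.odd_odd k i hk]

/-! ### The adjoint action of `τ` -/

/-- This is `[H, F] = -F` with `H` replaced by `G F + F G`. -/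
theorem F_eq (lam : ℂ) : gen lam .F =
    gen lam .F * gen lam .F * gen lam .G - gen lam .G * gen lam .F * gen lam .F := by
  have h := H_mul_F lam
  rw [← G_mul_F] at h
  have h2 : gen lam .F = gen lam .F * (gen lam .G * gen lam .F + gen lam .F * gen lam .G) -
      (gen lam .G * gen lam .F + gen lam .F * gen lam .G) * gen lam .F := by
    rw [h]; abel
  conv_lhs => rw [h2]
  noncomm_ring

/-- The adjoint action of `τ = H + 1/2 - 2 F G`. -/
noncomputable def adTau (lam : ℂ) (u : B lam) : B lam :=
  gen lam .H * u - u * gen lam .H + (1 / 2 : ℂ) • u - (2 : ℂ) • adF lam (adG lam u)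

theorem adF_add {lam : ℂ} (u v : B lam) : adF lam (u + v) = adF lam u + adF lam v := by
  simp only [adF, map_add]; noncomm_ring

theorem adF_sub {lam : ℂ} (u v : B lam) : adF lam (u - v) = adF lam u - adF lam v := by
  simp only [adF, map_sub]; noncomm_ring

theorem parityAut_H (lam : ℂ) : parityAut lam (gen lam .H) = gen lam .H := by simp [parity]

/-- The adjoint form of `τ F = -F τ`: the sum of the two sides is the supercommutator of `u` with `F
- (F² G - G F²)`, which is zero by `F_eq`. -/
theorem adTau_adF {lam : ℂ} (u : B lam) : adTau lam (adF lam u) = -adF lam (adTau lam u) := by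
  have h : adTau lam (adF lam u) + adF lam (adTau lam u) =
      (gen lam .F - (gen lam .F * gen lam .F * gen lam .G -
        gen lam .G * gen lam .F * gen lam .F)) * u -
      parityAut lam u * (gen lam .F - (gen lam .F * gen lam .F * gen lam .G -
        gen lam .G * gen lam .F * gen lam .F)) := by
    have hhalf : (1 / 2 : ℂ) • adF lam u + (1 / 2 : ℂ) • adF lam u = adF lam u := by
      rw [← add_smul]; norm_num
    have e1 : adTau lam (adF lam u) + adF lam (adTau lam u) =
        gen lam .H * adF lam u - adF lam u * gen lam .H +
        adF lam (gen lam .H * u - u * gen lam .H) + adF lam u -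
        (2 * adF lam (adG lam (adF lam u)) + 2 * adF lam (adF lam (adG lam u))) := by
      simp only [adTau, adF_add, adF_sub, adF_smul, two_smul, two_mul]
      generalize (1 / 2 : ℂ) • adF lam u = w at hhalf ⊢
      rw [← hhalf]
      abel
    rw [e1]
    simp only [adG, adF, map_sub, map_mul, map_neg, parityAut_parityAut, parityAut_F, parityAut_G,
      parityAut_H]
    rw [← G_mul_F]
    noncomm_ring
  rw [← F_eq, sub_self, zero_mul, mul_zero, sub_zero] at h
  exact eq_neg_of_add_eq_zero_left h

theorem adTau_adF_iterate {lam e : ℂ} {u : B lam} (hu : adTau lam u = e • u) (m : ℕ) :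
    adTau lam ((adF lam)^[m] u) = ((-1) ^ m * e) • (adF lam)^[m] u := by
  induction m with
  | zero => simpa using hu
  | succ m ih =>
    rw [Function.iterate_succ_apply', adTau_adF, ih, adF_smul, ← neg_smul]
    congr 1
    ring

theorem H_mul_G_pow (lam : ℂ) (j : ℕ) : gen lam .H * gen lam .G ^ j =
    gen lam .G ^ j * gen lam .H + (j : ℂ) • gen lam .G ^ j := by
  induction j with
  | zero => simp
  | succ j ih =>
    rw [pow_succ (gen lam .G), ← mul_assoc, ih, add_mul, mul_assoc, H_mul_G, smul_mul_assoc,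
      mul_add,
      ← mul_assoc, add_assoc, Nat.cast_add, Nat.cast_one, add_smul, one_smul,
      add_comm (gen _ _ ^ _ * _)]

theorem H_mul_ev (lam : ℂ) (f : Poly lam) :
    gen lam .H * evHom lam f = evHom lam f * gen lam .H := by
  rw [← evHom_pH, ← map_mul, ← map_mul, mul_comm]

theorem H_commutator_ev_mul_G_pow (lam : ℂ) (f : Poly lam) (j : ℕ) :
    gen lam .H * (evHom lam f * gen lam .G ^ j) - evHom lam f * gen lam .G ^ j * gen lam .H =
      (j : ℂ) • (evHom lam f * gen lam .G ^ j) := by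
  rw [← mul_assoc, H_mul_ev, mul_assoc, H_mul_G_pow, mul_add, mul_assoc, add_sub_cancel_left,
    mul_smul_comm]

theorem adG_ev_mul_G_pow (lam : ℂ) (f : Poly lam) (j : ℕ) :
    adG lam (evHom lam f * gen lam .G ^ j) =
      evHom lam (twist lam (-1) f - cst lam ((-1) ^ j) * f) * gen lam .G ^ (j + 1) := by
  rw [adG_homog (isHomog_ev_mul_G_pow lam f j), ← mul_assoc, G_mul_ev, pow_succ' (gen lam .G) j,
    map_sub, map_mul, evHom_cst, sub_mul, ← Algebra.smul_def, smul_mul_assoc, mul_assoc, mul_assoc,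
    ← pow_succ (gen lam .G), ← pow_succ' (gen lam .G)]

/-- On a vector killed by `ad G` only `H + 1/2` contributes, and `f G^j` has weight `j`. -/
theorem adTau_of_adG_eq_zero {lam : ℂ} {f : Poly lam} {j : ℕ}
    (h : adG lam (evHom lam f * gen lam .G ^ j) = 0) :
    adTau lam (evHom lam f * gen lam .G ^ j) =
      (j + 1 / 2 : ℂ) • (evHom lam f * gen lam .G ^ j) := by
  rw [adTau, H_commutator_ev_mul_G_pow, h, adF_zero, smul_zero, sub_zero, ← add_smul]

theorem adG_G_pow_even (lam : ℂ) {j : ℕ} (hj : Even j) : adG lam (gen lam .G ^ j) = 0 := by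
  have h := adG_ev_mul_G_pow lam 1 j
  rwa [map_one, one_mul, map_one, hj.neg_one_pow, cst_one, mul_one, sub_self, map_zero,
    zero_mul] at h

/-- An odd power of `G` does not supercommute with `G`; the extra sign from moving `G` past `τ`
repairs this, which explains the factor `τ` in the definition of the family. -/
theorem adG_G_pow_mul_tau (lam : ℂ) {j : ℕ} (hj : Odd j) :
    adG lam (gen lam .G ^ j * tau lam) = 0 := by
  obtain ⟨n, rfl⟩ : ∃ n, j = 2 * n + 1 := hj
  rw [G_pow_odd_mul_tau, adG_ev_mul_G_pow, Odd.neg_one_pow ⟨n, rfl⟩, cst_neg, cst_one, map_neg,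
    twist_pTau]
  simp

theorem adTau_G_pow (lam : ℂ) {j : ℕ} (hj : Even j) :
    adTau lam (gen lam .G ^ j) = (j + 1 / 2 : ℂ) • gen lam .G ^ j := by
  have h := adTau_of_adG_eq_zero (lam := lam) (f := 1) (j := j)
  rw [map_one, one_mul] at h
  exact h (adG_G_pow_even lam hj)

theorem adTau_G_pow_mul_tau (lam : ℂ) {j : ℕ} (hj : Odd j) :
    adTau lam (gen lam .G ^ j * tau lam) = (j + 1 / 2 : ℂ) • (gen lam .G ^ j * tau lam) := by
  have h := adG_G_pow_mul_tau lam hj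
  obtain ⟨n, rfl⟩ : ∃ n, j = 2 * n + 1 := hj
  rw [G_pow_odd_mul_tau] at h ⊢
  exact adTau_of_adG_eq_zero h

/-! ### The adjoint action of `τ` as a difference operator -/

theorem Del_eq {lam : ℂ} (f : Poly lam) : Del f = twist lam 1 f - f := rfl

theorem Nab_eq {lam : ℂ} (f : Poly lam) : Nab f = f - twist lam (-1) f := rfl

theorem Del2_eq {lam : ℂ} (f : Poly lam) : Del2 f = shiftHom lam 2 f - f := rfl

theorem Nab2_eq {lam : ℂ} (f : Poly lam) : Nab2 f = f - shiftHom lam (-2) f := rfl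

theorem Del_Nab {lam : ℂ} (f : Poly lam) :
    Del (Nab f) = twist lam 1 f - 2 * f + twist lam (-1) f := by
  rw [Del_eq, Nab_eq, map_sub, twist_twist_of_add_eq_zero (by norm_num)]
  ring

theorem Del2_Nab2 {lam : ℂ} (f : Poly lam) :
    Del2 (Nab2 f) = shiftHom lam 2 f - 2 * f + shiftHom lam (-2) f := by
  rw [Del2_eq, Nab2_eq, map_sub, shiftHom_shiftHom, add_neg_cancel, shiftHom_zero]
  ring

theorem adTau_ev_mul_G_pow_even (lam : ℂ) (f : Poly lam) (i : ℕ) :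
    adTau lam (evHom lam f * gen lam .G ^ (2 * i)) =
      evHom lam ((pH lam - pTau lam + cst lam (1 / 2)) * Del (Nab f) +
        2 * (pH lam - cst lam i) * Nab f + cst lam (2 * i + 1 / 2) * f) * gen lam .G ^ (2 * i) := by
  rw [adTau, H_commutator_ev_mul_G_pow, adG_ev_mul_G_pow, adF_ev_mul_G_pow_odd]
  simp only [← smul_mul_assoc, ← evHom_smul, ← add_mul, ← sub_mul, ← map_add, ← map_sub]
  congr 2
  rw [Del_Nab, Nab_eq, Even.neg_one_pow ⟨i, two_mul i⟩]
  simp only [smul_eq_cst_mul, polyFG, map_sub, map_mul, twist_cst,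
    twist_twist_of_add_eq_zero (show (1 : ℂ) + -1 = 0 by norm_num)]
  simp only [cst_add, cst_mul, Nat.cast_mul, cst_natCast, cst_ofNat, cst_one, Nat.cast_ofNat]
  have hc := two_mul_cst_half lam
  generalize twist lam 1 f = fp, twist lam (-1) f = fm, cst lam (1 / 2) = c at *
  grind

/-- For odd powers of `G` the difference operator is the negative of the adjoint action, so its
eigenvalues change sign. -/
theorem adTau_ev_mul_G_pow_odd (lam : ℂ) (f : Poly lam) (i : ℕ) :
    adTau lam (evHom lam f * gen lam .G ^ (2 * i + 1)) =
      evHom lam (-((pH lam - pTau lam + cst lam (1 / 2)) * Del (Nab f) +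
        2 * (pH lam - pTau lam - cst lam (i + 1 / 2)) * Nab f + cst lam (2 * i + 5 / 2) * f)) *
          gen lam .G ^ (2 * i + 1) := by
  rw [adTau, H_commutator_ev_mul_G_pow, adG_ev_mul_G_pow, adF_ev_mul_G_pow_even]
  simp only [← smul_mul_assoc, ← evHom_smul, ← add_mul, ← sub_mul, ← map_add, ← map_sub]
  congr 2
  rw [Del_Nab, Nab_eq, Odd.neg_one_pow ⟨i, rfl⟩]
  simp only [smul_eq_cst_mul, polyFG, map_sub, map_mul, twist_cst,
    twist_twist_of_add_eq_zero (show (1 : ℂ) + -1 = 0 by norm_num)]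
  simp only [cst_add, cst_mul, Nat.cast_mul, cst_natCast, cst_ofNat, cst_one, Nat.cast_ofNat,
    Nat.cast_add, Nat.cast_one, cst_five_halves, cst_neg]
  have hc := two_mul_cst_half lam
  generalize twist lam 1 f = fp, twist lam (-1) f = fm, cst lam (1 / 2) = c at *
  grind

/-- The starting vector of weight `2i + k` has eigenvalue `2i + k + 1/2`, and each of the `k`
applications of `ad F` changes the sign. -/
theorem IsFamily.tau_action_even {lam : ℂ} {f : ℕ → ℕ → Poly lam} (hf : IsFamily lam f)
    (k i : ℕ) :
    (pH lam - pTau lam + cst lam (1 / 2)) * Del (Nab (f k (2 * i))) +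
        2 * (pH lam - cst lam i) * Nab (f k (2 * i)) + cst lam (2 * i + 1 / 2) * f k (2 * i) =
      cst lam ((-1) ^ k * (2 * i + k + 1 / 2)) * f k (2 * i) := by
  apply ev_mul_G_pow_injective (j := 2 * i)
  rw [← adTau_ev_mul_G_pow_even, ← smul_eq_cst_mul, evHom_smul, smul_mul_assoc, ← ev_eq]
  rcases Nat.even_or_odd k with hk | hk
  · rw [hf.even_even k i hk, adTau_adF_iterate (adTau_G_pow lam ((even_two_mul i).add hk))]
    push_cast
    rfl
  · rw [hf.odd_even k i hk,
      adTau_adF_iterate (adTau_G_pow_mul_tau lam ((even_two_mul i).add_odd hk))]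
    push_cast
    rfl

theorem IsFamily.tau_action_odd {lam : ℂ} {f : ℕ → ℕ → Poly lam} (hf : IsFamily lam f)
    (k i : ℕ) :
    (pH lam - pTau lam + cst lam (1 / 2)) * Del (Nab (f k (2 * i + 1))) +
        2 * (pH lam - pTau lam - cst lam (i + 1 / 2)) * Nab (f k (2 * i + 1)) +
        cst lam (2 * i + 5 / 2) * f k (2 * i + 1) =
      (if Even k then cst lam (2 * i + k + 5 / 2) else -cst lam (2 * i + k + 1 / 2)) *
        f k (2 * i + 1) := by
  apply ev_mul_G_pow_injective (j := 2 * i + 1)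
  rw [← neg_neg ((pH lam - pTau lam + cst lam (1 / 2)) * _ + _ + _), map_neg, neg_mul,
    ← adTau_ev_mul_G_pow_odd, ← ev_eq]
  split_ifs with hk
  · rw [hf.even_odd k i hk, adTau_adF_iterate (adTau_G_pow lam (((even_two_mul i).add hk).add
      even_two)), ← smul_eq_cst_mul, evHom_smul, smul_mul_assoc, ← ev_eq, hf.even_odd k i hk,
      ← neg_smul, hk.add_one.neg_one_pow]
    congr 1
    push_cast
    ring
  · have hk := Nat.not_even_iff_odd.1 hk
    rw [hf.odd_odd k i hk,
      adTau_adF_iterate (adTau_G_pow_mul_tau lam ((even_two_mul i).add_odd hk)),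
      ← cst_neg, ← smul_eq_cst_mul, evHom_smul, smul_mul_assoc, ← ev_eq, hf.odd_odd k i hk,
      ← neg_smul, (Nat.Odd.sub_odd hk odd_one).neg_one_pow]
    congr 1
    push_cast
    ring

/-! ### The adjoint action of the Casimir element of `sl(2)` -/

/-- Here `fp`, `fm`, `fpp`, `fmm` stand for `f` shifted by `1`, `-1`, `2`, `-2`, and `c` for `1/2`.
If `D` is the operator in `h0`, the claim concerns `(D + c)² - (e + c)² = (D + e + 1)(D - e)`. The
three multipliers in `key` are the coefficients of `D + e + 1`, applied to the equations `D f = e f`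
at the shifted and unshifted points. -/
theorem casimir_even_aux {A : Type*} [CommRing A] {H t c I e f fp fm fpp fmm : A} (hc : 2 * c = 1)
    (h0 : (H - t + c) * (fp - 2 * f + fm) + 2 * (H - I) * (f - fm) + (2 * I + c) * f = e * f)
    (hp : (H + 1 + t + c) * (fpp - 2 * fp + f) + 2 * (H + 1 - I) * (fp - f) + (2 * I + c) * fp =
      e * fp)
    (hm : (H - 1 + t + c) * (f - 2 * fm + fmm) + 2 * (H - 1 - I) * (fm - fmm) + (2 * I + c) * fm =
      e * fm) :
    ((H + 1) ^ 2 - (t + c) ^ 2) * (fpp - 2 * f + fmm) + 4 * (I + 1) * (H - I) * (f - fmm) +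
      4 * I * (I + 1) * f = ((e + c) ^ 2 - 1) * f := by
  have key : ((H + 1) ^ 2 - (t + c) ^ 2) * (fpp - 2 * f + fmm) + 4 * (I + 1) * (H - I) * (f - fmm) +
      4 * I * (I + 1) * f - ((e + c) ^ 2 - 1) * f =
      (H - t + c) * ((H + 1 + t + c) * (fpp - 2 * fp + f) + 2 * (H + 1 - I) * (fp - f) +
        (2 * I + c) * fp - e * fp) +
      (-H - t + c + 2 * I) * ((H - 1 + t + c) * (f - 2 * fm + fmm) +
        2 * (H - 1 - I) * (fm - fmm) + (2 * I + c) * fm - e * fm) +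
      (e + 2 * t + c) * ((H - t + c) * (fp - 2 * f + fm) + 2 * (H - I) * (f - fm) +
        (2 * I + c) * f - e * f) := by
    clear h0 hp hm
    grind
  rw [h0, hp, hm] at key
  linear_combination key

/-- As in the even case, but `D` is now minus the action of `τ`, so the factorization is `(D - c)² -
(e - c)² = (D + e - 1)(D - e)`. -/
theorem casimir_odd_aux {A : Type*} [CommRing A] {H t c I e f fp fm fpp fmm : A} (hc : 2 * c = 1)
    (h0 : (H - t + c) * (fp - 2 * f + fm) + 2 * (H - t - (I + c)) * (f - fm) +
      (2 * I + (2 + c)) * f = e * f)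
    (hp : (H + 1 + t + c) * (fpp - 2 * fp + f) + 2 * (H + 1 + t - (I + c)) * (fp - f) +
      (2 * I + (2 + c)) * fp = e * fp)
    (hm : (H - 1 + t + c) * (f - 2 * fm + fmm) + 2 * (H - 1 + t - (I + c)) * (fm - fmm) +
      (2 * I + (2 + c)) * fm = e * fm) :
    ((H + 1) ^ 2 - (t + c) ^ 2) * (fpp - 2 * f + fmm) +
      ((2 * I + 3) * (2 * H - (2 * I + 1)) - 2 * t) * (f - fmm) +
      (2 * I + 1) * (2 * I + 3) * f = ((e - c) ^ 2 - 1) * f := by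
  have key : ((H + 1) ^ 2 - (t + c) ^ 2) * (fpp - 2 * f + fmm) +
      ((2 * I + 3) * (2 * H - (2 * I + 1)) - 2 * t) * (f - fmm) +
      (2 * I + 1) * (2 * I + 3) * f - ((e - c) ^ 2 - 1) * f =
      (H - t + c) * ((H + 1 + t + c) * (fpp - 2 * fp + f) + 2 * (H + 1 + t - (I + c)) * (fp - f) +
        (2 * I + (2 + c)) * fp - e * fp) +
      (-H + t + 3 * c + 2 * I) * ((H - 1 + t + c) * (f - 2 * fm + fmm) +
        2 * (H - 1 + t - (I + c)) * (fm - fmm) + (2 * I + (2 + c)) * fm - e * fm) +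
      (e - c) * ((H - t + c) * (fp - 2 * f + fm) + 2 * (H - t - (I + c)) * (f - fm) +
        (2 * I + (2 + c)) * f - e * f) := by
    clear h0 hp hm
    grind
  rw [h0, hp, hm] at key
  linear_combination key

theorem IsFamily.casimir_action_even {lam : ℂ} {f : ℕ → ℕ → Poly lam} (hf : IsFamily lam f)
    (k i : ℕ) :
    ((pH lam + 1) ^ 2 - (pTau lam + cst lam (1 / 2)) ^ 2) * Del2 (Nab2 (f k (2 * i))) +
        cst lam (4 * (i + 1)) * (pH lam - cst lam i) * Nab2 (f k (2 * i)) +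
        cst lam (4 * i * (i + 1)) * f k (2 * i) =
      (if Even k then cst lam ((2 * i + k) * (2 * i + k + 2))
        else cst lam ((2 * i + k - 1) * (2 * i + k + 1))) * f k (2 * i) := by
  have h0 := hf.tau_action_even k i
  have hc := two_mul_cst_half lam
  set e := cst lam ((-1) ^ k * (2 * i + k + 1 / 2)) with he
  have he' : (e + cst lam (1 / 2)) ^ 2 - 1 = if Even k then cst lam ((2 * i + k) * (2 * i + k + 2))
        else cst lam ((2 * i + k - 1) * (2 * i + k + 1)) := by
    rw [he, ← cst_add, ← cst_pow, ← cst_one, ← cst_sub, ← apply_ite (cst lam)]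
    congr 1
    split_ifs with hk
    · rw [hk.neg_one_pow]; ring
    · rw [(Nat.not_even_iff_odd.1 hk).neg_one_pow]; ring
  have e1 : ∀ g : Poly lam, twist lam 1 (twist lam 1 g) = shiftHom lam 2 g := fun g => by
    rw [twist_twist]; norm_num
  have e2 : ∀ g : Poly lam, twist lam (-1) (twist lam (-1) g) = shiftHom lam (-2) g := fun g => by
    rw [twist_twist]; norm_num
  have e3 : ∀ g : Poly lam, twist lam 1 (twist lam (-1) g) = g :=
    twist_twist_of_add_eq_zero (by norm_num)
  have e4 : ∀ g : Poly lam, twist lam (-1) (twist lam 1 g) = g :=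
    twist_twist_of_add_eq_zero (by norm_num)
  rw [Del_Nab, Nab_eq, cst_add (lam := lam), cst_mul (lam := lam), cst_ofNat] at h0
  -- The first-order shifts of the eigenvalue equation supply its instances at `(H ± 1, -τ)`, as
  -- needed for the elimination.
  have hp := congrArg (twist lam 1) h0
  have hm := congrArg (twist lam (-1)) h0
  simp only [map_add, map_mul, map_sub, map_ofNat, twist_pH, twist_pTau, twist_cst, e1, e2, e3, e4,
    cst_one, cst_neg, he, ← sub_eq_add_neg, sub_neg_eq_add] at hp hm
  rw [← he', Del2_Nab2, Nab2_eq]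
  have := casimir_even_aux (H := pH lam) (t := pTau lam) (I := cst lam i) (e := e)
    (f := f k (2 * i)) hc h0 hp hm
  rw [← this]
  simp only [cst_add, cst_mul, cst_ofNat, cst_one]

theorem IsFamily.casimir_action_odd {lam : ℂ} {f : ℕ → ℕ → Poly lam} (hf : IsFamily lam f)
    (k i : ℕ) :
    ((pH lam + 1) ^ 2 - (pTau lam + cst lam (1 / 2)) ^ 2) * Del2 (Nab2 (f k (2 * i + 1))) +
        (cst lam (2 * i + 3) * (2 * pH lam - cst lam (2 * i + 1)) - 2 * pTau lam) *
          Nab2 (f k (2 * i + 1)) +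
        cst lam ((2 * i + 1) * (2 * i + 3)) * f k (2 * i + 1) =
      (if Even k then cst lam ((2 * i + k + 1) * (2 * i + k + 3))
        else cst lam ((2 * i + k) * (2 * i + k + 2))) * f k (2 * i + 1) := by
  have h0 := hf.tau_action_odd k i
  have hc := two_mul_cst_half lam
  rw [← cst_neg, ← apply_ite (cst lam)] at h0
  set e := cst lam (if Even k then 2 * i + k + 5 / 2 else -(2 * i + k + 1 / 2)) with he
  have he' : (e - cst lam (1 / 2)) ^ 2 - 1 =
      if Even k then cst lam ((2 * i + k + 1) * (2 * i + k + 3))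
        else cst lam ((2 * i + k) * (2 * i + k + 2)) := by
    rw [he, ← cst_sub, ← cst_pow, ← cst_one, ← cst_sub, ← apply_ite (cst lam)]
    congr 1
    split_ifs with hk <;> ring
  have e1 : ∀ g : Poly lam, twist lam 1 (twist lam 1 g) = shiftHom lam 2 g := fun g => by
    rw [twist_twist]; norm_num
  have e2 : ∀ g : Poly lam, twist lam (-1) (twist lam (-1) g) = shiftHom lam (-2) g := fun g => by
    rw [twist_twist]; norm_num
  have e3 : ∀ g : Poly lam, twist lam 1 (twist lam (-1) g) = g :=
    twist_twist_of_add_eq_zero (by norm_num)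
  have e4 : ∀ g : Poly lam, twist lam (-1) (twist lam 1 g) = g :=
    twist_twist_of_add_eq_zero (by norm_num)
  rw [Del_Nab, Nab_eq, cst_add lam _ (5 / 2), cst_mul (lam := lam), cst_ofNat, cst_five_halves,
    cst_add lam i] at h0
  have hp := congrArg (twist lam 1) h0
  have hm := congrArg (twist lam (-1)) h0
  simp only [map_add, map_mul, map_sub, map_ofNat, twist_pH, twist_pTau, twist_cst, e1, e2, e3, e4,
    cst_one, cst_neg, he, ← sub_eq_add_neg, sub_neg_eq_add] at hp hm
  rw [← he', Del2_Nab2, Nab2_eq]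
  have := casimir_odd_aux (H := pH lam) (t := pTau lam) (I := cst lam i) (e := e)
    (f := f k (2 * i + 1)) hc h0 hp hm
  rw [← this]
  simp only [cst_add, cst_mul, cst_ofNat, cst_one]

/-! ### Degrees -/

/-- The coefficient of the monomial of degree `m`, that is, of `H^n` for `m = 2n` and of `H^n τ`
for `m = 2n + 1`. -/
noncomputable def coord (lam : ℂ) (m : ℕ) : Poly lam →ₗ[ℂ] ℂ where
  toFun f := if Even m then (f.coeff (m / 2)).re else (f.coeff (m / 2)).im
  map_add' f g := by split_ifs <;> simp
  map_smul' c f := by split_ifs <;> simp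

theorem coord_even (lam : ℂ) (n : ℕ) (f : Poly lam) : coord lam (2 * n) f = (f.coeff n).re := by
  simp [coord]

theorem coord_odd (lam : ℂ) (n : ℕ) (f : Poly lam) :
    coord lam (2 * n + 1) f = (f.coeff n).im := by
  simp [coord, half_odd]

theorem wdeg_lt_iff {lam : ℂ} (f : Poly lam) (k : ℕ) :
    wdeg f < k ↔ ∀ m, k ≤ m → coord lam m f = 0 := by
  refine (Finset.sup_lt_iff (WithBot.bot_lt_coe k)).trans ?_
  simp only [sup_lt_iff]
  constructor
  · intro h m hm
    by_contra hne
    rcases Nat.even_or_odd' m with ⟨n, rfl | rfl⟩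
    · rw [coord_even] at hne
      have hn : n ∈ f.support := by
        rw [Polynomial.mem_support_iff]
        rintro h0
        simp [h0] at hne
      have := (h n hn).1
      rw [if_neg hne] at this
      have : 2 * n < k := WithBot.coe_lt_coe.1 this
      omega
    · rw [coord_odd] at hne
      have hn : n ∈ f.support := by
        rw [Polynomial.mem_support_iff]
        rintro h0
        simp [h0] at hne
      have := (h n hn).2
      rw [if_neg hne] at this
      have : 2 * n + 1 < k := WithBot.coe_lt_coe.1 this
      omega
  · intro h n _
    constructor
    · split_ifs with h0
      · exact WithBot.bot_lt_coe k
      · rw [← coord_even] at h0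
        have : 2 * n < k := not_le.1 fun hk => h0 (h _ hk)
        exact WithBot.coe_lt_coe.2 this
    · split_ifs with h0
      · exact WithBot.bot_lt_coe k
      · rw [← coord_odd] at h0
        have : 2 * n + 1 < k := not_le.1 fun hk => h0 (h _ hk)
        exact WithBot.coe_lt_coe.2 this

theorem wdeg_eq_iff {lam : ℂ} (f : Poly lam) (k : ℕ) :
    wdeg f = k ↔ coord lam k f ≠ 0 ∧ ∀ m, k < m → coord lam m f = 0 := by
  have h1 : wdeg f ≤ k ↔ ∀ m, k < m → coord lam m f = 0 := by
    rw [show (∀ m, k < m → coord lam m f = 0) ↔ ∀ m, k + 1 ≤ m → coord lam m f = 0 from Iff.rfl,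
      ← wdeg_lt_iff]
    cases h : wdeg f with
    | bot => simp
    | coe a =>
      have e1 : ((a : WithBot ℕ) ≤ (k : WithBot ℕ)) ↔ a ≤ k := WithBot.coe_le_coe
      have e2 : ((a : WithBot ℕ) < ((k + 1 : ℕ) : WithBot ℕ)) ↔ a < k + 1 := WithBot.coe_lt_coe
      exact e1.trans (Nat.lt_succ_iff.symm.trans e2.symm)
  rw [eq_iff_le_not_lt, h1, wdeg_lt_iff]
  constructor
  · rintro ⟨ha, hb⟩
    refine ⟨fun h0 => hb fun m hm => ?_, ha⟩
    rcases hm.eq_or_lt with rfl | hlt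
    exacts [h0, ha m hlt]
  · rintro ⟨ha, hb⟩
    exact ⟨hb, fun h => ha (h k le_rfl)⟩

theorem coord_ext {lam : ℂ} {f : Poly lam} (h : ∀ m, coord lam m f = 0) : f = 0 := by
  ext n
  · simpa [coord_even] using h (2 * n)
  · simpa [coord_odd] using h (2 * n + 1)

/-- There is exactly one monomial of each degree, so the largest index with a nonzero coefficient
cannot cancel. -/
theorem linearIndependent_of_wdeg {lam : ℂ} {f : ℕ → Poly lam} (hf : ∀ k : ℕ, wdeg (f k) = k) :
    LinearIndependent ℂ f := by
  rw [linearIndependent_iff']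
  intro s g hg
  by_contra! hne
  obtain ⟨i, hi, hgi⟩ := hne
  obtain ⟨m, hm, hmax⟩ := (s.filter fun i => g i ≠ 0).exists_max_image id
    ⟨i, Finset.mem_filter.2 ⟨hi, hgi⟩⟩
  rw [Finset.mem_filter] at hm
  have h := congrArg (coord lam m) hg
  rw [map_sum, map_zero, Finset.sum_eq_single m] at h
  · rw [map_smul, smul_eq_mul] at h
    exact (mul_ne_zero hm.2 ((wdeg_eq_iff _ _).1 (hf m)).1) h
  · intro j hj hjm
    rw [map_smul]
    by_cases hgj : g j = 0
    · rw [hgj, zero_smul]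
    · have hle : j ≤ m := hmax j (Finset.mem_filter.2 ⟨hj, hgj⟩)
      rw [((wdeg_eq_iff _ _).1 (hf j)).2 m (lt_of_le_of_ne hle hjm), smul_zero]
  · exact fun h => absurd hm.1 h

theorem exists_wdeg_lt {lam : ℂ} (f : Poly lam) : ∃ k : ℕ, wdeg f < k := by
  refine ⟨2 * (f.natDegree + 1), (wdeg_lt_iff _ _).2 fun m hm => ?_⟩
  rcases Nat.even_or_odd' m with ⟨n, rfl | rfl⟩
  · rw [coord_even, Polynomial.coeff_eq_zero_of_natDegree_lt (by omega)]; rfl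
  · rw [coord_odd, Polynomial.coeff_eq_zero_of_natDegree_lt (by omega)]; rfl

theorem span_eq_top_of_wdeg {lam : ℂ} {f : ℕ → Poly lam} (hf : ∀ k : ℕ, wdeg (f k) = k) :
    Submodule.span ℂ (Set.range f) = ⊤ := by
  have key : ∀ (k : ℕ) (g : Poly lam), wdeg g < k → g ∈ Submodule.span ℂ (Set.range f) := by
    intro k
    induction k with
    | zero =>
      intro g hg
      rw [wdeg_lt_iff] at hg
      rw [coord_ext fun m => hg m m.zero_le]
      exact Submodule.zero_mem _
    | succ k ih =>
      intro g hg
      obtain ⟨h1, h2⟩ := (wdeg_eq_iff _ _).1 (hf k)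
      rw [← sub_add_cancel g ((coord lam k g / coord lam k (f k)) • f k)]
      refine Submodule.add_mem _ (ih _ ?_)
        (Submodule.smul_mem _ _ (Submodule.subset_span ⟨k, rfl⟩))
      rw [wdeg_lt_iff] at hg ⊢
      intro m hm
      rw [map_sub, map_smul, smul_eq_mul]
      rcases hm.eq_or_lt with rfl | hlt
      · rw [div_mul_cancel₀ _ h1, sub_self]
      · rw [hg m hlt, h2 m hlt, mul_zero, sub_zero]
  rw [eq_top_iff]
  rintro g -
  obtain ⟨k, hk⟩ := exists_wdeg_lt g
  exact key k g hk

theorem coeff_comp_neg_X {R : Type*} [CommRing R] (p : Polynomial R) (n : ℕ) :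
    (p.comp (-Polynomial.X)).coeff n = p.coeff n ∨
      (p.comp (-Polynomial.X)).coeff n = -p.coeff n := by
  have h : p.comp (-Polynomial.X) = p.comp (Polynomial.C (-1) * Polynomial.X) := by
    rw [Polynomial.C_neg, Polynomial.C_1, neg_one_mul]
  rw [h, Polynomial.comp_C_mul_X_coeff]
  rcases Nat.even_or_odd n with hn | hn <;> simp [hn.neg_one_pow]

theorem coord_reflect_eq_zero_iff {lam : ℂ} (f : Poly lam) (m : ℕ) :
    coord lam m (reflect f) = 0 ↔ coord lam m f = 0 := by
  rcases Nat.even_or_odd' m with ⟨n, rfl | rfl⟩ <;> simp only [coord_even, coord_odd] <;>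
  rcases coeff_comp_neg_X f n with h | h
  · exact iff_of_eq (congrArg (fun z : TauRing lam => z.re = 0) h)
  · exact (iff_of_eq (congrArg (fun z : TauRing lam => z.re = 0) h)).trans neg_eq_zero
  · exact iff_of_eq (congrArg (fun z : TauRing lam => z.im = 0) h)
  · exact (iff_of_eq (congrArg (fun z : TauRing lam => z.im = 0) h)).trans neg_eq_zero

theorem wdeg_reflect_lt_iff {lam : ℂ} (f : Poly lam) (k : ℕ) :
    wdeg (reflect f) < k ↔ wdeg f < k := by
  simp only [wdeg_lt_iff, coord_reflect_eq_zero_iff]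

theorem wdeg_reflect_eq_iff {lam : ℂ} (f : Poly lam) (k : ℕ) :
    wdeg (reflect f) = k ↔ wdeg f = k := by
  simp only [wdeg_eq_iff, coord_reflect_eq_zero_iff, ne_eq]

/-- A polynomial whose leading coefficient, as a polynomial in `H`, is a nonzero scalar. -/
structure HasLeading {lam : ℂ} (f : Poly lam) (n : ℕ) : Prop where
  natDegree_le : f.natDegree ≤ n
  im_eq : (f.coeff n).im = 0
  re_ne : (f.coeff n).re ≠ 0

theorem HasLeading.wdeg_eq {lam : ℂ} {f : Poly lam} {n : ℕ} (hf : HasLeading f n) :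
    wdeg f = ((2 * n : ℕ) : WithBot ℕ) := by
  refine (wdeg_eq_iff _ _).2 ⟨by rw [coord_even]; exact hf.re_ne, fun m hm => ?_⟩
  have h := hf.natDegree_le
  rcases Nat.even_or_odd' m with ⟨l, rfl | rfl⟩
  · rw [coord_even, Polynomial.coeff_eq_zero_of_natDegree_lt (by omega)]; rfl
  · rw [coord_odd]
    rcases (show n ≤ l by omega).eq_or_lt with rfl | hlt
    · exact hf.im_eq
    · rw [Polynomial.coeff_eq_zero_of_natDegree_lt (by omega)]; rfl

/-- Because the coefficient of `H^n` is a scalar, multiplication by `a τ + b` makes `H^n τ` the top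
monomial; a leading coefficient involving `τ` could lose it through `τ² ∈ ℂ`. -/
theorem HasLeading.wdeg_mul_eq {lam : ℂ} {f : Poly lam} {n : ℕ} (hf : HasLeading f n) {a : ℂ}
    (ha : a ≠ 0) (b : ℂ) : wdeg ((cst lam a * pTau lam + cst lam b) * f) =
      ((2 * n + 1 : ℕ) : WithBot ℕ) := by
  have hC : cst lam a * pTau lam + cst lam b = Polynomial.C ⟨b, a⟩ := by
    rw [C_eq]; ring
  rw [hC]
  have h := hf.natDegree_le
  refine (wdeg_eq_iff _ _).2 ⟨?_, fun m hm => ?_⟩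
  · rw [coord_odd, Polynomial.coeff_C_mul]
    simp [hf.im_eq, ha, hf.re_ne]
  · rcases Nat.even_or_odd' m with ⟨l, rfl | rfl⟩
    · rw [coord_even, Polynomial.coeff_C_mul, Polynomial.coeff_eq_zero_of_natDegree_lt (by omega),
        mul_zero]; rfl
    · rw [coord_odd, Polynomial.coeff_C_mul, Polynomial.coeff_eq_zero_of_natDegree_lt (by omega),
        mul_zero]; rfl

theorem HasLeading.cst_mul {lam : ℂ} {f : Poly lam} {n : ℕ} (hf : HasLeading f n) {a : ℂ}
    (ha : a ≠ 0) : HasLeading (cst lam a * f) n where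
  natDegree_le := by
    rw [cst_eq_C]
    exact (Polynomial.natDegree_C_mul_le _ _).trans hf.natDegree_le
  im_eq := by rw [cst_eq_C, Polynomial.coeff_C_mul]; simp [hf.im_eq]
  re_ne := by rw [cst_eq_C, Polynomial.coeff_C_mul]; simp [hf.re_ne, ha]

theorem HasLeading.mul {lam : ℂ} {f g : Poly lam} {m n : ℕ} (hf : HasLeading f m)
    (hg : HasLeading g n) : HasLeading (f * g) (m + n) where
  natDegree_le := Polynomial.natDegree_mul_le_of_le hf.natDegree_le hg.natDegree_le
  im_eq := by
    rw [Polynomial.coeff_mul_add_eq_of_natDegree_le hf.natDegree_le hg.natDegree_le]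
    simp [hf.im_eq, hg.im_eq]
  re_ne := by
    rw [Polynomial.coeff_mul_add_eq_of_natDegree_le hf.natDegree_le hg.natDegree_le]
    simp [hf.im_eq, hg.im_eq, hf.re_ne, hg.re_ne]

theorem HasLeading.add_of_lt {lam : ℂ} {f g : Poly lam} {n : ℕ} (hf : HasLeading f n)
    (hg : g.degree < n) : HasLeading (g + f) n where
  natDegree_le := Polynomial.natDegree_add_le_of_degree_le
    (Polynomial.natDegree_le_of_degree_le hg.le) hf.natDegree_le
  im_eq := by rw [Polynomial.coeff_add, Polynomial.coeff_eq_zero_of_degree_lt hg, zero_add,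
    hf.im_eq]
  re_ne := by rw [Polynomial.coeff_add, Polynomial.coeff_eq_zero_of_degree_lt hg,
      zero_add]; exact hf.re_ne

theorem hasLeading_cst {lam a : ℂ} (ha : a ≠ 0) : HasLeading (cst lam a) 0 where
  natDegree_le := by rw [cst_eq_C, Polynomial.natDegree_C]
  im_eq := by rw [cst_eq_C]; simp
  re_ne := by rw [cst_eq_C]; simpa using ha

theorem hasLeading_poch {lam : ℂ} (z : TauRing lam) (n : ℕ) :
    HasLeading (poch (cst lam (1 / 2) * (Polynomial.C z - pH lam)) n) n := by
  induction n with
  | zero => rw [poch_zero, ← cst_one]; exact hasLeading_cst one_ne_zero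
  | succ n ih =>
    rw [poch_succ]
    refine ih.mul ?_
    have h : cst lam (1 / 2) * (Polynomial.C z - pH lam) + (n : Poly lam) =
        Polynomial.C (⟨-1 / 2, 0⟩ : TauRing lam) * Polynomial.X +
          Polynomial.C (⟨1 / 2, 0⟩ * z + (n : TauRing lam)) := by
      rw [cst_eq_C, pH, Polynomial.C_add, Polynomial.C_mul, map_natCast]
      rw [show (⟨-1 / 2, 0⟩ : TauRing lam) = -⟨1 / 2, 0⟩ by ext <;> simp [neg_div],
        Polynomial.C_neg]
      ring
    rw [h]
    refine ⟨Polynomial.natDegree_linear_le, ?_, ?_⟩ <;> simp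

/-! ### Degrees of the Hahn polynomials -/

theorem map_poch {A B : Type*} [CommRing A] [CommRing B] (φ : A →+* B) (a : A) (n : ℕ) :
    φ (poch a n) = poch (φ a) n := by
  simp only [poch, map_prod, map_add, map_natCast]

theorem poch_ne_zero {K : Type*} [Field K] {a : K} {n : ℕ} (h : ∀ m < n, a + m ≠ 0) :
    poch a n ≠ 0 :=
  Finset.prod_ne_zero_iff.2 fun m hm => h m (Finset.mem_range.1 hm)

/-- The variable `H` enters only through `(c)_n`, of degree `n` in `H`. In the top term `n = k` the
Pochhammer symbols containing `d` and `e` are empty, so its coefficient is a scalar, nonzero since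
neither `(-k)_k` nor `(b)_k` vanishes. -/
theorem hasLeading_hyp32Cleared {lam : ℂ} (k : ℕ) {b : ℂ} (hb : ∀ m < k, b + m ≠ 0)
    (z d e : TauRing lam) :
    HasLeading (hyp32Cleared k (cst lam b) (cst lam (1 / 2) * (Polynomial.C z - pH lam))
      (Polynomial.C d) (Polynomial.C e)) k := by
  set c := cst lam (1 / 2) * (Polynomial.C z - pH lam) with hc
  rw [hyp32Cleared, Finset.sum_range_succ]
  refine HasLeading.add_of_lt ?_ ?_
  · have h : (k.factorial : ℂ)⁻¹ • (poch (-(k : Poly lam)) k * poch (cst lam b) k * poch c k *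
        poch (Polynomial.C d + (k : Poly lam)) (k - k) *
        poch (Polynomial.C e + (k : Poly lam)) (k - k)) =
        cst lam ((k.factorial : ℂ)⁻¹ * (poch (-(k : ℂ)) k * poch b k)) * poch c k := by
      have h1 : poch (-(k : Poly lam)) k = cst lam (poch (-(k : ℂ)) k) := by
        rw [cst, map_poch, map_neg, map_natCast]
      have h2 : poch (cst lam b) k = cst lam (poch b k) := by rw [cst, cst, map_poch]
      rw [Nat.sub_self, poch_zero, poch_zero, mul_one, mul_one, smul_eq_cst_mul, h1, h2, cst_mul,
        cst_mul]
      ring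
    rw [h]
    refine (hasLeading_poch z k).cst_mul ?_
    refine mul_ne_zero (inv_ne_zero (Nat.cast_ne_zero.2 k.factorial_ne_zero))
      (mul_ne_zero (poch_ne_zero fun m hm => ?_) (poch_ne_zero hb))
    rw [neg_add_eq_sub, sub_ne_zero]
    exact_mod_cast hm.ne
  · rw [← Polynomial.mem_degreeLT]
    refine Submodule.sum_mem _ fun n hn => ?_
    have hn := Finset.mem_range.1 hn
    rw [Polynomial.mem_degreeLT]
    have h : ∃ w : TauRing lam, (n.factorial : ℂ)⁻¹ • (poch (-(k : Poly lam)) n *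
        poch (cst lam b) n * poch c n * poch (Polynomial.C d + (n : Poly lam)) (k - n) *
        poch (Polynomial.C e + (n : Poly lam)) (k - n)) = Polynomial.C w * poch c n := by
      refine ⟨⟨(n.factorial : ℂ)⁻¹, 0⟩ * (poch (-(k : TauRing lam)) n * poch ⟨b, 0⟩ n *
        poch (d + n) (k - n) * poch (e + n) (k - n)), ?_⟩
      rw [smul_eq_cst_mul, cst_eq_C, cst_eq_C]
      simp only [Polynomial.C_mul, map_poch, map_neg, map_add, map_natCast]
      ring
    obtain ⟨w, hw⟩ := h
    rw [hw]
    refine lt_of_le_of_lt (Polynomial.degree_le_natDegree.trans (WithBot.coe_le_coe.2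
      ((Polynomial.natDegree_C_mul_le _ _).trans (hasLeading_poch z n).natDegree_le))) ?_
    exact WithBot.coe_lt_coe.2 hn

theorem cst_sub_pTau (lam a : ℂ) : cst lam a - pTau lam = Polynomial.C ⟨a, -1⟩ := by
  rw [C_eq, cst_neg, cst_one]; ring

theorem hasLeading_evenHahn (lam : ℂ) (k i : ℕ) : HasLeading (evenHahn lam k i) k := by
  rw [evenHahn, cst_sub_pTau, cst_sub_pTau, cst_eq_C lam (i + 1)]
  refine hasLeading_hyp32Cleared k (fun m _ => ?_) _ _ _
  exact_mod_cast (show k + 2 * i + 1 + m ≠ 0 by omega)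

theorem hasLeading_oddHahn (lam : ℂ) (k i : ℕ) : HasLeading (oddHahn lam k i) k := by
  rw [oddHahn, cst_sub_pTau, cst_sub_pTau, cst_eq_C lam (i + 2)]
  refine hasLeading_hyp32Cleared k (fun m _ => ?_) _ _ _
  exact_mod_cast (show k + 2 * i + 2 + m ≠ 0 by omega)

theorem wdeg_hahnFamily (lam : ℂ) (k j : ℕ) : wdeg (hahnFamily lam k j) = k := by
  rcases Nat.even_or_odd' j with ⟨i, rfl | rfl⟩ <;> rcases Nat.even_or_odd' k with ⟨k, rfl | rfl⟩
  · rw [hahnFamily_even_even]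
    exact (hasLeading_evenHahn lam k i).wdeg_eq
  · have h : cst lam (1 / 2) * (cst lam (2 * k + 2 * i + 1) * pTau lam -
        cst lam (2 * (lam + 1 / 2) ^ 2)) = cst lam (1 / 2 * (2 * k + 2 * i + 1)) * pTau lam +
          cst lam (-(1 / 2 * (2 * (lam + 1 / 2) ^ 2))) := by
      rw [cst_neg, cst_mul lam (1 / 2), cst_mul lam (1 / 2)]; ring
    rw [hahnFamily_odd_even, h]
    refine (hasLeading_evenHahn lam k i).wdeg_mul_eq (mul_ne_zero (by norm_num) ?_) _
    exact_mod_cast (show 2 * k + 2 * i + 1 ≠ 0 by omega)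
  · rw [hahnFamily_even_odd]
    refine ((hasLeading_oddHahn lam k i).cst_mul ?_).wdeg_eq
    exact_mod_cast (show i + k + 1 ≠ 0 by omega)
  · have h : -pTau lam = cst lam (-1) * pTau lam + cst lam 0 := by
      rw [cst_neg, cst_one, cst_zero]; ring
    rw [hahnFamily_odd_odd, h]
    exact (hasLeading_oddHahn lam k i).wdeg_mul_eq (by norm_num) _

/-! ### The operator `∇₂` lowers the degree by two -/

theorem eq_cst_of_wdeg_lt_one {lam : ℂ} {f : Poly lam} (hf : wdeg f < (1 : ℕ)) :
    ∃ c, f = cst lam c := by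
  rw [wdeg_lt_iff] at hf
  refine ⟨(f.coeff 0).re, ?_⟩
  rw [cst_eq_C]
  ext n
  · rcases n with _ | n
    · simp
    · rw [← coord_even, hf _ (by omega), Polynomial.coeff_C_succ]; rfl
  · rcases n with _ | n
    · rw [← coord_odd, hf _ (by omega)]; simp
    · rw [← coord_odd, hf _ (by omega), Polynomial.coeff_C_succ]; rfl

theorem eq_zero_of_wdeg_lt_zero {lam : ℂ} {f : Poly lam} (hf : wdeg f < (0 : ℕ)) : f = 0 := by
  rw [wdeg_lt_iff] at hf
  exact coord_ext fun m => hf m m.zero_le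

theorem coord_pH_mul (lam : ℂ) (f : Poly lam) (m : ℕ) :
    coord lam (m + 2) (pH lam * f) = coord lam m f := by
  rcases Nat.even_or_odd' m with ⟨n, rfl | rfl⟩
  · rw [show 2 * n + 2 = 2 * (n + 1) by ring, coord_even, coord_even, pH, Polynomial.coeff_X_mul]
  · rw [show 2 * n + 1 + 2 = 2 * (n + 1) + 1 by ring, coord_odd, coord_odd, pH,
      Polynomial.coeff_X_mul]

theorem wdeg_pH_mul_lt {lam : ℂ} {f : Poly lam} {k : ℕ} (hf : wdeg f < (k - 2 : ℕ)) :
    wdeg (pH lam * f) < k := by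
  rw [wdeg_lt_iff] at hf ⊢
  intro m hm
  rcases m with _ | _ | m
  · have h := coord_even lam 0 (pH lam * f)
    rw [pH, Polynomial.coeff_X_mul_zero] at h
    exact h
  · have h := coord_odd lam 0 (pH lam * f)
    rw [pH, Polynomial.coeff_X_mul_zero] at h
    exact h
  · rw [coord_pH_mul]
    exact hf m (by omega)

/-- Writing `f = H g + c` with `c` in `ℂ[τ]`, one has `∇₂ f = H ∇₂ g + 2 g - 2 ∇₂ g`, and `g` has
degree lower by two. For `k < 2` the polynomial is a scalar and `∇₂ f = 0`, in accordance with the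
truncated `k - 2 = 0`. -/
theorem wdeg_Nab2_lt {lam : ℂ} {f : Poly lam} {k : ℕ} (hf : wdeg f < k) :
    wdeg (Nab2 f) < (k - 2 : ℕ) := by
  induction k using Nat.strong_induction_on generalizing f with
  | _ k ih =>
    rcases lt_or_ge k 2 with hk | hk
    · have hf1 : wdeg f < (1 : ℕ) := lt_of_lt_of_le hf (WithBot.coe_le_coe.2 (show k ≤ 1 by omega))
      obtain ⟨c, rfl⟩ := eq_cst_of_wdeg_lt_one hf1
      rw [Nab2_eq, shiftHom_cst, sub_self, wdeg_lt_iff]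
      exact fun m _ => map_zero _
    · obtain ⟨k, rfl⟩ := Nat.exists_eq_add_of_le' hk
      rw [Nat.add_sub_cancel]
      have hg : f = pH lam * f.divX + Polynomial.C (f.coeff 0) := (Polynomial.X_mul_divX_add f).symm
      have hdeg : wdeg f.divX < k := by
        rw [wdeg_lt_iff] at hf ⊢
        intro m hm
        refine Eq.trans ?_ (hf (m + 2) (by omega))
        rcases Nat.even_or_odd' m with ⟨n, rfl | rfl⟩
        · rw [show 2 * n + 2 = 2 * (n + 1) by ring, coord_even, coord_even, Polynomial.coeff_divX]
        · rw [show 2 * n + 1 + 2 = 2 * (n + 1) + 1 by ring, coord_odd, coord_odd,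
            Polynomial.coeff_divX]
      have h1 := ih k (by omega) hdeg
      have hN : Nab2 f = pH lam * Nab2 f.divX + ((2 : ℂ) • f.divX - (2 : ℂ) • Nab2 f.divX) := by
        conv_lhs => rw [hg]
        simp only [Nab2_eq, smul_eq_cst_mul, map_add, map_mul, shiftHom_pH, C_eq, shiftHom_cst,
          shiftHom_pTau, cst_neg]
        ring
      have h2 := wdeg_pH_mul_lt h1
      rw [wdeg_lt_iff] at h1 h2 hdeg ⊢
      intro m hm
      rw [hN, map_add, map_sub, map_smul, map_smul, h2 m hm, hdeg m hm, h1 m (by omega)]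
      simp

theorem wdeg_Nab2_iterate_lt {lam : ℂ} {f : Poly lam} {n k : ℕ} (hf : wdeg f < (2 * n + k : ℕ)) :
    wdeg (Nab2^[n] f) < k := by
  induction n generalizing f with
  | zero => simpa using hf
  | succ n ih =>
    rw [Function.iterate_succ_apply]
    refine ih ?_
    have h := wdeg_Nab2_lt hf
    rwa [show 2 * (n + 1) + k - 2 = 2 * n + k by omega] at h

/-! ### `(ad F)²` on `F^j f` as the operator `∇₂` -/

/-- `F²` commutes with `F^j`, so the commutator only sees `f F² = F² f(H - 2, τ)`. -/
theorem adF_adF_F_pow_mul_ev (lam : ℂ) (j : ℕ) (f : Poly lam) :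
    adF lam (adF lam (gen lam .F ^ j * evHom lam f)) =
      gen lam .F ^ (j + 2) * evHom lam (Nab2 f) := by
  have h : evHom lam f * (gen lam .F * gen lam .F) =
      gen lam .F * gen lam .F * evHom lam (shiftHom lam (-2) f) := by
    rw [F_sq_mul_ev, shiftHom_shiftHom, add_neg_cancel, shiftHom_zero]
  rw [adF_adF, mul_assoc (gen lam .F ^ j), h, Nab2_eq, map_sub, mul_sub, pow_add (gen lam .F) j 2,
    pow_two (gen lam .F), ← mul_assoc, ← mul_assoc (gen lam .F ^ j)]
  congr 2
  rw [← pow_two (gen lam .F), ← pow_add (gen lam .F), ← pow_add (gen lam .F), add_comm]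

theorem adF_iterate_F_pow_mul_ev (lam : ℂ) (j n : ℕ) (f : Poly lam) :
    (adF lam)^[2 * n] (gen lam .F ^ j * evHom lam f) =
      gen lam .F ^ (j + 2 * n) * evHom lam (Nab2^[n] f) := by
  induction n with
  | zero => rfl
  | succ n ih =>
    rw [mul_add, mul_one, Function.iterate_succ_apply', Function.iterate_succ_apply', ih,
      adF_adF_F_pow_mul_ev, Function.iterate_succ_apply', add_assoc]

/-! ### Supertraces -/

theorem IsSupertrace.comm {lam : ℂ} {L : B lam →ₗ[ℂ] ℂ} (hL : IsSupertrace L) {p q : ℕ}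
    {u v : B lam} (hu : IsHomog p u) (hv : IsHomog q v) :
    L (u * v) = (-1) ^ (p * q) * L (v * u) := by
  have h := hL p q u v hu hv
  rwa [map_sub, map_smul, smul_eq_mul, sub_eq_zero] at h

/-- `L` vanishes on `[F, u v]`, and `ad F` is a superderivation. -/
theorem IsSupertrace.adF {lam : ℂ} {L : B lam →ₗ[ℂ] ℂ} (hL : IsSupertrace L) {p q : ℕ}
    {u v : B lam} (hu : IsHomog p u) (hv : IsHomog q v) :
    L (Osp12.adF lam u * v) = -(-1) ^ p * L (u * Osp12.adF lam v) := by
  have h := hL.comm (isHomog_F lam) (hu.mul hv)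
  have hp : ((-1 : ℂ) ^ p) ^ 2 = 1 := by rw [← pow_mul, mul_comm, pow_mul]; norm_num
  rw [adF_homog hu, adF_homog hv, sub_mul, mul_sub, mul_assoc, map_sub, map_sub, h,
    smul_mul_assoc, mul_smul_comm, map_smul, map_smul, one_mul, pow_add, mul_assoc u v,
    mul_assoc u]
  simp only [smul_eq_mul]
  ring

theorem IsSupertrace.adG {lam : ℂ} {L : B lam →ₗ[ℂ] ℂ} (hL : IsSupertrace L) {p q : ℕ}
    {u v : B lam} (hu : IsHomog p u) (hv : IsHomog q v) :
    L (Osp12.adG lam u * v) = -(-1) ^ p * L (u * Osp12.adG lam v) := by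
  have h := hL.comm (isHomog_G lam) (hu.mul hv)
  rw [adG_homog hu, adG_homog hv, sub_mul, mul_sub, mul_assoc, map_sub, map_sub, h,
    smul_mul_assoc, mul_smul_comm, map_smul, map_smul, one_mul, pow_add, mul_assoc u v,
    mul_assoc u]
  simp only [smul_eq_mul]
  ring

/-- Only vanishing is transferred, so the accumulated sign need not be computed. -/
theorem IsSupertrace.adF_iterate {lam : ℂ} {L : B lam →ₗ[ℂ] ℂ} (hL : IsSupertrace L) {p q : ℕ}
    {u v : B lam} (hu : IsHomog p u) (hv : IsHomog q v) (m : ℕ)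
    (h : L (u * (Osp12.adF lam)^[m] v) = 0) : L ((Osp12.adF lam)^[m] u * v) = 0 := by
  induction m generalizing q v with
  | zero => exact h
  | succ m ih =>
    rw [Function.iterate_succ_apply] at h
    rw [Function.iterate_succ_apply', hL.adF (hu.adF_iterate m) hv, ih hv.adF h, mul_zero]

/-- `0 = L([H, u]) = m L(u)`. -/
theorem IsSupertrace.eq_zero_of_weight {lam : ℂ} {L : B lam →ₗ[ℂ] ℂ} (hL : IsSupertrace L)
    {m : ℤ} (hm : m ≠ 0) {u : B lam} (hu : u ∈ weightSpace lam m) : L u = 0 := by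
  have h : L (gen lam .H * u - u * gen lam .H) = 0 := by
    obtain ⟨v, w, hv, hw, rfl⟩ := exists_homog_decomp u
    rw [mul_add, add_mul, map_sub, map_add, map_add, hL.comm (isHomog_H lam) hv,
      hL.comm (isHomog_H lam) hw]
    simp
  rw [show gen lam .H * u - u * gen lam .H = (m : ℂ) • u from hu, map_smul, smul_eq_mul] at h
  exact (mul_eq_zero.1 h).resolve_left (Int.cast_ne_zero.2 hm)

/-! ### Orthogonality of the `f_{k,j}` to lower degrees -/

theorem adG_F_pow_even (lam : ℂ) (n : ℕ) :
    adG lam (gen lam .F ^ (2 * n)) = (-n : ℂ) • (gen lam .F ^ (2 * n - 1)) := by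
  have h2 : gen lam .G * gen lam .F ^ 2 = gen lam .F ^ 2 * gen lam .G - gen lam .F := by
    have h := H_mul_F lam
    rw [pow_two (gen lam .F), ← mul_assoc, eq_sub_of_add_eq (G_mul_F lam), sub_mul, h, mul_assoc,
      eq_sub_of_add_eq (G_mul_F lam), mul_sub, mul_assoc]
    abel
  have h : ∀ n : ℕ, gen lam .G * gen lam .F ^ (2 * n) = gen lam .F ^ (2 * n) * gen lam .G -
      (n : ℂ) • gen lam .F ^ (2 * n - 1) := by
    intro n
    induction n with
    | zero => simp
    | succ n ih =>
      have e1 : gen lam .F ^ (2 * n - 1) * gen lam .F ^ 2 =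
          gen lam .F ^ (2 * n + 1) ∨ n = 0 := by
        rcases n with _ | n
        · exact Or.inr rfl
        · left; rw [← pow_add (gen lam .F)]; congr 1
      rw [mul_add, mul_one, pow_add (gen lam .F), ← mul_assoc, ih, sub_mul, mul_assoc, h2, mul_sub,
        ← pow_succ (gen lam .F), smul_mul_assoc, ← mul_assoc, sub_sub]
      congr 1
      rcases e1 with e1 | rfl
      · rw [e1, show 2 * n + 2 - 1 = 2 * n + 1 by omega]; push_cast; module
      · simp
  have hh : IsHomog (2 * n) (gen lam .F ^ (2 * n)) := (isHomog_F lam).pow _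
  rw [adG_homog hh, h, (even_two_mul n).neg_one_pow]
  module

/-- `F^{2n+1}` is a nonzero multiple of `[G, F^{2n+2}]`, and invariance moves `ad G` to `G^{2n+1}
τ`, which it kills. This covers the case of odd `k` and odd `j`, where one fewer power of `ad F` is
available. -/
theorem IsSupertrace.G_pow_tau_F_pow {lam : ℂ} {L : B lam →ₗ[ℂ] ℂ} (hL : IsSupertrace L)
    (n : ℕ) : L (gen lam .G ^ (2 * n + 1) * tau lam * gen lam .F ^ (2 * n + 1)) = 0 := by
  have h := hL.adG (((isHomog_G lam).pow (2 * n + 1)).mul (isHomog_tau lam))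
    ((isHomog_F lam).pow (2 * (n + 1)))
  rw [adG_G_pow_mul_tau lam ⟨n, rfl⟩, zero_mul, map_zero, adG_F_pow_even, mul_smul_comm, map_smul,
    show 2 * (n + 1) - 1 = 2 * n + 1 by omega] at h
  have hn : ((n + 1 : ℕ) : ℂ) ≠ 0 := Nat.cast_ne_zero.2 n.succ_ne_zero
  rcases mul_eq_zero.1 h.symm with h | h
  · exact absurd (neg_eq_zero.1 h) (pow_ne_zero _ (by norm_num))
  · exact (mul_eq_zero.1 h).resolve_left (neg_ne_zero.2 hn)

/-- Moving the powers of `ad F` to `F^j g` replaces `g` by an iterated `∇₂ g`. For even `k` this is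
zero. For odd `k` it is a constant, leaving a multiple of a power of `F`: if `j` is even the power
is even and one more `ad F` kills it; if `j` is odd, `IsSupertrace.G_pow_tau_F_pow` applies. -/
theorem IsFamily.orthogonal {lam : ℂ} {f : ℕ → ℕ → Poly lam} (hf : IsFamily lam f)
    {L : B lam →ₗ[ℂ] ℂ} (hL : IsSupertrace L) {k j : ℕ} {g : Poly lam} (hg : wdeg g < k) :
    L (evHom lam (f k j) * gen lam .G ^ j * (gen lam .F ^ j * evHom lam g)) = 0 := by
  have hv := isHomog_F_pow_mul_ev lam g j
  have hG := fun m : ℕ => (isHomog_G lam).pow m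
  have hGt := fun m : ℕ => ((isHomog_G lam).pow m).mul (isHomog_tau lam)
  rw [← ev_eq (f k j)]
  rcases Nat.even_or_odd' j with ⟨i, rfl | rfl⟩ <;> rcases Nat.even_or_odd' k with ⟨k, rfl | rfl⟩
  · rw [hf.even_even _ i (even_two_mul k)]
    refine hL.adF_iterate (hG _) hv _ ?_
    rw [adF_iterate_F_pow_mul_ev, eq_zero_of_wdeg_lt_zero (wdeg_Nab2_iterate_lt (k := 0) hg)]
    simp
  · rw [hf.odd_even (2 * k + 1) i ⟨k, rfl⟩]
    refine hL.adF_iterate (hGt _) hv (2 * k + 1) ?_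
    obtain ⟨c, hc⟩ := eq_cst_of_wdeg_lt_one (wdeg_Nab2_iterate_lt (k := 1) hg)
    have h0 : (adF lam)^[2 * k + 1] (gen lam .F ^ (2 * i) * evHom lam g) = 0 := by
      rw [Function.iterate_succ_apply', adF_iterate_F_pow_mul_ev, hc,
        adF_homog (isHomog_F_pow_mul_ev lam _ _),
        ((even_two_mul i).add (even_two_mul k)).neg_one_pow, one_smul, evHom_cst,
        ← Algebra.commutes, mul_assoc (algebraMap _ _ _), ← pow_succ (gen lam .F), ← mul_assoc,
        ← Algebra.commutes, mul_assoc, ← pow_succ' (gen lam .F), sub_self]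
    refine (congrArg (fun w => L (_ * w)) h0).trans ?_
    rw [mul_zero, map_zero]
  · rw [hf.even_odd _ i (even_two_mul k)]
    refine hL.adF_iterate (hG _) hv _ ?_
    rw [Function.iterate_succ_apply', adF_iterate_F_pow_mul_ev,
      eq_zero_of_wdeg_lt_zero (wdeg_Nab2_iterate_lt (k := 0) hg)]
    simp [adF_zero]
  · rw [hf.odd_odd (2 * k + 1) i ⟨k, rfl⟩]
    refine hL.adF_iterate (hGt _) hv _ ?_
    obtain ⟨c, hc⟩ := eq_cst_of_wdeg_lt_one (wdeg_Nab2_iterate_lt (k := 1) hg)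
    rw [Nat.add_sub_cancel, adF_iterate_F_pow_mul_ev, hc, evHom_cst, ← Algebra.commutes,
      ← Algebra.smul_def, mul_smul_comm, map_smul,
      show 2 * i + (2 * k + 1) = 2 * (i + k) + 1 by ring,
      show 2 * i + 1 + 2 * k = 2 * (i + k) + 1 by ring, hL.G_pow_tau_F_pow, smul_zero]

/-! ### The bilinear forms -/

theorem ordTranspose_ev (lam : ℂ) (f : Poly lam) :
    (ordTranspose lam (evHom lam f)).unop = evHom lam f := by
  induction f using Poly.induction with
  | hc c => rw [evHom_cst, AlgHom.commutes]; rfl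
  | hH => rw [evHom_pH, ordTranspose_gen]; simp [swap, swapCoeff]
  | ht =>
    have h2 : MulOpposite.unop (2 : (B lam)ᵐᵒᵖ) = 2 := rfl
    have hc : (2 : B lam) * (gen lam .F * gen lam .G) = gen lam .F * gen lam .G * 2 :=
      ((Commute.ofNat_left 2 _) : _)
    rw [evHom_pTau]
    conv_lhs => rw [tau_eq]
    rw [tau_eq, hc, map_sub, map_add, map_mul, map_mul, AlgHom.commutes, map_ofNat]
    simp only [MulOpposite.unop_sub, MulOpposite.unop_add, MulOpposite.unop_mul, ordTranspose_gen,
      MulOpposite.algebraMap_apply, MulOpposite.unop_op, h2, ← hc]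
    simp [swap, swapCoeff, smul_smul]
  | hadd f g hf hg => simp only [map_add, MulOpposite.unop_add, hf, hg]
  | hmul f g hf hg => rw [map_mul, map_mul, MulOpposite.unop_mul, hf, hg, ← map_mul, ← map_mul,
      mul_comm]

/-- The scalar depends only on the parity, and its value is irrelevant for orthogonality. -/
theorem exists_transpose_eq {lam : ℂ} (p : ℕ) : ∃ s : ℂ, ∀ u : B lam, IsHomog p u →
    transpose lam u = s • (ordTranspose lam u).unop := by
  rcases Nat.even_or_odd p with hp | hp
  · exact ⟨1, fun u hu => by rw [transpose_even hp hu, one_smul]⟩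
  · exact ⟨Complex.I, fun u hu => transpose_odd hp hu⟩

theorem exists_transpose_ev_mul_G_pow (lam : ℂ) (j : ℕ) : ∃ s : ℂ, ∀ g : Poly lam,
    transpose lam (evHom lam g * gen lam .G ^ j) = s • (gen lam .F ^ j * evHom lam g) := by
  obtain ⟨s, hs⟩ := exists_transpose_eq (lam := lam) j
  refine ⟨s * Complex.I ^ j, fun g => ?_⟩
  rw [hs _ (isHomog_ev_mul_G_pow lam g j), map_mul, map_pow, MulOpposite.unop_mul,
    MulOpposite.unop_pow, ordTranspose_ev, ordTranspose_gen, smul_pow, smul_mul_assoc, smul_smul]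
  rfl

theorem exists_transpose_ev_mul_F_pow (lam : ℂ) (j : ℕ) : ∃ s : ℂ, ∀ g : Poly lam,
    transpose lam (evHom lam g * gen lam .F ^ j) = s • (gen lam .G ^ j * evHom lam g) := by
  obtain ⟨s, hs⟩ := exists_transpose_eq (lam := lam) j
  refine ⟨s * (-Complex.I) ^ j, fun g => ?_⟩
  rw [hs _ (isHomog_ev_mul_F_pow lam g j), map_mul, map_pow, MulOpposite.unop_mul,
    MulOpposite.unop_pow, ordTranspose_ev, ordTranspose_gen, smul_pow, smul_mul_assoc, smul_smul]
  rfl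

/-- The form `L(f G^j F^j g)`, which is proportional to `⟨f, g⟩_j`. -/
noncomputable def pairing {lam : ℂ} (L : B lam →ₗ[ℂ] ℂ) (j : ℕ) (f g : Poly lam) : ℂ :=
  L (evHom lam f * gen lam .G ^ j * (gen lam .F ^ j * evHom lam g))

theorem exists_G_pow_mul_F_pow (lam : ℂ) (j : ℕ) :
    ∃ w, gen lam .G ^ j * gen lam .F ^ j = evHom lam w := by
  induction j with
  | zero => exact ⟨1, by simp⟩
  | succ j ih =>
    obtain ⟨w, hw⟩ := ih
    refine ⟨twist lam (-1) w * polyGF lam, ?_⟩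
    rw [pow_succ' (gen lam .G), pow_succ (gen lam .F), mul_assoc, ← mul_assoc (gen lam .G ^ j), hw,
      ← mul_assoc, G_mul_ev, mul_assoc, G_mul_F_eq, map_mul]

/-- `G^j F^j` is a polynomial in `H` and `τ`, so the argument of `L` is a product in a commutative
ring. -/
theorem pairing_comm {lam : ℂ} (L : B lam →ₗ[ℂ] ℂ) (j : ℕ) (f g : Poly lam) :
    pairing L j f g = pairing L j g f := by
  obtain ⟨w, hw⟩ := exists_G_pow_mul_F_pow lam j
  have h : ∀ f g : Poly lam, evHom lam f * gen lam .G ^ j * (gen lam .F ^ j * evHom lam g) =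
      evHom lam (f * w * g) := by
    intro f g
    rw [mul_assoc, ← mul_assoc (gen lam .G ^ j), hw, ← mul_assoc, map_mul, map_mul]
  rw [pairing, pairing, h, h]
  congr 2
  ring

theorem IsFamily.pairing_eq_zero {lam : ℂ} {f : ℕ → ℕ → Poly lam} (hf : IsFamily lam f)
    {L : B lam →ₗ[ℂ] ℂ} (hL : IsSupertrace L) (j : ℕ) {k l : ℕ} (hkl : k ≠ l) :
    pairing L j (f k j) (f l j) = 0 := by
  have hd : ∀ k, wdeg (f k j) = k := fun k => by rw [hf.eq_hahnFamily, wdeg_hahnFamily]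
  rcases hkl.lt_or_gt with h | h
  · rw [pairing_comm]
    exact hf.orthogonal hL (by rw [hd]; exact WithBot.coe_lt_coe.2 h)
  · exact hf.orthogonal hL (by rw [hd]; exact WithBot.coe_lt_coe.2 h)

theorem formPos_eq {lam : ℂ} (L : B lam →ₗ[ℂ] ℂ) (j : ℕ) :
    ∃ s : ℂ, ∀ f g, formPos L j f g = s * pairing L j f g := by
  obtain ⟨s, hs⟩ := exists_transpose_ev_mul_G_pow lam j
  refine ⟨s, fun f g => ?_⟩
  rw [formPos, form, ev_eq, ev_eq, hs, mul_smul_comm, map_smul, smul_eq_mul, pairing]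

theorem IsFamily.isOrthogonalBasis_formPos {lam : ℂ} {f : ℕ → ℕ → Poly lam} (hf : IsFamily lam f)
    {L : B lam →ₗ[ℂ] ℂ} (hL : IsSupertrace L) (j : ℕ) :
    IsOrthogonalBasis (formPos L j) (fun k => f k j) := by
  have hd : ∀ k, wdeg (f k j) = k := fun k => by rw [hf.eq_hahnFamily, wdeg_hahnFamily]
  obtain ⟨s, hs⟩ := formPos_eq L j
  refine ⟨linearIndependent_of_wdeg hd, span_eq_top_of_wdeg hd, hd, fun k g hg => ?_,
    fun k l hkl => ?_⟩
  · rw [hs, pairing, hf.orthogonal hL hg, mul_zero]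
  · rw [hs, hf.pairing_eq_zero hL j hkl, mul_zero]

/-! ### The automorphism that exchanges `F` and `G` -/

/-- The scalars in the definition of `swapAut`. -/
noncomputable def swapAutCoeff : OspGen → ℂ
  | .X => 1
  | .Y => 1
  | .H => -1
  | .F => Complex.I
  | .G => Complex.I

theorem coeff_swapAut (a b c : OspGen) :
    (coeff (swap a) (swap b) (swap c) : ℂ) * (swapAutCoeff a * swapAutCoeff b) =
      coeff a b c * swapAutCoeff c := by
  cases a <;> cases b <;> cases c <;> simp [coeff, swap, swapAutCoeff]

/-- The automorphism of `B_λ` with `H ↦ -H`, `F ↦ √-1 G`, `G ↦ √-1 F`, `X ↦ Y`, `Y ↦ X`. -/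
noncomputable def swapAut (lam : ℂ) : B lam →ₐ[ℂ] B lam :=
  lift lam (fun a => swapAutCoeff a • gen lam (swap a))
    (by
      intro a b
      have hsw : Function.Involutive swap := by intro x; cases x <;> rfl
      have hp : ∀ x, parity (swap x) = parity x := by intro x; cases x <;> rfl
      simp only [smul_smul, ← coeff_swapAut]
      rw [hsw.bijective.sum_comp (fun c => ((coeff (swap a) (swap b) c : ℂ) *
        (swapAutCoeff a * swapAutCoeff b)) • gen lam c)]
      simp only [mul_comm _ (swapAutCoeff a * swapAutCoeff b),
        mul_smul (swapAutCoeff a * swapAutCoeff b), ← Finset.smul_sum]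
      rw [← gen_bracket, hp, hp]
      simp only [smul_mul_smul_comm, smul_sub, smul_smul]
      congr 2
      ring_nf)
    (by
      rw [← tau_sq, tau_eq]
      congr 1
      simp only [swapAutCoeff, swap, smul_mul_smul_comm, Complex.I_mul_I]
      rw [← G_mul_F, neg_smul, one_smul, neg_smul, one_smul]
      noncomm_ring)

theorem swapAut_gen (lam : ℂ) (a : OspGen) :
    swapAut lam (gen lam a) = swapAutCoeff a • gen lam (swap a) := lift_gen ..

theorem parityAut_swapAut {lam : ℂ} (u : B lam) :
    parityAut lam (swapAut lam u) = swapAut lam (parityAut lam u) := by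
  have h : (parityAut lam).comp (swapAut lam) = (swapAut lam).comp (parityAut lam) := by
    apply algHom_ext_FG <;> simp [swapAut_gen, swap, parity]
  exact DFunLike.congr_fun h u

theorem IsHomog.swapAut {lam : ℂ} {p : ℕ} {u : B lam} (hu : IsHomog p u) :
    IsHomog p (Osp12.swapAut lam u) := by
  unfold IsHomog at *
  rw [parityAut_swapAut, hu, map_smul]

theorem IsSupertrace.comp_swapAut {lam : ℂ} {L : B lam →ₗ[ℂ] ℂ} (hL : IsSupertrace L) :
    IsSupertrace (L.comp (Osp12.swapAut lam).toLinearMap) := by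
  intro p q u v hu hv
  have h := hL p q _ _ hu.swapAut hv.swapAut
  simpa only [LinearMap.comp_apply, AlgHom.toLinearMap_apply, map_sub, map_smul, map_mul] using h

theorem swapAut_tau (lam : ℂ) : swapAut lam (tau lam) = tau lam := by
  rw [tau_eq, map_sub, map_add, map_mul, map_mul, AlgHom.commutes, map_ofNat, swapAut_gen,
    swapAut_gen, swapAut_gen]
  simp only [swapAutCoeff, swap, smul_mul_smul_comm, Complex.I_mul_I]
  rw [← G_mul_F, neg_smul, one_smul, neg_smul, one_smul]
  noncomm_ring

theorem swapAut_ev (lam : ℂ) (f : Poly lam) :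
    swapAut lam (evHom lam f) = evHom lam (reflect f) := by
  induction f using Poly.induction with
  | hc c =>
    have h : reflect (cst lam c) = cst lam c := by simp [reflect, cst_eq_C]
    rw [h, evHom_cst, AlgHom.commutes]
  | hH =>
    have h : reflect (pH lam) = -pH lam := by simp [reflect, pH]
    rw [h, map_neg, evHom_pH, swapAut_gen]
    simp [swapAutCoeff, swap]
  | ht =>
    have h : reflect (pTau lam) = pTau lam := by simp [reflect, pTau]
    rw [h, evHom_pTau, swapAut_tau]
  | hadd f g hf hg =>
    have h : reflect (f + g) = reflect f + reflect g := by simp [reflect]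
    simp only [h, map_add, hf, hg]
  | hmul f g hf hg =>
    have h : reflect (f * g) = reflect f * reflect g := by simp [reflect]
    simp only [h, map_mul, hf, hg]

theorem reflect_reflect {lam : ℂ} (f : Poly lam) : reflect (reflect f) = f :=
  Polynomial.comp_neg_X_comp_neg_X f

/-- `swapAut` carries `f G^j F^j g` to `I^{2j} f(-H, τ) F^j G^j g(-H, τ)`; the inverse power of `I`
in the witness compensates. Composing `L` with `swapAut` gives a supertrace again, so orthogonality
for positive index can be reused. -/
theorem formNeg_reflect {lam : ℂ} (L : B lam →ₗ[ℂ] ℂ) (j : ℕ) :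
    ∃ s : ℂ, ∀ f g, formNeg L j (reflect f) (reflect g) =
      s * pairing (L.comp (swapAut lam).toLinearMap) j f g := by
  obtain ⟨s, hs⟩ := exists_transpose_ev_mul_F_pow lam j
  have hI : (Complex.I ^ j) ≠ 0 := pow_ne_zero _ Complex.I_ne_zero
  refine ⟨s * (Complex.I ^ j * Complex.I ^ j)⁻¹, fun f g => ?_⟩
  rw [formNeg, form, ev_eq, ev_eq, hs, mul_smul_comm, map_smul, smul_eq_mul, pairing,
    mul_assoc s]
  congr 1
  rw [LinearMap.comp_apply, AlgHom.toLinearMap_apply, map_mul (swapAut lam),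
    map_mul (swapAut lam), map_mul (swapAut lam), map_pow (swapAut lam), map_pow (swapAut lam),
    swapAut_ev, swapAut_ev, swapAut_gen, swapAut_gen, smul_pow, smul_pow, mul_smul_comm,
    smul_mul_assoc, smul_mul_assoc, mul_smul_comm, smul_smul, map_smul, smul_eq_mul]
  exact (inv_mul_cancel_left₀ (mul_ne_zero hI hI) _).symm

theorem IsFamily.isOrthogonalBasis_formNeg {lam : ℂ} {f : ℕ → ℕ → Poly lam} (hf : IsFamily lam f)
    {L : B lam →ₗ[ℂ] ℂ} (hL : IsSupertrace L) (j : ℕ) :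
    IsOrthogonalBasis (formNeg L j) (fun k => reflect (f k j)) := by
  have hd : ∀ k, wdeg (reflect (f k j)) = k := fun k => by
    rw [wdeg_reflect_eq_iff, hf.eq_hahnFamily, wdeg_hahnFamily]
  obtain ⟨s, hs⟩ := formNeg_reflect L j
  refine ⟨linearIndependent_of_wdeg hd, span_eq_top_of_wdeg hd, hd, fun k g hg => ?_,
    fun k l hkl => ?_⟩
  · rw [← reflect_reflect g, hs, pairing,
      hf.orthogonal hL.comp_swapAut ((wdeg_reflect_lt_iff g k).2 hg), mul_zero]
  · rw [hs, hf.pairing_eq_zero hL.comp_swapAut j hkl, mul_zero]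

/-! ### Weights -/

theorem mem_weightSpace {lam : ℂ} {i : ℤ} {u : B lam} :
    u ∈ weightSpace lam i ↔ gen lam .H * u - u * gen lam .H = (i : ℂ) • u := Iff.rfl

theorem mul_mem_weightSpace {lam : ℂ} {i j : ℤ} {u v : B lam} (hu : u ∈ weightSpace lam i)
    (hv : v ∈ weightSpace lam j) : u * v ∈ weightSpace lam (i + j) := by
  rw [mem_weightSpace] at *
  have h : gen lam .H * (u * v) - u * v * gen lam .H =
      (gen lam .H * u - u * gen lam .H) * v + u * (gen lam .H * v - v * gen lam .H) := by
    noncomm_ring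
  rw [h, hu, hv, smul_mul_assoc, mul_smul_comm, ← add_smul, Int.cast_add]

theorem parityAut_mem_weightSpace {lam : ℂ} {i : ℤ} {u : B lam} (hu : u ∈ weightSpace lam i) :
    parityAut lam u ∈ weightSpace lam i := by
  rw [mem_weightSpace] at *
  have h := congrArg (parityAut lam) hu
  rwa [map_sub, map_mul, map_mul, parityAut_H, map_smul] at h

theorem F_mem_weightSpace (lam : ℂ) : gen lam .F ∈ weightSpace lam (-1) := by
  rw [mem_weightSpace, H_mul_F]
  simp

theorem G_mem_weightSpace (lam : ℂ) : gen lam .G ∈ weightSpace lam 1 := by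
  rw [mem_weightSpace, H_mul_G]
  simp

theorem adF_mem_weightSpace {lam : ℂ} {i : ℤ} {u : B lam} (hu : u ∈ weightSpace lam i) :
    adF lam u ∈ weightSpace lam (i - 1) := by
  refine Submodule.sub_mem _ ?_
    (mul_mem_weightSpace (parityAut_mem_weightSpace hu) (F_mem_weightSpace lam))
  rw [sub_eq_add_neg, add_comm]
  exact mul_mem_weightSpace (F_mem_weightSpace lam) hu

theorem adG_mem_weightSpace {lam : ℂ} {i : ℤ} {u : B lam} (hu : u ∈ weightSpace lam i) :
    adG lam u ∈ weightSpace lam (i + 1) := by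
  refine Submodule.sub_mem _ ?_
    (mul_mem_weightSpace (parityAut_mem_weightSpace hu) (G_mem_weightSpace lam))
  rw [add_comm]
  exact mul_mem_weightSpace (G_mem_weightSpace lam) hu

theorem ev_mul_G_pow_mem_weightSpace (lam : ℂ) (f : Poly lam) (i : ℕ) :
    evHom lam f * gen lam .G ^ i ∈ weightSpace lam i := by
  rw [mem_weightSpace, H_commutator_ev_mul_G_pow]
  rfl

theorem ev_mul_F_pow_mem_weightSpace (lam : ℂ) (f : Poly lam) (i : ℕ) :
    evHom lam f * gen lam .F ^ i ∈ weightSpace lam (-i) := by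
  induction i with
  | zero => simpa using ev_mul_G_pow_mem_weightSpace lam f 0
  | succ i ih =>
    have h := mul_mem_weightSpace ih (F_mem_weightSpace lam)
    rw [mul_assoc, ← pow_succ (gen lam .F)] at h
    rwa [Nat.cast_succ, neg_add]

theorem transpose_mem_weightSpace {lam : ℂ} {i : ℤ} {u : B lam} (hu : u ∈ weightSpace lam i) :
    transpose lam u ∈ weightSpace lam (-i) := by
  have h : ∀ v ∈ weightSpace lam i, (ordTranspose lam v).unop ∈ weightSpace lam (-i) := by
    intro v hv
    rw [mem_weightSpace] at *
    have h := congrArg (fun w => (ordTranspose lam w).unop) hv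
    simp only [map_sub, map_mul, map_smul, MulOpposite.unop_sub, MulOpposite.unop_mul,
      MulOpposite.unop_smul, ordTranspose_gen, swap, swapCoeff, one_smul] at h
    rw [← neg_sub, h, Int.cast_neg, neg_smul]
  have hp := parityAut_mem_weightSpace hu
  exact Submodule.add_mem _ (Submodule.smul_mem _ _ (h _ (Submodule.add_mem _ hu hp)))
    (Submodule.smul_mem _ _ (h _ (Submodule.sub_mem _ hu hp)))

theorem IsSupertrace.form_eq_zero {lam : ℂ} {L : B lam →ₗ[ℂ] ℂ} (hL : IsSupertrace L) {i j : ℤ}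
    (hij : i ≠ j) {u v : B lam} (hu : u ∈ weightSpace lam i) (hv : v ∈ weightSpace lam j) :
    form L u v = 0 :=
  hL.eq_zero_of_weight (m := i + -j) (by omega)
    (mul_mem_weightSpace hu (transpose_mem_weightSpace hv))

/-! ### Existence and uniqueness of the supertrace -/

theorem hahnFamily_zero_zero (lam : ℂ) : hahnFamily lam 0 0 = 1 := by
  simpa [evenHahn, hyp32Cleared_zero] using hahnFamily_even_even lam 0 0

/-- Orthogonality to `1` in the form of index `0`. -/
theorem IsSupertrace.ev_hahnFamily {lam : ℂ} {L : B lam →ₗ[ℂ] ℂ} (hL : IsSupertrace L) {k : ℕ}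
    (hk : k ≠ 0) : L (evHom lam (hahnFamily lam k 0)) = 0 := by
  have h1 : wdeg (1 : Poly lam) < k := by
    rw [← hahnFamily_zero_zero, wdeg_hahnFamily]
    exact WithBot.coe_lt_coe.2 (Nat.pos_of_ne_zero hk)
  simpa using (isFamily_hahnFamily lam).orthogonal hL (j := 0) h1

theorem IsSupertrace.ext {lam : ℂ} {L L' : B lam →ₗ[ℂ] ℂ} (hL : IsSupertrace L)
    (hL' : IsSupertrace L') (h : L 1 = L' 1) : L = L' := by
  have hev : L.comp (evLin lam) = L'.comp (evLin lam) := by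
    refine LinearMap.ext_on_range (span_eq_top_of_wdeg fun k => wdeg_hahnFamily lam k 0) fun k => ?_
    change L (evHom lam _) = L' (evHom lam _)
    rcases eq_or_ne k 0 with rfl | hk
    · rw [hahnFamily_zero_zero, map_one, h]
    · rw [hL.ev_hahnFamily hk, hL'.ev_hahnFamily hk]
  refine LinearMap.ext fun u => ?_
  induction u using span_induction_B with
  | hG f i =>
    rcases eq_or_ne i 0 with rfl | hi
    · rw [pow_zero, mul_one]; exact LinearMap.congr_fun hev f
    · have hw := ev_mul_G_pow_mem_weightSpace lam f i
      rw [hL.eq_zero_of_weight (by exact_mod_cast hi) hw,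
        hL'.eq_zero_of_weight (by exact_mod_cast hi) hw]
  | hF f i =>
    rcases eq_or_ne i 0 with rfl | hi
    · rw [pow_zero, mul_one]; exact LinearMap.congr_fun hev f
    · have hw := ev_mul_F_pow_mem_weightSpace lam f i
      rw [hL.eq_zero_of_weight (neg_ne_zero.2 (by exact_mod_cast hi)) hw,
        hL'.eq_zero_of_weight (neg_ne_zero.2 (by exact_mod_cast hi)) hw]
  | hadd u v hu hv => rw [map_add, map_add, hu, hv]

/-- The functional on `ℂ[H, τ]` with the value `1` at `f_{0,0} = 1` and `0` at `f_{k,0}`,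
`k > 0`. -/
noncomputable def polyTrace (lam : ℂ) : Poly lam →ₗ[ℂ] ℂ :=
  (Module.Basis.mk (linearIndependent_of_wdeg fun k => wdeg_hahnFamily lam k 0)
    (span_eq_top_of_wdeg fun k => wdeg_hahnFamily lam k 0).ge).constr ℂ
      fun k => if k = 0 then 1 else 0

theorem polyTrace_hahnFamily (lam : ℂ) (k : ℕ) :
    polyTrace lam (hahnFamily lam k 0) = if k = 0 then 1 else 0 := by
  have h := (Module.Basis.mk (linearIndependent_of_wdeg fun k => wdeg_hahnFamily lam k 0)
    (span_eq_top_of_wdeg fun k => wdeg_hahnFamily lam k 0).ge).constr_basis ℂ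
      (fun k => if k = 0 then (1 : ℂ) else 0) k
  rwa [Module.Basis.mk_apply] at h

/-- The supertrace on `B_λ`. -/
noncomputable def str (lam : ℂ) : B lam →ₗ[ℂ] ℂ := (polyTrace lam).comp (coeffZero lam)

theorem str_ev (lam : ℂ) (f : Poly lam) : str lam (evHom lam f) = polyTrace lam f := by
  rw [str, LinearMap.comp_apply, coeffZero_ev]

/-- `H` acts on `e_0` and on coordinate `0` by the same polynomial, so `[H, u]` has no coefficient
there; hence neither has `u` when its weight is nonzero. -/
theorem str_eq_zero_of_weight {lam : ℂ} {m : ℤ} (hm : m ≠ 0) {u : B lam}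
    (hu : u ∈ weightSpace lam m) : str lam u = 0 := by
  have hH : repGen lam .H (Pi.single 0 1) = pH lam • (Pi.single 0 1 : ℤ → Poly lam) := by
    funext n
    rw [repGen_H, Pi.smul_apply, smul_eq_mul]
    rcases eq_or_ne n 0 with rfl | hn
    · simp
    · simp [hn]
  have h := congrArg (coeffZero lam) (mem_weightSpace.1 hu)
  have h0 : coeffZero lam (gen lam .H * u - u * gen lam .H) = 0 := by
    change rep lam _ _ 0 = 0
    rw [map_sub, map_mul, map_mul, LinearMap.sub_apply, Pi.sub_apply, Module.End.mul_apply,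
      Module.End.mul_apply, rep_gen, hH, map_smul, repGen_H, Pi.smul_apply, smul_eq_mul]
    simp
  rw [h0, map_smul] at h
  have h1 : coeffZero lam u = 0 :=
    (smul_eq_zero.1 h.symm).resolve_left (Int.cast_ne_zero.2 hm)
  rw [str, LinearMap.comp_apply, h1, map_zero]

/-- It suffices to take `f = f_{k,1}`: by the defining relations `[F, f_{k,1} G]` is `f_{k+2,0}` for
even `k` and `f_{k,0}` for odd `k`, and `str` is zero on both. -/
theorem str_adF_ev_mul_G (lam : ℂ) (f : Poly lam) :
    str lam (adF lam (evHom lam f * gen lam .G)) = 0 := by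
  have hF := isFamily_hahnFamily lam
  have hf : f ∈ Submodule.span ℂ (Set.range fun k => hahnFamily lam k 1) := by
    rw [span_eq_top_of_wdeg fun k => wdeg_hahnFamily lam k 1]
    trivial
  induction hf using Submodule.span_induction with
  | mem f hf =>
    obtain ⟨k, rfl⟩ := hf
    rcases Nat.even_or_odd k with hk | hk
    · have h1 := hF.even_odd k 0 hk
      have h2 := hF.even_even (k + 2) 0 (hk.add even_two)
      rw [mul_zero, zero_add, zero_add, pow_one, ev_eq] at h1
      rw [mul_zero, zero_add, pow_zero, mul_one, ev_eq] at h2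
      rw [h1, ← Function.iterate_succ_apply' (adF lam), show (k + 1).succ = k + 2 from rfl, ← h2,
        str_ev, polyTrace_hahnFamily, if_neg (by omega)]
    · have h1 := hF.odd_odd k 0 hk
      have h2 := hF.odd_even k 0 hk
      rw [mul_zero, zero_add, zero_add, pow_one, ev_eq] at h1
      rw [mul_zero, zero_add, pow_zero, mul_one, ev_eq] at h2
      rw [h1, ← Function.iterate_succ_apply' (adF lam), Nat.succ_eq_add_one,
        Nat.sub_add_cancel hk.pos, ← h2, str_ev, polyTrace_hahnFamily, if_neg hk.pos.ne']
  | zero => rw [map_zero, zero_mul, adF_zero, map_zero]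
  | add f g _ _ hf hg => rw [map_add, add_mul, adF_add, map_add, hf, hg, add_zero]
  | smul c f _ hf => rw [evHom_smul, smul_mul_assoc, adF_smul, map_smul, hf, smul_zero]

theorem str_adF (lam : ℂ) (u : B lam) : str lam (adF lam u) = 0 := by
  induction u using span_induction_B with
  | hG f i =>
    rcases eq_or_ne i 1 with rfl | hi
    · rw [pow_one]; exact str_adF_ev_mul_G lam f
    · exact str_eq_zero_of_weight (by omega)
        (adF_mem_weightSpace (ev_mul_G_pow_mem_weightSpace lam f i))
  | hF f i =>
    exact str_eq_zero_of_weight (by omega)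
      (adF_mem_weightSpace (ev_mul_F_pow_mem_weightSpace lam f i))
  | hadd u v hu hv => rw [adF_add, map_add, hu, hv, add_zero]

theorem str_adG (lam : ℂ) (u : B lam) : str lam (adG lam u) = 0 := by
  induction u using span_induction_B with
  | hG f i =>
    exact str_eq_zero_of_weight (by omega)
      (adG_mem_weightSpace (ev_mul_G_pow_mem_weightSpace lam f i))
  | hF f i =>
    rcases eq_or_ne i 1 with rfl | hi
    · have h : adG lam (evHom lam f * gen lam .F ^ 1) =
          adF lam (evHom lam (twist lam (-1) f) * gen lam .G) := by
        rw [← G_mul_ev, pow_one]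
        simp only [adF, adG, map_mul, parityAut_ev, parityAut_F, parityAut_G]
        have h2 : evHom lam f * gen lam .F * gen lam .G =
            gen lam .F * (gen lam .G * evHom lam f) := by
          rw [mul_assoc, ← mul_assoc (gen lam .F), F_mul_G_eq, ← map_mul, ← map_mul, mul_comm]
        rw [mul_neg, neg_mul, neg_mul, neg_mul, sub_neg_eq_add, sub_neg_eq_add, h2, mul_assoc,
          add_comm]
      rw [h]
      exact str_adF_ev_mul_G lam _
    · exact str_eq_zero_of_weight (by omega)
        (adG_mem_weightSpace (ev_mul_F_pow_mem_weightSpace lam f i))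
  | hadd u v hu hv =>
    have h : adG lam (u + v) = adG lam u + adG lam v := by
      simp only [adG, map_add]; noncomm_ring
    rw [h, map_add, hu, hv, add_zero]

theorem str_one (lam : ℂ) : str lam 1 = 1 := by
  rw [← map_one (evHom lam), str_ev, ← hahnFamily_zero_zero, polyTrace_hahnFamily, if_pos rfl]

/-- The element `u` of parity `p` supercommutes with everything under `str`. -/
def StrComm {lam : ℂ} (p : ℕ) (u : B lam) : Prop :=
  IsHomog p u ∧ ∀ (q : ℕ) (v : B lam), IsHomog q v →
    str lam (u * v) = (-1) ^ (p * q) * str lam (v * u)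

theorem StrComm.mul {lam : ℂ} {p q : ℕ} {u v : B lam} (hu : StrComm p u) (hv : StrComm q v) :
    StrComm (p + q) (u * v) := by
  refine ⟨hu.1.mul hv.1, fun r w hw => ?_⟩
  rw [mul_assoc, hu.2 _ _ (hv.1.mul hw), mul_assoc, hv.2 _ _ (hw.mul hu.1), mul_assoc w,
    ← mul_assoc, ← pow_add]
  -- Moving `v` and then `u` cyclically gives this exponent, which has the parity of `(p + q) r`.
  have h : p * (q + r) + q * (r + p) = (p + q) * r + 2 * (p * q) := by ring
  rw [h, pow_add, pow_mul _ 2]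
  norm_num

theorem StrComm.congr {lam : ℂ} {p q : ℕ} {u : B lam} (hu : StrComm p u)
    (h : (-1 : ℂ) ^ p = (-1) ^ q) : StrComm q u :=
  ⟨hu.1.congr h, fun r v hv => by rw [hu.2 r v hv, pow_mul, h, ← pow_mul]⟩

theorem StrComm.add {lam : ℂ} {p : ℕ} {u v : B lam} (hu : StrComm p u) (hv : StrComm p v) :
    StrComm p (u + v) := by
  refine ⟨?_, fun r w hw => ?_⟩
  · have h1 := hu.1
    have h2 := hv.1
    unfold IsHomog at *
    rw [map_add, h1, h2, smul_add]
  · rw [add_mul, mul_add, map_add, map_add, hu.2 r w hw, hv.2 r w hw, mul_add]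

theorem StrComm.smul {lam : ℂ} {p : ℕ} {u : B lam} (hu : StrComm p u) (c : ℂ) :
    StrComm p (c • u) := by
  refine ⟨hu.1.smul c, fun r w hw => ?_⟩
  rw [smul_mul_assoc, mul_smul_comm, map_smul, map_smul, hu.2 r w hw, smul_eq_mul, smul_eq_mul]
  ring

theorem strComm_zero (lam : ℂ) (p : ℕ) : StrComm p (0 : B lam) :=
  ⟨by simp [IsHomog], fun r w _ => by simp⟩

theorem strComm_F (lam : ℂ) : StrComm 1 (gen lam .F) := by
  refine ⟨isHomog_F lam, fun r w hw => ?_⟩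
  have h := str_adF lam w
  rwa [adF_homog hw, map_sub, map_smul, smul_eq_mul, sub_eq_zero, ← one_mul r] at h

theorem strComm_G (lam : ℂ) : StrComm 1 (gen lam .G) := by
  refine ⟨isHomog_G lam, fun r w hw => ?_⟩
  have h := str_adG lam w
  rwa [adG_homog hw, map_sub, map_smul, smul_eq_mul, sub_eq_zero, ← one_mul r] at h

/-- The sums on the right form a subspace containing `1` and stable under left multiplication by `F`
and `G`, hence all of `B_λ`. -/
theorem exists_strComm_decomp {lam : ℂ} (u : B lam) :
    ∃ u₀ u₁ : B lam, StrComm 0 u₀ ∧ StrComm 1 u₁ ∧ u = u₀ + u₁ := by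
  let S : Submodule ℂ (B lam) :=
    { carrier := {u | ∃ u₀ u₁ : B lam, StrComm 0 u₀ ∧ StrComm 1 u₁ ∧ u = u₀ + u₁}
      zero_mem' := ⟨0, 0, strComm_zero lam 0, strComm_zero lam 1, (add_zero 0).symm⟩
      add_mem' := by
        rintro _ _ ⟨u₀, u₁, h₀, h₁, rfl⟩ ⟨v₀, v₁, k₀, k₁, rfl⟩
        exact ⟨u₀ + v₀, u₁ + v₁, h₀.add k₀, h₁.add k₁, by abel⟩
      smul_mem' := by
        rintro c _ ⟨u₀, u₁, h₀, h₁, rfl⟩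
        exact ⟨c • u₀, c • u₁, h₀.smul c, h₁.smul c, smul_add _ _ _⟩ }
  have hmul : ∀ x : B lam, StrComm 1 x → ∀ u ∈ S, x * u ∈ S := by
    rintro x hx _ ⟨u₀, u₁, h₀, h₁, rfl⟩
    exact ⟨x * u₁, x * u₀, (hx.mul h₁).congr (by norm_num), hx.mul h₀, by rw [mul_add, add_comm]⟩
  have hone : StrComm 0 (1 : B lam) := ⟨by simp [IsHomog], fun r w _ => by simp⟩
  have htop : S = ⊤ := submodule_eq_top S ⟨1, 0, hone, strComm_zero lam 1, (add_zero 1).symm⟩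
    (hmul _ (strComm_F lam)) (hmul _ (strComm_G lam))
  have hu : u ∈ S := htop ▸ Submodule.mem_top
  exact hu

theorem isSupertrace_str (lam : ℂ) : IsSupertrace (str lam) := by
  intro p q u v hu hv
  obtain ⟨u₀, u₁, h₀, h₁, rfl⟩ := exists_strComm_decomp u
  have e₀ : parityAut lam u₀ = u₀ := by simpa [IsHomog] using h₀.1
  have e₁ : parityAut lam u₁ = -u₁ := by simpa [IsHomog] using h₁.1
  -- For `u` of parity `p`, the component of the opposite parity equals its own negative and is
  -- zero.
  have hS : StrComm p (u₀ + u₁) := by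
    rw [IsHomog, map_add, e₀, e₁] at hu
    rcases Nat.even_or_odd p with hp | hp
    · rw [hp.neg_one_pow, one_smul] at hu
      have h : (2 : ℂ) • u₁ = 0 := by
        rw [two_smul]; nth_rewrite 1 [← neg_neg u₁]; rw [add_left_cancel hu]; abel
      rw [(smul_eq_zero.1 h).resolve_left two_ne_zero, add_zero]
      exact h₀.congr (by rw [hp.neg_one_pow, pow_zero])
    · rw [hp.neg_one_pow, neg_one_smul, neg_add] at hu
      have h : (2 : ℂ) • u₀ = 0 := by
        have := add_right_cancel hu
        rw [two_smul]; nth_rewrite 1 [this]; abel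
      rw [(smul_eq_zero.1 h).resolve_left two_ne_zero, zero_add]
      exact h₁.congr (by rw [hp.neg_one_pow, pow_one])
  rw [map_sub, map_smul, smul_eq_mul, hS.2 q v hv, sub_self]

theorem existsUnique_supertrace (lam : ℂ) :
    ∃! L : B lam →ₗ[ℂ] ℂ, IsSupertrace L ∧ L 1 = 1 :=
  ⟨str lam, ⟨isSupertrace_str lam, str_one lam⟩, fun _ hL =>
    hL.1.ext (isSupertrace_str lam) (hL.2.trans (str_one lam).symm)⟩

/-! ### Invertibility of the Pochhammer factors -/

theorem isUnit_poch {A : Type*} [CommRing A] {a : A} {k : ℕ} (h : ∀ m : ℕ, IsUnit (a + m)) :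
    IsUnit (poch a k) := by
  induction k with
  | zero => rw [poch_zero]; exact isUnit_one
  | succ k ih => rw [poch_succ]; exact ih.mul (h k)

theorem isUnit_cst {lam a : ℂ} (ha : a ≠ 0) : IsUnit (cst lam a) :=
  (IsUnit.mk0 a ha).map (algebraMap ℂ (Poly lam))

/-- `(a - τ)(a + τ)` is the scalar `a² - (λ + 1/2)²`. -/
theorem isUnit_cst_sub_pTau {lam a : ℂ} (ha : a ^ 2 ≠ (lam + 1 / 2) ^ 2) :
    IsUnit (cst lam a - pTau lam) := by
  have h : (cst lam a - pTau lam) * (cst lam a + pTau lam) =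
      cst lam (a ^ 2 - (lam + 1 / 2) ^ 2) := by
    have ht : pTau lam ^ 2 = cst lam ((lam + 1 / 2) ^ 2) := pTau_sq lam
    rw [cst_sub, ← ht, cst_pow]; ring
  exact isUnit_of_mul_isUnit_left (h ▸ isUnit_cst (sub_ne_zero.2 ha))

theorem isUnit_poch_cst (lam : ℂ) {n : ℕ} (hn : n ≠ 0) (k : ℕ) : IsUnit (poch (cst lam n) k) := by
  refine isUnit_poch fun m => ?_
  rw [← cst_natCast, ← cst_add]
  exact isUnit_cst (by exact_mod_cast (show n + m ≠ 0 by omega))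

theorem isUnit_poch_cst_sub_pTau {lam : ℂ} (hlam : ∀ n : ℕ, lam ≠ n)
    (hlam' : ∀ n : ℕ, lam ≠ -(n + 1)) (n k : ℕ) :
    IsUnit (poch (cst lam (n + 1 / 2) - pTau lam) k) := by
  refine isUnit_poch fun m => ?_
  rw [← cst_natCast, sub_add_eq_add_sub, ← cst_add]
  refine isUnit_cst_sub_pTau fun h => ?_
  -- With `a = n + m + 1/2`, the equations `a = ±(λ + 1/2)` say that `λ = n + m` or `λ = -(n + m +
  -- 1)`.
  rcases sq_eq_sq_iff_eq_or_eq_neg.1 h with h | h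
  · exact hlam (n + m) (by push_cast; linear_combination -h)
  · exact hlam' (n + m) (by push_cast; linear_combination h)

end Osp12

theorem theorem2p2 (lam : ℂ) (hlam : ∀ n : ℕ, lam ≠ n) (hlam' : lam ≠ -1 / 2) :
    -- the supertrace exists and is unique up to a scalar
    (∃! L : B lam →ₗ[ℂ] ℂ, IsSupertrace L ∧ L 1 = 1) ∧
    -- the polynomials `f_{k,j}` are well defined
    (∃! f : ℕ → ℕ → Poly lam, IsFamily lam f) ∧
    -- 1) the graded pieces are mutually orthogonal
    (∀ L : B lam →ₗ[ℂ] ℂ, IsSupertrace L → ∀ i j : ℤ, i ≠ j →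
      ∀ u ∈ weightSpace lam i, ∀ v ∈ weightSpace lam j, form L u v = 0) ∧
    ∀ f : ℕ → ℕ → Poly lam, IsFamily lam f →
      -- 2) orthogonality and degrees for the form with index `j`
      (∀ L : B lam →ₗ[ℂ] ℂ, IsSupertrace L → ∀ j : ℕ,
        IsOrthogonalBasis (formPos L j) (fun k => f k j)) ∧
      -- 3) the action of `τ`, even `j`
      (∀ k i : ℕ,
        (pH lam - pTau lam + cst lam (1 / 2)) * Del (Nab (f k (2 * i))) +
            2 * (pH lam - cst lam i) * Nab (f k (2 * i)) +
            cst lam (2 * i + 1 / 2) * f k (2 * i) =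
          cst lam ((-1) ^ k * (2 * i + k + 1 / 2)) * f k (2 * i)) ∧
      -- 4) the action of `τ`, odd `j`
      (∀ k i : ℕ,
        (pH lam - pTau lam + cst lam (1 / 2)) * Del (Nab (f k (2 * i + 1))) +
            2 * (pH lam - pTau lam - cst lam (i + 1 / 2)) * Nab (f k (2 * i + 1)) +
            cst lam (2 * i + 5 / 2) * f k (2 * i + 1) =
          (if Even k then cst lam (2 * i + k + 5 / 2) else -cst lam (2 * i + k + 1 / 2)) *
            f k (2 * i + 1)) ∧
      -- 5) orthogonality and degrees for the form with index `-j`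
      (∀ L : B lam →ₗ[ℂ] ℂ, IsSupertrace L → ∀ j : ℕ,
        IsOrthogonalBasis (formNeg L j) (fun k => reflect (f k j))) ∧
      -- 6) the action of the Casimir element of `sl(2)`, even `j`
      (∀ k i : ℕ,
        ((pH lam + 1) ^ 2 - (pTau lam + cst lam (1 / 2)) ^ 2) * Del2 (Nab2 (f k (2 * i))) +
            cst lam (4 * (i + 1)) * (pH lam - cst lam i) * Nab2 (f k (2 * i)) +
            cst lam (4 * i * (i + 1)) * f k (2 * i) =
          (if Even k then cst lam ((2 * i + k) * (2 * i + k + 2))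
            else cst lam ((2 * i + k - 1) * (2 * i + k + 1))) * f k (2 * i)) ∧
      -- 7) the action of the Casimir element of `sl(2)`, odd `j`
      (∀ k i : ℕ,
        ((pH lam + 1) ^ 2 - (pTau lam + cst lam (1 / 2)) ^ 2) * Del2 (Nab2 (f k (2 * i + 1))) +
            (cst lam (2 * i + 3) * (2 * pH lam - cst lam (2 * i + 1)) - 2 * pTau lam) *
              Nab2 (f k (2 * i + 1)) +
            cst lam ((2 * i + 1) * (2 * i + 3)) * f k (2 * i + 1) =
          (if Even k then cst lam ((2 * i + k + 1) * (2 * i + k + 3))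
            else cst lam ((2 * i + k) * (2 * i + k + 2))) * f k (2 * i + 1)) ∧
      -- 8) Hahn polynomials, even `j`
      (∀ k i : ℕ,
        f (2 * k) (2 * i) =
            hyp32Cleared k (cst lam (k + 2 * i + 1))
              (cst lam (1 / 2) * (cst lam (2 * i + 1 / 2) - pTau lam - pH lam))
              (cst lam (i + 1)) (cst lam (i + 1 / 2) - pTau lam) ∧
        ((∀ n : ℕ, lam ≠ -(n + 1)) →
          IsUnit (poch (cst lam (i + 1)) k) ∧ IsUnit (poch (cst lam (i + 1 / 2) - pTau lam) k) ∧
          f (2 * k) (2 * i) =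
            poch (cst lam (i + 1)) k * poch (cst lam (i + 1 / 2) - pTau lam) k *
              hyp32 k (cst lam (k + 2 * i + 1))
                (cst lam (1 / 2) * (cst lam (2 * i + 1 / 2) - pTau lam - pH lam))
                (cst lam (i + 1)) (cst lam (i + 1 / 2) - pTau lam)) ∧
        f (2 * k + 1) (2 * i) =
          cst lam (1 / 2) * (cst lam (2 * k + 2 * i + 1) * pTau lam -
            cst lam (2 * (lam + 1 / 2) ^ 2)) * f (2 * k) (2 * i)) ∧
      -- 9) Hahn polynomials, odd `j`
      (∀ k i : ℕ,
        f (2 * k) (2 * i + 1) =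
            cst lam (i + k + 1) * hyp32Cleared k (cst lam (k + 2 * i + 2))
              (cst lam (1 / 2) * (cst lam (2 * i + 5 / 2) - pTau lam - pH lam))
              (cst lam (i + 2)) (cst lam (i + 3 / 2) - pTau lam) ∧
        ((∀ n : ℕ, lam ≠ -(n + 1)) →
          IsUnit (poch (cst lam (i + 2)) k) ∧ IsUnit (poch (cst lam (i + 3 / 2) - pTau lam) k) ∧
          f (2 * k) (2 * i + 1) =
            cst lam (i + k + 1) * poch (cst lam (i + 2)) k *
              poch (cst lam (i + 3 / 2) - pTau lam) k *
              hyp32 k (cst lam (k + 2 * i + 2))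
                (cst lam (1 / 2) * (cst lam (2 * i + 5 / 2) - pTau lam - pH lam))
                (cst lam (i + 2)) (cst lam (i + 3 / 2) - pTau lam)) ∧
        f (2 * k + 1) (2 * i + 1) =
          -(cst lam (1 / (i + k + 1)) * pTau lam) * f (2 * k) (2 * i + 1)) := by
  refine ⟨existsUnique_supertrace lam, ⟨hahnFamily lam, isFamily_hahnFamily lam, fun g hg =>
    hg.eq_hahnFamily⟩, fun L hL i j hij u hu v hv => hL.form_eq_zero hij hu hv, fun f hf =>
    ⟨fun L hL j => hf.isOrthogonalBasis_formPos hL j, hf.tau_action_even, hf.tau_action_odd,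
      fun L hL j => hf.isOrthogonalBasis_formNeg hL j, hf.casimir_action_even,
      hf.casimir_action_odd, fun k i => ?_, fun k i => ?_⟩⟩
  · rw [hf.eq_hahnFamily]
    refine ⟨?_, fun hneg => ?_, ?_⟩
    · rw [hahnFamily_even_even, evenHahn]
    · have h1 : IsUnit (poch (cst lam (i + 1)) k) := by
        exact_mod_cast isUnit_poch_cst lam i.succ_ne_zero k
      have h2 := isUnit_poch_cst_sub_pTau hlam hneg i k
      exact ⟨h1, h2, by rw [hahnFamily_even_even, evenHahn, hyp32Cleared_eq _ _ _ _ _ h1 h2]⟩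
    · rw [hahnFamily_odd_even, hahnFamily_even_even]
  · rw [hf.eq_hahnFamily]
    refine ⟨?_, fun hneg => ?_, ?_⟩
    · rw [hahnFamily_even_odd, oddHahn]
    · have h1 : IsUnit (poch (cst lam (i + 2)) k) := by
        exact_mod_cast isUnit_poch_cst lam (i + 1).succ_ne_zero k
      have h2 : IsUnit (poch (cst lam (i + 3 / 2) - pTau lam) k) := by
        have h := isUnit_poch_cst_sub_pTau hlam hneg (i + 1) k
        rwa [show ((i + 1 : ℕ) : ℂ) + 1 / 2 = i + 3 / 2 by push_cast; ring] at h
      refine ⟨h1, h2, ?_⟩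
      rw [hahnFamily_even_odd, oddHahn, hyp32Cleared_eq _ _ _ _ _ h1 h2]
      ring
    · have hk : (i + k + 1 : ℂ) ≠ 0 := by exact_mod_cast (i + k).succ_ne_zero
      have h : cst lam (1 / (i + k + 1)) * cst lam (i + k + 1) = 1 := by
        rw [← cst_mul, one_div_mul_cancel hk, cst_one]
      rw [hahnFamily_odd_odd, hahnFamily_even_odd]
      linear_combination (pTau lam * oddHahn lam k i) * h
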